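/- Let $n, m, p, q$ be non-negative integers with $p+q \le m \le n$, and consider forms on $\mathbb{C}^n$ with constant complex coefficients; write $\Lambda^{p,q}$ for the space of such forms of type $(p,q)$. An $(n,n)$-form is called positive if it is a positive real multiple of $\bigwedge_{j=1}^n (i\,dz_j\wedge d\bar z_j)$. Let $\omega = i\sum_{j,k} h_{jk}\,dz_j\wedge d\bar z_k$, with $(h_{jk})$ positive definite Hermitian, be a Kähler metric on $\mathbb{C}^n$, and let $\Gamma$ be a positive $(n,n)$-form (a volume form). Let $\alpha_1,\dots,\alpha_{m-p-q+1}$ be real $(1,1)$-forms such that each $\alpha_j$ is (a) $m$-positive with respect to $\omega$, that is, $\alpha_j^k\wedge\omega^{n-k}>0$ for all $1\le k\le m$, and (b) semipositive, that is, $\alpha_j = i\sum_{k,l} a_{kl}\,dz_k\wedge d\bar z_l$ with $(a_{kl})$ positive semidefinite Hermitian. Set $\Omega = \omega^{n-m}\wedge\alpha_1\wedge\cdots\wedge\alpha_{m-p-q}$ and $$P^{p,q} = \{\Phi\in\Lambda^{p,q} : \Omega\wedge\alpha_{m-p-q+1}\wedge\Phi = 0\}.$$ Then the sesquilinear form $$Q(\Phi,\Psi)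 = i^{\,q-p}(-1)^{(p+q)(p+q+1)/2}\;\frac{\Omega\wedge\Phi\wedge\overline{\Psi}}{\Gamma}$$ is Hermitian and positive definite on $P^{p,q}$. -/

import Mathlib

namespace LinearHRR

noncomputable section

/-- The complexified real cotangent space of `ℂ^n`: real-linear maps `ℂ^n → ℂ`. -/
abbrev Cotangent (n : ℕ) : Type := (Fin n → ℂ) →ₗ[ℝ] ℂ

/-- Complex-valued differential forms on `ℂ^n` with constant coefficients, of all degrees.
The product `*` is the wedge product. -/
abbrev Forms (n : ℕ) : Type := ExteriorAlgebra ℂ (Cotangent n)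

/-- The coordinate form `dz_j`. -/
def dz {n : ℕ} (j : Fin n) : Forms n :=
  ExteriorAlgebra.ι ℂ ((LinearMap.proj j : (Fin n → ℂ) →ₗ[ℂ] ℂ).restrictScalars ℝ)

/-- Complex conjugation of real-linear functionals. -/
def conjCotangent {n : ℕ} (ξ : Cotangent n) : Cotangent n :=
  Complex.conjAe.toLinearMap ∘ₗ ξ

/-- The coordinate form `dz̄_j`. -/
def dzbar {n : ℕ} (j : Fin n) : Forms n :=
  ExteriorAlgebra.ι ℂ
    (conjCotangent ((LinearMap.proj j : (Fin n → ℂ) →ₗ[ℂ] ℂ).restrictScalars ℝ))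

/-! ### Complex conjugation of forms -/

/-- The ring of forms, with scalars acting through complex conjugation. It only serves to
construct the conjugate-linear map `conj`. -/
def ConjForms (n : ℕ) : Type := Forms n

instance (n : ℕ) : Ring (ConjForms n) := inferInstanceAs (Ring (Forms n))

instance (n : ℕ) : Algebra ℂ (ConjForms n) :=
  RingHom.toAlgebra' ((algebraMap ℂ (Forms n)).comp (starRingEnd ℂ))
    (fun c x => Algebra.commutes (A := Forms n) (starRingEnd ℂ c) x)

theorem ConjForms.smul_eq {n : ℕ} (c : ℂ) (x : Forms n) :
    (HSMul.hSMul c (show ConjForms n from x) : ConjForms n) =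
      (HSMul.hSMul (starRingEnd ℂ c) x : Forms n) :=
  (Algebra.smul_def (A := Forms n) (starRingEnd ℂ c) x).symm

/-- Conjugation on 1-forms. -/
def conjOne (n : ℕ) : Cotangent n →ₗ[ℂ] ConjForms n where
  toFun ξ := (ExteriorAlgebra.ι ℂ (conjCotangent ξ) : Forms n)
  map_add' ξ η := by
    have h : conjCotangent (ξ + η) = conjCotangent ξ + conjCotangent η := by
      ext v
      simp [conjCotangent]
    rw [h, map_add]
    rfl
  map_smul' c ξ := by
    have h : conjCotangent (c • ξ) = (starRingEnd ℂ c) • conjCotangent ξ := by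
      ext v
      simp [conjCotangent]
    rw [h, map_smul]
    exact (ConjForms.smul_eq c _).symm

/-- Complex conjugation `Ψ ↦ Ψ̄`, the conjugate-linear ring homomorphism that conjugates
1-forms pointwise. -/
def conj {n : ℕ} : Forms n →+* Forms n :=
  (ExteriorAlgebra.lift ℂ ⟨conjOne n, fun ξ =>
    (ExteriorAlgebra.ι_sq_zero (R := ℂ) (conjCotangent ξ))⟩ : Forms n →ₐ[ℂ] ConjForms n).toRingHom

theorem conj_ι {n : ℕ} (ξ : Cotangent n) :
    conj (ExteriorAlgebra.ι ℂ ξ) = ExteriorAlgebra.ι ℂ (conjCotangent ξ) :=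
  ExteriorAlgebra.lift_ι_apply ℂ (A := ConjForms n) (conjOne n) _ ξ

theorem conj_smul {n : ℕ} (c : ℂ) (x : Forms n) :
    conj (c • x) = (starRingEnd ℂ c) • conj x := by
  rw [← ConjForms.smul_eq]
  exact map_smul (ExteriorAlgebra.lift ℂ ⟨conjOne n, fun ξ =>
    (ExteriorAlgebra.ι_sq_zero (R := ℂ) (conjCotangent ξ))⟩ : Forms n →ₐ[ℂ] ConjForms n) c x

/-! ### Types of forms and positivity -/

/-- The space `Λ^{p,q}` of forms of type `(p,q)`: the span of all wedge products of `p` of the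
forms `dz_j` followed by `q` of the forms `dz̄_j`. -/
def formsOfType (n p q : ℕ) : Submodule ℂ (Forms n) :=
  Submodule.span ℂ (Set.range (dz (n := n))) ^ p *
    Submodule.span ℂ (Set.range (dzbar (n := n))) ^ q

/-- Real `(1,1)`-forms. -/
def IsRealOneOne {n : ℕ} (α : Forms n) : Prop :=
  α ∈ formsOfType n 1 1 ∧ conj α = α

/-- The `(1,1)`-form `i ∑ a_{jk} dz_j ∧ dz̄_k` of a matrix `(a_{jk})`. -/
def formOfMatrix {n : ℕ} (A : Matrix (Fin n) (Fin n) ℂ) : Forms n :=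
  Complex.I • ∑ j, ∑ k, A j k • (dz j * dzbar k)

open scoped ComplexOrder in
/-- Kähler metrics with constant coefficients, identified with their `(1,1)`-forms. -/
def IsKahler {n : ℕ} (ω : Forms n) : Prop :=
  ∃ A : Matrix (Fin n) (Fin n) ℂ, A.PosDef ∧ ω = formOfMatrix A

open scoped ComplexOrder in
/-- Semipositive `(1,1)`-forms. -/
def IsSemipositive {n : ℕ} (α : Forms n) : Prop :=
  ∃ A : Matrix (Fin n) (Fin n) ℂ, A.PosSemidef ∧ α = formOfMatrix A

/-- The form `(i dz_1 ∧ dz̄_1) ∧ ... ∧ (i dz_n ∧ dz̄_n)`. -/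
def stdVolume (n : ℕ) : Forms n :=
  (List.ofFn fun j : Fin n => Complex.I • (dz j * dzbar j)).prod

/-- Strictly positive `(n,n)`-forms, that is, volume forms (for the complex orientation). -/
def IsPositiveTop {n : ℕ} (Γ : Forms n) : Prop :=
  ∃ c : ℝ, 0 < c ∧ Γ = (c : ℂ) • stdVolume n

/-- `α` is `m`-positive with respect to `ω`: `α^k ∧ ω^{n-k} > 0` for `1 ≤ k ≤ m`. -/
def IsMPositive {n : ℕ} (m : ℕ) (ω α : Forms n) : Prop :=
  IsRealOneOne α ∧ ∀ k : ℕ, 1 ≤ k → k ≤ m → IsPositiveTop (α ^ k * ω ^ (n - k))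

/-! ### The form `Q` and primitive forms -/

open Classical in
/-- The quotient `η / Γ` of an `(n,n)`-form `η` by a volume form `Γ`: the number `t` with
`η = t Γ` (and `0` if there is none, which does not happen for `η` of type `(n,n)`). -/
def divTop {n : ℕ} (η Γ : Forms n) : ℂ :=
  if h : ∃ t : ℂ, η = t • Γ then h.choose else 0

/-- `Q(Φ, Ψ) = i^{q-p} (-1)^{(p+q)(p+q+1)/2} Ω ∧ Φ ∧ Ψ̄ / Γ`. -/
def Q {n : ℕ} (p q : ℕ) (Ω Γ Φ Ψ : Forms n) : ℂ :=
  Complex.I ^ ((q : ℤ) - (p : ℤ)) * (-1 : ℂ) ^ ((p + q) * (p + q + 1) / 2) *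
    divTop (Ω * Φ * conj Ψ) Γ

/-- The space of `(p,q)`-forms that are primitive with respect to `Θ`. -/
def primitiveForms {n : ℕ} (p q : ℕ) (Θ : Forms n) : Submodule ℂ (Forms n) :=
  formsOfType n p q ⊓ LinearMap.ker (LinearMap.mulLeft ℂ Θ)

/-- A sesquilinear form is (Hermitian and) positive definite on the subspace `P`. -/
def IsPositiveDefiniteOn {n : ℕ} (B : Forms n → Forms n → ℂ) (P : Submodule ℂ (Forms n)) : Prop :=
  (∀ Φ ∈ P, ∀ Ψ ∈ P, B Ψ Φ = starRingEnd ℂ (B Φ Ψ)) ∧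
    ∀ Φ ∈ P, Φ ≠ 0 → (B Φ Φ).im = 0 ∧ 0 < (B Φ Φ).re

/-- `Ω = ω^{n-m} ∧ α_1 ∧ ... ∧ α_r`. -/
def mixedForm {n r : ℕ} (m : ℕ) (ω : Forms n) (α : Fin r → Forms n) : Forms n :=
  ω ^ (n - m) * (List.ofFn α).prod

end

end LinearHRR

/-! The relations are proved for all forms of a given degree k at once. With C the Weil operator and
x ↦ x* the conjugate-linear reversal, `pairing` sends (x, y) to the integral of z ∧ Cx ∧ y*. On
forms of type (p,q), C is the scalar i^{p-q}, and the signs of Q are such that Q is this pairing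
divided by a positive constant (`Q_eq_pairing`).

In a coframe diagonalising the metric, ω = ∑ i e_j ∧ ē_j. A semipositive form is a sum of squares i
w ∧ w̄, and α^m ≠ 0 forces the vectors w to span a space of dimension at least m. This (`IsGood`) is
all that is retained about the α_j.

Multiplication by the squares of s orthonormal vectors (`flag`) amounts to restriction to the
subspace of codimension s on which these vectors vanish. The mixed Lefschetz property L(s)
(injectivity modulo the kernel of the flag) and the mixed Hodge–Riemann property HR(s) are proved
together by descending induction on s (`lefschetz_and_hodgeRiemann`).

HR(s+1) implies L(s): suppose Ω' ∧ α kills x, where α = ∑ i w ∧ w̄. For each w, x is primitive on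
the hyperplane w = 0, so its pairing there is nonnegative. These values add up to the pairing of x
with Ω' ∧ α ∧ x = 0, so each vanishes and x restricts to zero on every hyperplane w = 0. As the w
span enough dimensions, x = 0 (`flag_mul_eq_zero`). When no α is left, L(s) is the classical hard
Lefschetz theorem.

L(s) implies HR(s): move all the α_j to ω along segments. By L(s) the pairing stays nondegenerate on
k-forms and on the image of (k-2)-forms under α, so definiteness on the primitive forms cannot
change along the way (`pos_of_deformation`). At the end of the segment it is the classical relation
for ω.

The classical relation comes from `exp_form_pos`: twisting by the exponentials of ∓Λ, where Λ is
contraction with ω, gives a positive definite form on the whole algebra, by induction on the number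
of directions. On a primitive form these exponentials act trivially, and degree reasons leave only
the required power of ω. -/

namespace LinearHRR

noncomputable section

open ExteriorAlgebra

variable {n : ℕ}

/-! ### Contractions -/

/-- Covectors on the complexified cotangent space. -/
abbrev Covector (n : ℕ) : Type := Module.Dual ℂ (Cotangent n)

/-- Contraction of forms with a covector. -/
def contract (d : Covector n) : Forms n →ₗ[ℂ] Forms n := CliffordAlgebra.contractLeft d

theorem contract_ι_mul (d : Covector n) (ξ : Cotangent n) (x : Forms n) :
    contract d (ι ℂ ξ * x) = d ξ • x - ι ℂ ξ * contract d x :=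
  CliffordAlgebra.contractLeft_ι_mul d ξ x

theorem contract_contract (d : Covector n) (x : Forms n) : contract d (contract d x) = 0 :=
  CliffordAlgebra.contractLeft_contractLeft d x

theorem contract_comm (d d' : Covector n) (x : Forms n) :
    contract d (contract d' x) = -contract d' (contract d x) :=
  CliffordAlgebra.contractLeft_comm d d' x

theorem contract_algebraMap (d : Covector n) (c : ℂ) :
    contract d (algebraMap ℂ (Forms n) c) = 0 :=
  CliffordAlgebra.contractLeft_algebraMap _ d c

theorem contract_one (d : Covector n) : contract d (1 : Forms n) = 0 :=
  CliffordAlgebra.contractLeft_one _ d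

theorem contract_ι_mul_ι_mul (d : Covector n) (ξ η : Cotangent n) (x : Forms n) :
    contract d (ι ℂ ξ * ι ℂ η * x) =
      d ξ • (ι ℂ η * x) - d η • (ι ℂ ξ * x) + ι ℂ ξ * ι ℂ η * contract d x := by
  rw [mul_assoc, contract_ι_mul, contract_ι_mul, mul_sub, mul_smul_comm, mul_assoc]
  abel

theorem ι_mul_ι_comm (ξ η : Cotangent n) :
    (ι ℂ ξ * ι ℂ η : Forms n) = -(ι ℂ η * ι ℂ ξ) :=
  eq_neg_of_add_eq_zero_left (ι_add_mul_swap ξ η)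

theorem ι_mul_ι_mul_comm (ξ η : Cotangent n) (x : Forms n) :
    ι ℂ ξ * (ι ℂ η * x) = -(ι ℂ η * (ι ℂ ξ * x)) := by
  rw [← mul_assoc, ι_mul_ι_comm, neg_mul, mul_assoc]

theorem ι_mul_ι_mul_self (ξ : Cotangent n) (x : Forms n) : ι ℂ ξ * (ι ℂ ξ * x) = 0 := by
  rw [← mul_assoc, ι_sq_zero, zero_mul]

/-- Induction on forms by left multiplication with 1-forms. -/
theorem forms_induction {P : Forms n → Prop} (algebraMap : ∀ c, P (algebraMap ℂ (Forms n) c))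
    (add : ∀ x y, P x → P y → P (x + y)) (ι_mul : ∀ ξ x, P x → P (ι ℂ ξ * x)) (x : Forms n) :
    P x :=
  CliffordAlgebra.left_induction (Q := (0 : QuadraticForm ℂ (Cotangent n))) algebraMap add
    (fun x m h => ι_mul m x h) x

/-! ### The center -/

/-- The center of the algebra of forms. -/
abbrev CentralForms (n : ℕ) : Subalgebra ℂ (Forms n) := Subalgebra.center ℂ (Forms n)

/-- Moving a 1-form past two others changes the sign twice. Products of (1,1)-forms thus live in the
commutative algebra `CentralForms`, where `ring` and finite products are available. -/
theorem ι_mul_ι_mem_center (ξ η : Cotangent n) : (ι ℂ ξ * ι ℂ η : Forms n) ∈ CentralForms n := by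
  rw [Subalgebra.mem_center_iff]
  intro x
  induction x using forms_induction with
  | algebraMap c => exact Algebra.commutes c _
  | add x y hx hy => rw [add_mul, mul_add, hx, hy]
  | ι_mul ζ x hx =>
    rw [mul_assoc, hx, ← mul_assoc, ← mul_assoc, ← mul_assoc]
    congr 1
    rw [ι_mul_ι_comm ζ ξ, neg_mul, mul_assoc, ι_mul_ι_comm ζ η, mul_neg, neg_neg, mul_assoc]

theorem central_comm (z : CentralForms n) (x : Forms n) : (z : Forms n) * x = x * z :=
  (Subalgebra.mem_center_iff.mp z.2 x).symm

theorem central_mul_left_comm (z : CentralForms n) (x y : Forms n) :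
    (z : Forms n) * (x * y) = x * (z * y) := by
  rw [← mul_assoc, central_comm, mul_assoc]

/-- The real `(1,1)`-form `i ξ ∧ ξ̄`. -/
def theta (ξ : Cotangent n) : CentralForms n :=
  ⟨Complex.I • (ι ℂ ξ * ι ℂ (conjCotangent ξ)),
    Subalgebra.smul_mem _ (ι_mul_ι_mem_center _ _) _⟩

theorem coe_theta (ξ : Cotangent n) :
    (theta ξ : Forms n) = Complex.I • (ι ℂ ξ * ι ℂ (conjCotangent ξ)) := rfl

theorem ι_mul_theta_mul (ξ : Cotangent n) (x : Forms n) : ι ℂ ξ * (theta ξ * x) = 0 := by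
  rw [coe_theta, smul_mul_assoc, mul_smul_comm, mul_assoc, ι_mul_ι_mul_self, smul_zero]

theorem ι_conj_mul_theta_mul (ξ : Cotangent n) (x : Forms n) :
    ι ℂ (conjCotangent ξ) * (theta ξ * x) = 0 := by
  rw [coe_theta, smul_mul_assoc, mul_smul_comm, mul_assoc, ι_mul_ι_mul_comm, ι_mul_ι_mul_self,
    mul_zero, neg_zero, smul_zero]

theorem theta_mul_theta_mul (ξ : Cotangent n) (x : Forms n) :
    (theta ξ : Forms n) * (theta ξ * x) = 0 := by
  conv_lhs => rw [coe_theta, smul_mul_assoc, mul_assoc, ← coe_theta, ι_conj_mul_theta_mul]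
  rw [mul_zero, smul_zero]

theorem theta_mul_self (ξ : Cotangent n) : theta ξ * theta ξ = 0 := by
  apply Subtype.ext
  have h := theta_mul_theta_mul ξ 1
  rwa [mul_one] at h

theorem contract_theta_mul (d : Covector n) (ξ : Cotangent n) (x : Forms n) :
    contract d (theta ξ * x) = Complex.I • (d ξ • (ι ℂ (conjCotangent ξ) * x)
      - d (conjCotangent ξ) • (ι ℂ ξ * x)) + theta ξ * contract d x := by
  rw [coe_theta, smul_mul_assoc, map_smul, contract_ι_mul_ι_mul, smul_add, smul_mul_assoc]

/-! ### Conjugation, the Weil operator and the adjoint -/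

theorem conjCotangent_conjCotangent (ξ : Cotangent n) :
    conjCotangent (conjCotangent ξ) = ξ := by
  ext v; simp [conjCotangent]

theorem conjCotangent_add (ξ η : Cotangent n) :
    conjCotangent (ξ + η) = conjCotangent ξ + conjCotangent η := by
  ext v; simp [conjCotangent]

theorem conjCotangent_smul (c : ℂ) (ξ : Cotangent n) :
    conjCotangent (c • ξ) = starRingEnd ℂ c • conjCotangent ξ := by
  ext v; simp [conjCotangent]

theorem conjCotangent_zero : conjCotangent (0 : Cotangent n) = 0 := by
  ext v; simp [conjCotangent]

theorem conj_algebraMap (c : ℂ) :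
    conj (algebraMap ℂ (Forms n) c) = algebraMap ℂ (Forms n) (starRingEnd ℂ c) := by
  rw [Algebra.algebraMap_eq_smul_one, conj_smul, map_one, Algebra.algebraMap_eq_smul_one]

/-- Precomposition of real-linear functionals with multiplication by `i`. -/
def rotate (n : ℕ) : Cotangent n →ₗ[ℂ] Cotangent n where
  toFun ξ := ξ ∘ₗ (LinearMap.lsmul ℂ (Fin n → ℂ) Complex.I).restrictScalars ℝ
  map_add' _ _ := rfl
  map_smul' _ _ := rfl

theorem rotate_apply (ξ : Cotangent n) (v : Fin n → ℂ) : rotate n ξ v = ξ (Complex.I • v) := rfl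

theorem rotate_rotate (ξ : Cotangent n) : rotate n (rotate n ξ) = -ξ := by
  refine LinearMap.ext fun v => ?_
  rw [rotate_apply, rotate_apply, smul_smul, Complex.I_mul_I, neg_one_smul, map_neg]
  rfl

theorem rotate_conjCotangent (ξ : Cotangent n) :
    rotate n (conjCotangent ξ) = conjCotangent (rotate n ξ) := rfl

/-- The Weil operator, acting on `(p,q)`-forms as `i^{p-q}`. -/
def weil : Forms n →ₐ[ℂ] Forms n := ExteriorAlgebra.map (rotate n)

theorem weil_ι (ξ : Cotangent n) : weil (ι ℂ ξ) = ι ℂ (rotate n ξ) := map_apply_ι _ _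

theorem weil_conj (x : Forms n) : weil (conj x) = conj (weil x) := by
  induction x using forms_induction with
  | algebraMap c => simp [conj_algebraMap]
  | add x y hx hy => rw [map_add, map_add, map_add, map_add, hx, hy]
  | ι_mul ξ x hx =>
    rw [map_mul, map_mul, map_mul, map_mul, conj_ι, weil_ι, weil_ι, conj_ι, hx]
    rfl

/-- The grading involution. -/
def parity : Forms n →ₐ[ℂ] Forms n := CliffordAlgebra.involute

theorem parity_ι (ξ : Cotangent n) : parity (ι ℂ ξ) = -ι ℂ ξ := CliffordAlgebra.involute_ι ξ

theorem weil_weil (x : Forms n) : weil (weil x) = parity x := by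
  induction x using forms_induction with
  | algebraMap c => simp
  | add x y hx hy => rw [map_add, map_add, map_add, hx, hy]
  | ι_mul ξ x hx =>
    rw [map_mul, map_mul, weil_ι, weil_ι, hx, rotate_rotate, map_mul, parity_ι, map_neg]

theorem mul_ι (x : Forms n) (ξ : Cotangent n) : x * ι ℂ ξ = ι ℂ ξ * parity x := by
  induction x using forms_induction with
  | algebraMap c => rw [AlgHom.commutes, Algebra.commutes]
  | add x y hx hy => rw [map_add, add_mul, mul_add, hx, hy]
  | ι_mul η x hx => rw [mul_assoc, hx, map_mul, parity_ι, neg_mul, mul_neg, ι_mul_ι_mul_comm]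

/-- The reversal anti-automorphism. -/
def rev : Forms n →ₗ[ℂ] Forms n := CliffordAlgebra.reverse

theorem rev_mul (x y : Forms n) : rev (x * y) = rev y * rev x :=
  CliffordAlgebra.reverse.map_mul x y

theorem rev_ι (ξ : Cotangent n) : rev (ι ℂ ξ) = ι ℂ ξ := CliffordAlgebra.reverse_ι ξ

theorem rev_algebraMap (c : ℂ) :
    rev (algebraMap ℂ (Forms n) c) = algebraMap ℂ (Forms n) c :=
  CliffordAlgebra.reverse.commutes c

/-- The conjugate-linear anti-automorphism that conjugates 1-forms. -/
def adj (x : Forms n) : Forms n := rev (conj x)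

theorem adj_add (x y : Forms n) : adj (x + y) = adj x + adj y := by
  rw [adj, map_add, map_add]; rfl

theorem adj_zero : adj (0 : Forms n) = 0 := by
  rw [adj, map_zero, map_zero]

theorem adj_smul (c : ℂ) (x : Forms n) : adj (c • x) = starRingEnd ℂ c • adj x := by
  rw [adj, conj_smul, map_smul]; rfl

theorem adj_mul (x y : Forms n) : adj (x * y) = adj y * adj x := by
  rw [adj, map_mul, rev_mul]; rfl

theorem adj_ι (ξ : Cotangent n) : adj (ι ℂ ξ) = ι ℂ (conjCotangent ξ) := by
  rw [adj, conj_ι, rev_ι]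

theorem adj_algebraMap (c : ℂ) :
    adj (algebraMap ℂ (Forms n) c) = algebraMap ℂ (Forms n) (starRingEnd ℂ c) := by
  rw [adj, conj_algebraMap, rev_algebraMap]

theorem adj_adj (x : Forms n) : adj (adj x) = x := by
  induction x using forms_induction with
  | algebraMap c => simp [adj_algebraMap]
  | add x y hx hy => rw [adj_add, adj_add, hx, hy]
  | ι_mul ξ x hx => rw [adj_mul, adj_mul, adj_ι, adj_ι, hx, conjCotangent_conjCotangent]

theorem weil_adj (x : Forms n) : weil (adj x) = adj (weil x) := by
  induction x using forms_induction with
  | algebraMap c => simp [adj_algebraMap]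
  | add x y hx hy => rw [adj_add, map_add, map_add, adj_add, hx, hy]
  | ι_mul ξ x hx =>
    rw [adj_mul, map_mul, map_mul, adj_mul, adj_ι, weil_ι, weil_ι, adj_ι, hx]
    rfl

theorem adj_theta (ξ : Cotangent n) : adj (theta ξ : Forms n) = -(theta ξ : Forms n) := by
  rw [coe_theta, adj_smul, adj_mul, adj_ι, adj_ι, conjCotangent_conjCotangent, Complex.conj_I,
    neg_smul]

theorem conj_theta (ξ : Cotangent n) : conj (theta ξ : Forms n) = (theta ξ : Forms n) := by
  rw [coe_theta, conj_smul, map_mul, conj_ι, conj_ι, conjCotangent_conjCotangent, Complex.conj_I,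
    ι_mul_ι_comm, smul_neg, neg_smul, neg_neg]

theorem parity_contract (d : Covector n) (x : Forms n) :
    contract d (parity x) = -parity (contract d x) := by
  induction x using forms_induction with
  | algebraMap c => simp [contract_algebraMap]
  | add x y hx hy => rw [map_add, map_add, map_add, map_add, hx, hy, neg_add]
  | ι_mul ξ x hx =>
    rw [map_mul, parity_ι, neg_mul, map_neg, contract_ι_mul, contract_ι_mul, map_sub, map_smul,
      map_mul, parity_ι, hx]
    simp

theorem weil_contract (d : Covector n) (x : Forms n) :
    contract d (weil x) = weil (contract (d ∘ₗ rotate n) x) := by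
  induction x using forms_induction with
  | algebraMap c => simp [contract_algebraMap]
  | add x y hx hy => rw [map_add, map_add, map_add, map_add, hx, hy]
  | ι_mul ξ x hx =>
    rw [map_mul, weil_ι, contract_ι_mul, contract_ι_mul, map_sub, map_smul, map_mul, weil_ι, hx]
    rfl

/-- The conjugate covector. -/
def conjCovector (d : Covector n) : Covector n where
  toFun ξ := starRingEnd ℂ (d (conjCotangent ξ))
  map_add' ξ η := by rw [conjCotangent_add, map_add, map_add]
  map_smul' c ξ := by
    rw [conjCotangent_smul, map_smul, smul_eq_mul, map_mul, Complex.conj_conj]; rfl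

theorem conj_contract (d : Covector n) (x : Forms n) :
    contract d (conj x) = conj (contract (conjCovector d) x) := by
  induction x using forms_induction with
  | algebraMap c => simp [contract_algebraMap, conj_algebraMap]
  | add x y hx hy => rw [map_add, map_add, map_add, map_add, hx, hy]
  | ι_mul ξ x hx =>
    rw [map_mul, conj_ι, contract_ι_mul, contract_ι_mul, map_sub, conj_smul, map_mul, conj_ι, hx]
    simp [conjCovector]

end

end LinearHRR

namespace LinearHRR

noncomputable section

open ExteriorAlgebra

variable {n : ℕ}

/-! ### Homogeneous forms -/

/-- Forms of degree `k`. -/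
abbrev formsOfDegree (n k : ℕ) : Submodule ℂ (Forms n) := ⋀[ℂ]^k (Cotangent n)

theorem mul_mem_formsOfDegree {k l : ℕ} {x y : Forms n} (hx : x ∈ formsOfDegree n k)
    (hy : y ∈ formsOfDegree n l) : x * y ∈ formsOfDegree n (k + l) := by
  rw [formsOfDegree, exteriorPower, pow_add]
  exact Submodule.mul_mem_mul hx hy

theorem ι_mem_formsOfDegree (ξ : Cotangent n) : ι ℂ ξ ∈ formsOfDegree n 1 := by
  rw [formsOfDegree, exteriorPower, pow_one]
  exact LinearMap.mem_range_self _ _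

theorem algebraMap_mem_formsOfDegree (c : ℂ) :
    algebraMap ℂ (Forms n) c ∈ formsOfDegree n 0 := by
  rw [formsOfDegree, exteriorPower, pow_zero]
  exact Submodule.algebraMap_mem c

theorem mem_formsOfDegree_zero {x : Forms n} (hx : x ∈ formsOfDegree n 0) :
    ∃ c, x = algebraMap ℂ (Forms n) c := by
  rw [formsOfDegree, exteriorPower, pow_zero] at hx
  obtain ⟨c, hc⟩ := Submodule.mem_one.mp hx
  exact ⟨c, hc.symm⟩

theorem formsOfDegree_induction {P : ℕ → Forms n → Prop}
    (algebraMap : ∀ c, P 0 (algebraMap ℂ (Forms n) c))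
    (add : ∀ k x y, P k x → P k y → P k (x + y))
    (ι_mul : ∀ k ξ x, x ∈ formsOfDegree n k → P k x → P (k + 1) (ι ℂ ξ * x))
    {k : ℕ} {x : Forms n} (hx : x ∈ formsOfDegree n k) : P k x := by
  refine Submodule.pow_induction_on_left' (M := LinearMap.range (ι ℂ))
    (C := fun k x _ => P k x) algebraMap (fun x y i _ _ => add i x y) ?_ hx
  rintro m ⟨ξ, rfl⟩ i x hx h
  exact ι_mul i ξ x hx h

theorem theta_mem_formsOfDegree (ξ : Cotangent n) : (theta ξ : Forms n) ∈ formsOfDegree n 2 :=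
  Submodule.smul_mem _ _ (mul_mem_formsOfDegree (ι_mem_formsOfDegree _) (ι_mem_formsOfDegree _))

/-- The two clauses separate degree 0, where the contraction vanishes, from positive degree, so that
no truncated subtraction `k - 1` appears. -/
theorem contract_mem_formsOfDegree (d : Covector n) {k : ℕ} {x : Forms n}
    (hx : x ∈ formsOfDegree n k) :
    (k = 0 → contract d x = 0) ∧ ∀ l, k = l + 1 → contract d x ∈ formsOfDegree n l := by
  refine formsOfDegree_induction (P := fun k x => (k = 0 → contract d x = 0) ∧
    ∀ l, k = l + 1 → contract d x ∈ formsOfDegree n l) ?_ ?_ ?_ hx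
  · exact fun c => ⟨fun _ => contract_algebraMap d c, fun l hl => by omega⟩
  · intro k x y hx hy
    refine ⟨fun h => by rw [map_add, hx.1 h, hy.1 h, add_zero], fun l hl => ?_⟩
    rw [map_add]
    exact add_mem (hx.2 l hl) (hy.2 l hl)
  · intro k ξ x hx ih
    refine ⟨fun h => by omega, fun l hl => ?_⟩
    obtain rfl : k = l := by omega
    rw [contract_ι_mul]
    refine sub_mem (Submodule.smul_mem _ _ hx) ?_
    rcases k with _ | k
    · rw [ih.1 rfl, mul_zero]
      exact zero_mem _
    · rw [add_comm k 1]
      exact mul_mem_formsOfDegree (ι_mem_formsOfDegree ξ) (ih.2 k rfl)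

theorem conj_mem_formsOfDegree {k : ℕ} {x : Forms n} (hx : x ∈ formsOfDegree n k) :
    conj x ∈ formsOfDegree n k := by
  refine formsOfDegree_induction (P := fun k x => conj x ∈ formsOfDegree n k) ?_ ?_ ?_ hx
  · intro c
    rw [conj_algebraMap]
    exact algebraMap_mem_formsOfDegree _
  · intro k x y hx hy
    rw [map_add]
    exact add_mem hx hy
  · intro k ξ x _ ih
    rw [map_mul, conj_ι, add_comm k 1]
    exact mul_mem_formsOfDegree (ι_mem_formsOfDegree _) ih

theorem weil_mem_formsOfDegree {k : ℕ} {x : Forms n} (hx : x ∈ formsOfDegree n k) :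
    weil x ∈ formsOfDegree n k := by
  refine formsOfDegree_induction (P := fun k x => weil x ∈ formsOfDegree n k) ?_ ?_ ?_ hx
  · intro c
    rw [AlgHom.commutes]
    exact algebraMap_mem_formsOfDegree _
  · intro k x y hx hy
    rw [map_add]
    exact add_mem hx hy
  · intro k ξ x _ ih
    rw [map_mul, weil_ι, add_comm k 1]
    exact mul_mem_formsOfDegree (ι_mem_formsOfDegree _) ih

theorem parity_of_mem {k : ℕ} {x : Forms n} (hx : x ∈ formsOfDegree n k) :
    parity x = (-1 : ℂ) ^ k • x := by
  refine formsOfDegree_induction (P := fun k x => parity x = (-1 : ℂ) ^ k • x) ?_ ?_ ?_ hx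
  · simp
  · intro k x y hx hy
    rw [map_add, hx, hy, smul_add]
  · intro k ξ x _ ih
    rw [map_mul, parity_ι, ih, mul_smul_comm, pow_succ, mul_neg_one, neg_smul, neg_mul, smul_neg]

theorem rev_of_mem {k : ℕ} {x : Forms n} (hx : x ∈ formsOfDegree n k) :
    rev x = (-1 : ℂ) ^ (k * (k - 1) / 2) • x := by
  refine formsOfDegree_induction
    (P := fun k x => rev x = (-1 : ℂ) ^ (k * (k - 1) / 2) • x) ?_ ?_ ?_ hx
  · intro c
    simp [rev_algebraMap]
  · intro k x y hx hy
    rw [map_add, hx, hy, smul_add]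
  · intro k ξ x hx ih
    rw [rev_mul, rev_ι, ih, smul_mul_assoc, mul_ι, parity_of_mem hx, mul_smul_comm, smul_smul,
      ← pow_add]
    congr 2
    rw [← Nat.choose_two_right, ← Nat.choose_two_right, Nat.choose_succ_succ' k 1,
      Nat.choose_one_right, add_comm]

theorem adj_mem_formsOfDegree {k : ℕ} {x : Forms n} (hx : x ∈ formsOfDegree n k) :
    adj x ∈ formsOfDegree n k := by
  rw [adj, rev_of_mem (conj_mem_formsOfDegree hx)]
  exact Submodule.smul_mem _ _ (conj_mem_formsOfDegree hx)

theorem iSup_formsOfDegree : ⨆ k, formsOfDegree n k = ⊤ :=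
  (DirectSum.Decomposition.isInternal (formsOfDegree n)).submodule_iSup_eq_top

/-- Induction on forms by decomposition into homogeneous components. -/
theorem forms_homogeneous_induction {P : Forms n → Prop}
    (hom : ∀ k, ∀ x ∈ formsOfDegree n k, P x) (add : ∀ x y, P x → P y → P (x + y))
    (x : Forms n) : P x := by
  have hx : x ∈ ⨆ k, formsOfDegree n k := by rw [iSup_formsOfDegree]; trivial
  exact Submodule.iSup_induction _ (motive := P) hx hom (hom 0 0 (zero_mem _)) add

/-! ### Unitary coframes -/

/-- A basis `e_1, …, e_n` of the `ℂ`-linear functionals on `ℂ^n`, with the basis of covectors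
dual to `e_1, …, e_n, ē_1, …, ē_n`. -/
structure Coframe (n : ℕ) where
  /-- the functionals -/
  e : Fin n → Cotangent n
  /-- the covectors dual to the functionals -/
  d : Fin n → Covector n
  /-- the covectors dual to the conjugate functionals -/
  db : Fin n → Covector n
  d_e : ∀ i j, d i (e j) = if i = j then 1 else 0
  d_conj : ∀ i j, d i (conjCotangent (e j)) = 0
  db_e : ∀ i j, db i (e j) = 0
  db_conj : ∀ i j, db i (conjCotangent (e j)) = if i = j then 1 else 0
  complete : ∀ ξ, ∑ j, (d j ξ • e j + db j ξ • conjCotangent (e j)) = ξ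
  rotate_e : ∀ j, rotate n (e j) = Complex.I • e j

namespace Coframe

variable (c : Coframe n)

/-- The form `i e_j ∧ ē_j`. -/
def th (j : Fin n) : CentralForms n := theta (c.e j)

/-- The contraction adjoint to multiplication with `i e_j ∧ ē_j`. -/
def D (j : Fin n) : Module.End ℂ (Forms n) :=
  (-Complex.I) • (contract (c.db j) ∘ₗ contract (c.d j))

theorem D_apply (j : Fin n) (x : Forms n) :
    c.D j x = (-Complex.I) • contract (c.db j) (contract (c.d j) x) := rfl

theorem D_contract (i : Fin n) (d : Covector n) (x : Forms n) :
    c.D i (contract d x) = contract d (c.D i x) := by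
  rw [D_apply, D_apply, map_smul, contract_comm (c.d i) d, map_neg, contract_comm (c.db i) d,
    neg_neg]

theorem contract_d_D (j : Fin n) (x : Forms n) : contract (c.d j) (c.D j x) = 0 := by
  rw [D_apply, map_smul, contract_comm, contract_contract, map_zero, neg_zero, smul_zero]

theorem contract_db_D (j : Fin n) (x : Forms n) : contract (c.db j) (c.D j x) = 0 := by
  rw [D_apply, map_smul, contract_contract, smul_zero]

theorem D_comm (i j : Fin n) (x : Forms n) : c.D i (c.D j x) = c.D j (c.D i x) := by
  conv_lhs => rw [c.D_apply j, map_smul, D_contract, D_contract]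
  rw [c.D_apply j]

theorem D_D (j : Fin n) (x : Forms n) : c.D j (c.D j x) = 0 := by
  conv_lhs => rw [D_apply, contract_d_D, map_zero, smul_zero]

theorem D_ι_mul (i : Fin n) (ξ : Cotangent n) (h : c.d i ξ = 0) (h' : c.db i ξ = 0)
    (x : Forms n) : c.D i (ι ℂ ξ * x) = ι ℂ ξ * c.D i x := by
  rw [D_apply, D_apply, contract_ι_mul, h, zero_smul, zero_sub, map_neg, contract_ι_mul, h',
    zero_smul, zero_sub, neg_neg, mul_smul_comm]

variable {c} in
theorem d_e_of_ne {i j : Fin n} (h : i ≠ j) : c.d i (c.e j) = 0 := by rw [d_e, if_neg h]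

variable {c} in
theorem db_conj_of_ne {i j : Fin n} (h : i ≠ j) : c.db i (conjCotangent (c.e j)) = 0 := by
  rw [db_conj, if_neg h]

theorem d_e_self (i : Fin n) : c.d i (c.e i) = 1 := by rw [d_e, if_pos rfl]

theorem db_conj_self (i : Fin n) : c.db i (conjCotangent (c.e i)) = 1 := by
  rw [db_conj, if_pos rfl]

theorem D_e_mul {i j : Fin n} (h : i ≠ j) (x : Forms n) :
    c.D i (ι ℂ (c.e j) * x) = ι ℂ (c.e j) * c.D i x :=
  c.D_ι_mul i _ (d_e_of_ne h) (c.db_e i j) x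

theorem D_conj_mul {i j : Fin n} (h : i ≠ j) (x : Forms n) :
    c.D i (ι ℂ (conjCotangent (c.e j)) * x) = ι ℂ (conjCotangent (c.e j)) * c.D i x :=
  c.D_ι_mul i _ (c.d_conj i j) (db_conj_of_ne h) x

theorem contract_d_th_mul (j : Fin n) (x : Forms n) : contract (c.d j) (c.th j * x) =
    Complex.I • (ι ℂ (conjCotangent (c.e j)) * x) + c.th j * contract (c.d j) x := by
  rw [th, contract_theta_mul, d_e_self, d_conj, zero_smul, sub_zero, one_smul]

theorem contract_db_th_mul (j : Fin n) (x : Forms n) : contract (c.db j) (c.th j * x) =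
    -Complex.I • (ι ℂ (c.e j) * x) + c.th j * contract (c.db j) x := by
  rw [th, contract_theta_mul, db_e, db_conj_self, zero_smul, zero_sub, one_smul, smul_neg, neg_smul]

theorem contract_d_th_mul_of_ne {i j : Fin n} (h : i ≠ j) (x : Forms n) :
    contract (c.d i) (c.th j * x) = c.th j * contract (c.d i) x := by
  rw [th, contract_theta_mul, d_e_of_ne h, d_conj, zero_smul, zero_smul, sub_zero, smul_zero,
    zero_add]

theorem contract_db_th_mul_of_ne {i j : Fin n} (h : i ≠ j) (x : Forms n) :
    contract (c.db i) (c.th j * x) = c.th j * contract (c.db i) x := by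
  rw [th, contract_theta_mul, db_e, db_conj_of_ne h, zero_smul, zero_smul, sub_zero, smul_zero,
    zero_add]

theorem D_th_mul_of_ne {i j : Fin n} (h : i ≠ j) (x : Forms n) :
    c.D i (c.th j * x) = c.th j * c.D i x := by
  rw [D_apply, contract_d_th_mul_of_ne _ h, contract_db_th_mul_of_ne _ h, D_apply, mul_smul_comm]

/-- The `sl₂` relation in one direction: the commutator of `D j` with `th j` is 1 minus the operator
counting the factors e_j and ē_j. -/
theorem D_th_mul (j : Fin n) (x : Forms n) : c.D j (c.th j * x) =
    x - ι ℂ (c.e j) * contract (c.d j) x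
      - ι ℂ (conjCotangent (c.e j)) * contract (c.db j) x + c.th j * c.D j x := by
  rw [D_apply, contract_d_th_mul, map_add, map_smul, contract_ι_mul, contract_db_th_mul,
    db_conj_self, D_apply, mul_smul_comm]
  simp only [smul_add, smul_sub, smul_neg, neg_smul, smul_smul, one_smul, neg_mul,
    Complex.I_mul_I, neg_neg]
  abel

theorem D_th_mul_of_eq_zero {j : Fin n} {x : Forms n} (h : contract (c.d j) x = 0)
    (h' : contract (c.db j) x = 0) : c.D j (c.th j * x) = x := by
  rw [D_th_mul, D_apply, h, h']
  simp

theorem eq_sum_covector (d : Covector n) :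
    d = ∑ j, (d (c.e j) • c.d j + d (conjCotangent (c.e j)) • c.db j) := by
  ext ξ
  conv_lhs => rw [← c.complete ξ]
  simp [mul_comm]

theorem contract_eq_sum (d : Covector n) (x : Forms n) :
    contract d x = ∑ j, (d (c.e j) • contract (c.d j) x
      + d (conjCotangent (c.e j)) • contract (c.db j) x) := by
  conv_lhs => rw [c.eq_sum_covector d]
  simp [contract]

/-- The Euler operator, multiplication by the degree. -/
def euler : Module.End ℂ (Forms n) :=
  ∑ j, (LinearMap.mulLeft ℂ (ι ℂ (c.e j)) ∘ₗ contract (c.d j)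
    + LinearMap.mulLeft ℂ (ι ℂ (conjCotangent (c.e j))) ∘ₗ contract (c.db j))

theorem euler_apply (x : Forms n) : c.euler x = ∑ j, (ι ℂ (c.e j) * contract (c.d j) x
    + ι ℂ (conjCotangent (c.e j)) * contract (c.db j) x) := by
  simp [euler]

theorem euler_ι_mul (ξ : Cotangent n) (x : Forms n) :
    c.euler (ι ℂ ξ * x) = ι ℂ ξ * x + ι ℂ ξ * c.euler x := by
  rw [euler_apply, euler_apply]
  conv_rhs => enter [1]; rw [← c.complete ξ]
  rw [map_sum, Finset.sum_mul, Finset.mul_sum, ← Finset.sum_add_distrib]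
  refine Finset.sum_congr rfl fun j _ => ?_
  rw [contract_ι_mul, contract_ι_mul, map_add, map_smul, map_smul, mul_sub, mul_sub,
    ι_mul_ι_mul_comm (c.e j), ι_mul_ι_mul_comm (conjCotangent (c.e j)), mul_add, add_mul,
    smul_mul_assoc, smul_mul_assoc, mul_smul_comm, mul_smul_comm]
  abel

theorem euler_of_mem {k : ℕ} {x : Forms n} (hx : x ∈ formsOfDegree n k) :
    c.euler x = (k : ℂ) • x := by
  refine formsOfDegree_induction (P := fun k x => c.euler x = (k : ℂ) • x) ?_ ?_ ?_ hx
  · intro r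
    simp [euler_apply, contract_algebraMap]
  · intro k x y hx hy
    rw [map_add, hx, hy, smul_add]
  · intro k ξ x _ ih
    rw [euler_ι_mul, ih, mul_smul_comm]
    push_cast
    rw [add_smul, one_smul, add_comm]

theorem decompose_euler (x : Forms n) (k : ℕ) :
    (DirectSum.decompose (formsOfDegree n) (c.euler x) k : Forms n) =
      (k : ℂ) • (DirectSum.decompose (formsOfDegree n) x k : Forms n) := by
  induction x using forms_homogeneous_induction with
  | hom l x hx =>
    rw [c.euler_of_mem hx]
    by_cases h : l = k
    · subst h
      rw [DirectSum.decompose_of_mem_same _ (Submodule.smul_mem _ _ hx),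
        DirectSum.decompose_of_mem_same _ hx]
    · rw [DirectSum.decompose_of_mem_ne _ (Submodule.smul_mem _ _ hx) h,
        DirectSum.decompose_of_mem_ne _ hx h, smul_zero]
  | add x y hx hy =>
    simp only [map_add, DirectSum.decompose_add, DirectSum.add_apply, Submodule.coe_add, hx, hy,
      smul_add]

/-- The Euler operator annihilates such a form and acts on degree k as multiplication by k, so only
the component of degree 0 survives. -/
theorem exists_algebraMap_of_contract_eq_zero {x : Forms n}
    (h : ∀ j, contract (c.d j) x = 0) (h' : ∀ j, contract (c.db j) x = 0) :
    ∃ r, x = algebraMap ℂ (Forms n) r := by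
  have h0 : c.euler x = 0 := by simp [euler_apply, h, h']
  have hk : ∀ k, k ≠ 0 → (DirectSum.decompose (formsOfDegree n) x k : Forms n) = 0 := by
    intro k hk
    have := c.decompose_euler x k
    rw [h0, DirectSum.decompose_zero] at this
    have h2 : (k : ℂ) • (DirectSum.decompose (formsOfDegree n) x k : Forms n) = 0 := this.symm
    exact (smul_eq_zero.mp h2).resolve_left (by exact_mod_cast hk)
  have hx : x ∈ formsOfDegree n 0 := by
    classical
    rw [← DirectSum.sum_support_decompose (formsOfDegree n) x]
    refine sum_mem fun k _ => ?_
    by_cases h : k = 0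
    · subst h; exact SetLike.coe_mem _
    · rw [hk k h]; exact zero_mem _
  exact mem_formsOfDegree_zero hx

/-! ### Integration of forms -/

/-- The product of contractions over a list of indices. -/
def DList (l : List (Fin n)) : Module.End ℂ (Forms n) := (l.map c.D).prod

theorem DList_cons (a : Fin n) (l : List (Fin n)) (x : Forms n) :
    c.DList (a :: l) x = c.D a (c.DList l x) := by
  simp [DList]

theorem DList_nil (x : Forms n) : c.DList [] x = x := by
  simp [DList]

theorem DList_contract (l : List (Fin n)) (d : Covector n) (x : Forms n) :
    c.DList l (contract d x) = contract d (c.DList l x) := by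
  induction l with
  | nil => rw [DList_nil, DList_nil]
  | cons a l ih => rw [DList_cons, DList_cons, ih, D_contract]

theorem contract_DList {l : List (Fin n)} {j : Fin n} (hj : j ∈ l) (x : Forms n) :
    contract (c.d j) (c.DList l x) = 0 ∧ contract (c.db j) (c.DList l x) = 0 := by
  induction l with
  | nil => simp at hj
  | cons a l ih =>
    rw [DList_cons]
    by_cases h : j = a
    · subst h
      exact ⟨contract_d_D _ _ _, contract_db_D _ _ _⟩
    · have := ih ((List.mem_cons.mp hj).resolve_left h)
      rw [← D_contract, ← D_contract, this.1, this.2, map_zero]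
      exact ⟨rfl, rfl⟩

theorem DList_th_mul_of_notMem {l : List (Fin n)} {j : Fin n} (hj : j ∉ l) (x : Forms n) :
    c.DList l (c.th j * x) = c.th j * c.DList l x := by
  induction l with
  | nil => rw [DList_nil, DList_nil]
  | cons a l ih =>
    rw [List.mem_cons, not_or] at hj
    rw [DList_cons, DList_cons, ih hj.2, D_th_mul_of_ne _ (Ne.symm hj.1)]

theorem D_thList_mul {l : List (Fin n)} {j : Fin n} (hj : j ∉ l) (x : Forms n) :
    c.D j ((l.map c.th).prod * x) = (l.map c.th).prod * c.D j x := by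
  induction l with
  | nil => simp
  | cons a l ih =>
    rw [List.mem_cons, not_or] at hj
    rw [List.map_cons, List.prod_cons, Subalgebra.coe_mul, mul_assoc, mul_assoc,
      D_th_mul_of_ne _ hj.1, ih hj.2]

theorem DList_thList_mul {l : List (Fin n)} (hl : l.Nodup) {x : Forms n}
    (h : ∀ j ∈ l, contract (c.d j) x = 0 ∧ contract (c.db j) x = 0) :
    c.DList l ((l.map c.th).prod * x) = x := by
  induction l with
  | nil => simp [DList_nil]
  | cons a l ih =>
    rw [List.nodup_cons] at hl
    rw [List.map_cons, List.prod_cons, Subalgebra.coe_mul, mul_assoc, DList_cons,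
      DList_th_mul_of_notMem _ hl.1, ih hl.2 fun j hj => h j (List.mem_cons_of_mem _ hj)]
    have := h a List.mem_cons_self
    exact c.D_th_mul_of_eq_zero this.1 this.2

/-- The volume form of a coframe. -/
def vol : CentralForms n := ∏ j, c.th j

theorem vol_eq_list : c.vol = ((List.finRange n).map c.th).prod := Fin.prod_univ_def _

/-- Integration against the volume form of a coframe: the coefficient of the volume form. -/
def integral : Forms n →ₗ[ℂ] ℂ :=
  (algebraMapInv : Forms n →ₐ[ℂ] ℂ).toLinearMap ∘ₗ c.DList (List.finRange n)

end Coframe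

/-- A linear functional on forms that vanishes in degrees other than the top degree. -/
def IsIntegral (t : Forms n →ₗ[ℂ] ℂ) : Prop := ∀ d x, t (contract d x) = 0

namespace Coframe

variable (c : Coframe n)

/-- Every contraction is a combination of the contractions `d j` and `db j`, commutes with the D's,
and is killed by the factor D_j. -/
theorem isIntegral_integral : IsIntegral c.integral := by
  intro d x
  have h (j : Fin n) := c.contract_DList (List.mem_finRange j) x
  rw [integral, LinearMap.comp_apply, DList_contract, c.contract_eq_sum]
  simp [h]

theorem integral_vol : c.integral c.vol = 1 := by
  have := c.DList_thList_mul (List.nodup_finRange n) (x := 1)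
    fun j _ => ⟨contract_one _, contract_one _⟩
  rw [integral, LinearMap.comp_apply, vol_eq_list, ← mul_one (Subtype.val _), this]
  simp

theorem vol_ne_zero : c.vol ≠ 0 := by
  intro h
  have := c.integral_vol
  simp [h] at this

variable {c} {t : Forms n →ₗ[ℂ] ℂ}

/-- Integration by parts: the integral of `D j (th j * x)` vanishes, and each of the two counting
terms of `D_th_mul` integrates to t(x). -/
theorem integral_th_mul_D (ht : IsIntegral t) (j : Fin n) (x : Forms n) :
    t (c.th j * c.D j x) = t x := by
  have h1 : t (c.D j (c.th j * x)) = 0 := by rw [D_apply, map_smul, ht, smul_zero]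
  have h2 : t (ι ℂ (c.e j) * contract (c.d j) x) = t x := by
    have := ht (c.d j) (ι ℂ (c.e j) * x)
    rw [contract_ι_mul, d_e_self, one_smul, map_sub, sub_eq_zero] at this
    exact this.symm
  have h3 : t (ι ℂ (conjCotangent (c.e j)) * contract (c.db j) x) = t x := by
    have := ht (c.db j) (ι ℂ (conjCotangent (c.e j)) * x)
    rw [contract_ι_mul, db_conj_self, one_smul, map_sub, sub_eq_zero] at this
    exact this.symm
  rw [D_th_mul, map_add, map_sub, map_sub, h2, h3] at h1
  linear_combination h1

theorem integral_thList_mul_DList (ht : IsIntegral t) {l : List (Fin n)} (hl : l.Nodup)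
    (x : Forms n) : t ((l.map c.th).prod * c.DList l x) = t x := by
  induction l with
  | nil => simp [DList_nil]
  | cons a l ih =>
    rw [List.nodup_cons] at hl
    rw [DList_cons, List.map_cons, List.prod_cons, Subalgebra.coe_mul, mul_assoc,
      ← D_thList_mul _ hl.1, integral_th_mul_D ht, ih hl.2]

/-- Uniqueness of integration up to a scalar. Contracting all directions leaves a constant, and
integration by parts puts the volume form back. -/
theorem eq_mul_integral (c : Coframe n) (ht : IsIntegral t) (x : Forms n) :
    t x = c.integral x * t c.vol := by
  obtain ⟨r, hr⟩ := c.exists_algebraMap_of_contract_eq_zero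
    (x := c.DList (List.finRange n) x)
    (fun j => (c.contract_DList (List.mem_finRange j) x).1)
    (fun j => (c.contract_DList (List.mem_finRange j) x).2)
  rw [← c.integral_thList_mul_DList ht (List.nodup_finRange n) x, integral, LinearMap.comp_apply,
    hr, ← vol_eq_list, ← Algebra.commutes, ← Algebra.smul_def, map_smul]
  simp

/-- Two evaluations of t on the Euler operator: it multiplies by k on degree k, while integration by
parts gives the factor 2n on every form. -/
theorem eq_zero_of_mem (c : Coframe n) (ht : IsIntegral t) {k : ℕ} (hk : k ≠ 2 * n)
    {x : Forms n} (hx : x ∈ formsOfDegree n k) : t x = 0 := by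
  have h1 : t (c.euler x) = ∑ _j : Fin n, (t x + t x) := by
    rw [euler_apply, map_sum]
    refine Finset.sum_congr rfl fun j _ => ?_
    have h2 := ht (c.d j) (ι ℂ (c.e j) * x)
    have h3 := ht (c.db j) (ι ℂ (conjCotangent (c.e j)) * x)
    rw [contract_ι_mul, d_e_self, one_smul, map_sub, sub_eq_zero] at h2
    rw [contract_ι_mul, db_conj_self, one_smul, map_sub, sub_eq_zero] at h3
    rw [map_add, ← h2, ← h3]
  rw [c.euler_of_mem hx, map_smul, Finset.sum_const, Finset.card_univ, Fintype.card_fin,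
    smul_eq_mul, nsmul_eq_mul] at h1
  have h4 : ((k : ℂ) - 2 * n) * t x = 0 := by linear_combination h1
  refine (mul_eq_zero.mp h4).resolve_left fun h => hk ?_
  rw [sub_eq_zero] at h
  exact_mod_cast h

theorem integral_parity (c : Coframe n) (ht : IsIntegral t) (x : Forms n) :
    t (parity x) = t x := by
  have ht' : IsIntegral (t ∘ₗ (parity : Forms n →ₐ[ℂ] Forms n).toLinearMap) := by
    intro d x
    have := ht d (parity x)
    rw [parity_contract, map_neg, neg_eq_zero] at this
    exact this
  induction x using forms_homogeneous_induction with
  | hom k x hx =>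
    by_cases hk : k = 2 * n
    · rw [parity_of_mem hx, hk, pow_mul]
      simp
    · rw [c.eq_zero_of_mem ht hk hx]
      exact c.eq_zero_of_mem ht' hk hx
  | add x y hx hy => rw [map_add, map_add, map_add, hx, hy]

end Coframe

end

end LinearHRR

namespace LinearHRR

noncomputable section

open ExteriorAlgebra

variable {n : ℕ}

/-! ### A positive definite form on the algebra of forms -/

theorem contract_mul (d : Covector n) (x y : Forms n) :
    contract d (x * y) = contract d x * y + parity x * contract d y := by
  induction x using forms_induction with
  | algebraMap c =>
    rw [contract_algebraMap, zero_mul, zero_add, AlgHom.commutes, ← Algebra.smul_def,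
      ← Algebra.smul_def, map_smul]
  | add x x' hx hx' => rw [add_mul, map_add, map_add, map_add, hx, hx', add_mul, add_mul]; abel
  | ι_mul ξ x hx =>
    rw [mul_assoc, contract_ι_mul, hx, contract_ι_mul, map_mul, parity_ι, sub_mul, mul_add,
      smul_mul_assoc, mul_assoc, neg_mul, neg_mul, mul_assoc]
    abel

theorem parity_rev (x : Forms n) : parity (rev x) = rev (parity x) := by
  induction x using forms_induction with
  | algebraMap c => simp [rev_algebraMap]
  | add x y hx hy => rw [map_add, map_add, map_add, map_add, hx, hy]
  | ι_mul ξ x hx => rw [rev_mul, map_mul, map_mul, rev_mul, rev_ι, parity_ι, hx, map_neg, rev_ι]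

theorem parity_parity (x : Forms n) : parity (parity x) = x :=
  CliffordAlgebra.involute_involute x

theorem contract_rev (d : Covector n) (x : Forms n) :
    contract d (rev x) = rev (parity (contract d x)) := by
  induction x using forms_induction with
  | algebraMap c => simp [rev_algebraMap, contract_algebraMap]
  | add x y hx hy => simp only [map_add, hx, hy]
  | ι_mul ξ x hx =>
    rw [rev_mul, rev_ι, mul_ι, contract_ι_mul, parity_contract, hx, contract_ι_mul, map_sub,
      map_smul, map_mul, parity_ι, neg_mul, sub_neg_eq_add, map_add, map_smul, rev_mul, rev_ι,
      mul_ι, ← parity_rev, ← parity_rev, mul_neg, sub_neg_eq_add]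

theorem contract_adj (d : Covector n) (x : Forms n) :
    contract d (adj x) = adj (parity (contract (conjCovector d) x)) := by
  rw [adj, contract_rev, conj_contract, adj, ← weil_weil, weil_conj, weil_conj, weil_weil]

/-- The central forms whose multiplication commutes with a contraction. -/
def contractInvariants (d : Covector n) : Subalgebra ℂ (CentralForms n) where
  carrier := {z | ∀ x : Forms n, contract d (z * x) = z * contract d x}
  mul_mem' {a b} ha hb x := by
    rw [Subalgebra.coe_mul, mul_assoc, ha, hb, mul_assoc]
  add_mem' {a b} ha hb x := by
    rw [Subalgebra.coe_add, add_mul, map_add, ha, hb, add_mul]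
  algebraMap_mem' r x := by
    rw [Subalgebra.coe_algebraMap, ← Algebra.smul_def, map_smul, Algebra.smul_def]

/-- The central forms of even degree that are fixed by the Weil operator. -/
def weilInvariants (n : ℕ) : Subalgebra ℂ (CentralForms n) :=
  Subalgebra.comap (CentralForms n).val (AlgHom.equalizer weil (AlgHom.id ℂ (Forms n)))

theorem mem_weilInvariants {z : CentralForms n} :
    z ∈ weilInvariants n ↔ weil (z : Forms n) = z := Iff.rfl

theorem parity_of_mem_weilInvariants {z : CentralForms n} (hz : z ∈ weilInvariants n) :
    parity (z : Forms n) = z := by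
  rw [mem_weilInvariants] at hz
  rw [← weil_weil, hz, hz]

theorem theta_mem_weilInvariants {ξ : Cotangent n} (h : rotate n ξ = Complex.I • ξ) :
    theta ξ ∈ weilInvariants n := by
  rw [mem_weilInvariants, coe_theta, map_smul, map_mul, weil_ι, weil_ι, rotate_conjCotangent, h,
    conjCotangent_smul, map_smul, map_smul, Complex.conj_I, smul_mul_smul_comm]
  simp

theorem add_pow_succ_of_mul_self_eq_zero {A : Type*} [Ring A] [Algebra ℂ A] {a s : A}
    (hc : Commute a s) (haa : a * a = 0) (i : ℕ) :
    (a + s) ^ (i + 1) = s ^ (i + 1) + ((i + 1 : ℕ) : ℂ) • (a * s ^ i) := by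
  induction i with
  | zero => simp [add_comm]
  | succ i ih =>
    rw [pow_succ', ih, add_mul, mul_add, mul_add, mul_smul_comm, ← mul_assoc, haa, zero_mul,
      smul_zero, mul_smul_comm, ← mul_assoc s a, ← hc.eq, mul_assoc a, ← pow_succ', ← pow_succ']
    push_cast
    module

/-- Exponentials of commuting elements of square zero. -/
theorem prod_one_add_eq_sum {A : Type*} [Ring A] [Algebra ℂ A] (l : List A)
    (hc : ∀ a ∈ l, ∀ b ∈ l, Commute a b) (h0 : ∀ a ∈ l, a * a = 0) :
    l.sum ^ (l.length + 1) = 0 ∧ (l.map (1 + ·)).prod =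
      ∑ i ∈ Finset.range (l.length + 1), ((i.factorial : ℂ)⁻¹) • l.sum ^ i := by
  induction l with
  | nil => simp
  | cons a l ih =>
    have hcl : Commute a l.sum :=
      Commute.list_sum_right _ _ fun b hb => hc a List.mem_cons_self b (List.mem_cons_of_mem _ hb)
    have haa := h0 a List.mem_cons_self
    obtain ⟨h1, h2⟩ := ih
      (fun b hb b' hb' => hc b (List.mem_cons_of_mem _ hb) b' (List.mem_cons_of_mem _ hb'))
      fun b hb => h0 b (List.mem_cons_of_mem _ hb)
    have hpow := add_pow_succ_of_mul_self_eq_zero hcl haa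
    rw [List.sum_cons, List.length_cons, List.map_cons, List.prod_cons, h2]
    refine ⟨?_, ?_⟩
    · rw [hpow, h1, pow_succ, h1, zero_mul, mul_zero, smul_zero, add_zero]
    · rw [Finset.sum_range_succ' _ (l.length + 1)]
      simp_rw [hpow]
      simp_rw [smul_add]
      rw [Finset.sum_add_distrib, add_mul, one_mul]
      conv_lhs => enter [1]; rw [Finset.sum_range_succ']
      conv_rhs => enter [1, 1]; rw [Finset.sum_range_succ, h1, smul_zero, add_zero]
      have h3 : ∀ i ∈ Finset.range (l.length + 1),
          ((((i + 1).factorial : ℕ) : ℂ)⁻¹) • ((i + 1 : ℕ) : ℂ) • (a * l.sum ^ i) =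
          a * (((i.factorial : ℂ)⁻¹) • l.sum ^ i) := by
        intro i _
        rw [smul_smul, mul_smul_comm, Nat.factorial_succ]
        congr 1
        have : ((i + 1 : ℕ) : ℂ) ≠ 0 := by exact_mod_cast Nat.succ_ne_zero i
        push_cast at this ⊢
        rw [mul_inv, mul_comm, ← mul_assoc, mul_inv_cancel₀ this, one_mul]
      rw [Finset.sum_congr rfl h3, ← Finset.mul_sum]
      simp only [pow_zero]
      abel

/-- Top powers of sums of commuting elements of square zero. -/
theorem sum_pow_length {A : Type*} [Ring A] [Algebra ℂ A] (l : List A)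
    (hc : ∀ a ∈ l, ∀ b ∈ l, Commute a b) (h0 : ∀ a ∈ l, a * a = 0) :
    l.sum ^ l.length = (l.length.factorial : ℂ) • l.prod := by
  induction l with
  | nil => simp
  | cons a l ih =>
    have hcl : Commute a l.sum :=
      Commute.list_sum_right _ _ fun b hb => hc a List.mem_cons_self b (List.mem_cons_of_mem _ hb)
    have hc' := fun b hb b' hb' => hc b (List.mem_cons_of_mem a hb) b' (List.mem_cons_of_mem a hb')
    have h0' := fun b hb => h0 b (List.mem_cons_of_mem a hb)
    rw [List.sum_cons, List.length_cons, List.prod_cons,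
      add_pow_succ_of_mul_self_eq_zero hcl (h0 a List.mem_cons_self),
      (prod_one_add_eq_sum l hc' h0').1, zero_add, ih hc' h0', mul_smul_comm, smul_smul,
      Nat.factorial_succ]
    push_cast
    rfl

namespace Coframe

variable (c : Coframe n)

theorem th_mem_weilInvariants (j : Fin n) : c.th j ∈ weilInvariants n :=
  theta_mem_weilInvariants (c.rotate_e j)

theorem th_mem_contractInvariants {i j : Fin n} (h : i ≠ j) :
    c.th j ∈ contractInvariants (c.d i) ⊓ contractInvariants (c.db i) :=
  ⟨c.contract_d_th_mul_of_ne h, c.contract_db_th_mul_of_ne h⟩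

/-- The forms generated by the coframe elements with index in `l`. -/
def formsOn (l : List (Fin n)) : Submodule ℂ (Forms n) :=
  ⨅ i : {i // i ∉ l}, LinearMap.ker (contract (c.d i)) ⊓ LinearMap.ker (contract (c.db i))

theorem mem_formsOn {l : List (Fin n)} {x : Forms n} : x ∈ c.formsOn l ↔
    ∀ i, i ∉ l → contract (c.d i) x = 0 ∧ contract (c.db i) x = 0 := by
  simp [formsOn]

theorem d_comp_rotate (i : Fin n) : c.d i ∘ₗ rotate n = Complex.I • c.d i := by
  rw [c.eq_sum_covector (c.d i ∘ₗ rotate n)]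
  simp [rotate_conjCotangent, c.rotate_e, conjCotangent_smul, c.d_e, c.d_conj]

theorem db_comp_rotate (i : Fin n) : c.db i ∘ₗ rotate n = (-Complex.I) • c.db i := by
  rw [c.eq_sum_covector (c.db i ∘ₗ rotate n)]
  simp [rotate_conjCotangent, c.rotate_e, conjCotangent_smul, c.db_e, c.db_conj]

theorem conjCovector_d (i : Fin n) : conjCovector (c.d i) = c.db i := by
  rw [c.eq_sum_covector (conjCovector (c.d i))]
  simp [conjCovector, c.d_conj, conjCotangent_conjCotangent, c.d_e]

theorem conjCovector_db (i : Fin n) : conjCovector (c.db i) = c.d i := by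
  rw [c.eq_sum_covector (conjCovector (c.db i))]
  simp [conjCovector, c.db_conj, conjCotangent_conjCotangent, c.db_e]

variable {c}

theorem weil_mem_formsOn {l : List (Fin n)} {x : Forms n} (hx : x ∈ c.formsOn l) :
    weil x ∈ c.formsOn l := by
  rw [mem_formsOn] at hx ⊢
  intro i hi
  rw [weil_contract, weil_contract, d_comp_rotate, db_comp_rotate]
  have h (r : ℂ) (d : Covector n) : contract (r • d) x = r • contract d x := by simp [contract]
  rw [h, h, (hx i hi).1, (hx i hi).2]
  simp

theorem adj_mem_formsOn {l : List (Fin n)} {x : Forms n} (hx : x ∈ c.formsOn l) :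
    adj x ∈ c.formsOn l := by
  rw [mem_formsOn] at hx ⊢
  intro i hi
  rw [contract_adj, contract_adj, conjCovector_d, conjCovector_db, (hx i hi).1, (hx i hi).2]
  simp [adj_zero]

theorem parity_mem_formsOn {l : List (Fin n)} {x : Forms n} (hx : x ∈ c.formsOn l) :
    parity x ∈ c.formsOn l := by
  rw [← weil_weil]
  exact weil_mem_formsOn (weil_mem_formsOn hx)

theorem mul_mem_formsOn {l : List (Fin n)} {x y : Forms n} (hx : x ∈ c.formsOn l)
    (hy : y ∈ c.formsOn l) : x * y ∈ c.formsOn l := by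
  rw [mem_formsOn] at hx hy ⊢
  intro i hi
  rw [contract_mul, contract_mul, (hx i hi).1, (hx i hi).2, (hy i hi).1, (hy i hi).2]
  simp

theorem D_mem_formsOn (j : Fin n) {l : List (Fin n)} {x : Forms n} (hx : x ∈ c.formsOn l) :
    c.D j x ∈ c.formsOn l := by
  rw [mem_formsOn] at hx ⊢
  intro i hi
  rw [← D_contract, ← D_contract, (hx i hi).1, (hx i hi).2]
  simp

variable (c)

/-- Splits off the direction j, whose exterior algebra has the basis 1, e_j, ē_j, i e_j ∧ ē_j. -/
theorem formsOn_cons {l : List (Fin n)} {j : Fin n} {x : Forms n}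
    (hx : x ∈ c.formsOn (j :: l)) :
    ∃ a ∈ c.formsOn l, ∃ b ∈ c.formsOn l, ∃ b' ∈ c.formsOn l, ∃ d ∈ c.formsOn l,
      x = a + ι ℂ (c.e j) * b + ι ℂ (conjCotangent (c.e j)) * b' + c.th j * d := by
  rw [mem_formsOn] at hx
  set d := c.D j x with hd
  set y := x - c.th j * d with hy
  set b := contract (c.d j) y with hb
  set b' := contract (c.db j) y with hb'
  set a := y - ι ℂ (c.e j) * b - ι ℂ (conjCotangent (c.e j)) * b' with ha
  have hne {i : Fin n} (hi : i ∉ l) (hij : i ≠ j) : i ∉ j :: l := by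
    simp [hi, hij]
  have hdj : contract (c.d j) d = 0 := contract_d_D _ _ _
  have hdj' : contract (c.db j) d = 0 := contract_db_D _ _ _
  have hd_mem : d ∈ c.formsOn l := by
    rw [mem_formsOn]
    intro i hi
    by_cases hij : i = j
    · subst hij; exact ⟨hdj, hdj'⟩
    · have := hx i (hne hi hij)
      rw [hd, ← D_contract, ← D_contract, this.1, this.2, map_zero]
      exact ⟨rfl, rfl⟩
  have hdi := (c.mem_formsOn).mp hd_mem
  have hyi {i : Fin n} (hi : i ∉ l) (hij : i ≠ j) :
      contract (c.d i) y = 0 ∧ contract (c.db i) y = 0 := by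
    have := hx i (hne hi hij)
    rw [hy, map_sub, map_sub, contract_d_th_mul_of_ne _ hij, contract_db_th_mul_of_ne _ hij,
      this.1, this.2, (hdi i hi).1, (hdi i hi).2]
    simp
  have hbj : contract (c.d j) b = 0 := contract_contract _ _
  -- Subtracting `c.th j * d` has removed exactly the part of x that contains both e_j and ē_j.
  have hbj' : contract (c.db j) b = 0 := by
    rw [hb, hy, map_sub, contract_d_th_mul, hdj, mul_zero, add_zero, map_sub, map_smul,
      contract_ι_mul, db_conj_self, hdj', one_smul, mul_zero, sub_zero, hd, D_apply, smul_smul]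
    simp
  have hbb : contract (c.d j) b' = 0 := by
    rw [hb', contract_comm, ← hb, hbj', neg_zero]
  have hbb' : contract (c.db j) b' = 0 := contract_contract _ _
  have hb_mem : b ∈ c.formsOn l := by
    rw [mem_formsOn]
    intro i hi
    by_cases hij : i = j
    · subst hij; exact ⟨hbj, hbj'⟩
    · rw [hb, contract_comm, (hyi hi hij).1, contract_comm, (hyi hi hij).2]
      simp
  have hb'_mem : b' ∈ c.formsOn l := by
    rw [mem_formsOn]
    intro i hi
    by_cases hij : i = j
    · subst hij; exact ⟨hbb, hbb'⟩
    · rw [hb', contract_comm, (hyi hi hij).1, contract_comm, (hyi hi hij).2]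
      simp
  refine ⟨a, ?_, b, hb_mem, b', hb'_mem, d, hd_mem, ?_⟩
  · rw [mem_formsOn]
    intro i hi
    by_cases hij : i = j
    · subst hij
      rw [ha]
      simp only [map_sub _ (y - _), map_sub _ y]
      rw [contract_ι_mul, contract_ι_mul, contract_ι_mul, contract_ι_mul, hbj, hbj', hbb, hbb',
        d_e_self, db_conj_self, d_conj, db_e, ← hb, ← hb']
      simp
    · have h1 := (c.mem_formsOn).mp hb_mem i hi
      have h2 := (c.mem_formsOn).mp hb'_mem i hi
      rw [ha]
      simp only [map_sub _ (y - _), map_sub _ y]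
      rw [contract_ι_mul, contract_ι_mul, contract_ι_mul, contract_ι_mul, d_e_of_ne hij,
        db_conj_of_ne hij, d_conj, db_e, h1.1, h1.2, h2.1, h2.2,
        (hyi hi hij).1, (hyi hi hij).2]
      simp
  · rw [ha, hy]
    abel

theorem mul_expand (j : Fin n) (p q r s p' q' r' s' : Forms n) :
    (p + ι ℂ (c.e j) * q + ι ℂ (conjCotangent (c.e j)) * r + c.th j * s) *
      (p' + ι ℂ (c.e j) * q' + ι ℂ (conjCotangent (c.e j)) * r' + c.th j * s') =
    p * p' + ι ℂ (c.e j) * (parity p * q' + q * p')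
      + ι ℂ (conjCotangent (c.e j)) * (parity p * r' + r * p')
      + c.th j * (p * s' + s * p' - Complex.I • (parity q * r' - parity r * q')) := by
  have mv (x y : Forms n) (ξ : Cotangent n) : x * (ι ℂ ξ * y) = ι ℂ ξ * (parity x * y) := by
    rw [← mul_assoc, mul_ι, mul_assoc]
  have mc (x y : Forms n) : x * (c.th j * y) = c.th j * (x * y) :=
    (central_mul_left_comm _ _ _).symm
  have z1 (x : Forms n) : ι ℂ (c.e j) * (c.th j * x) = 0 := ι_mul_theta_mul _ _
  have z2 (x : Forms n) : ι ℂ (conjCotangent (c.e j)) * (c.th j * x) = 0 :=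
    ι_conj_mul_theta_mul _ _
  have z3 (x : Forms n) : c.th j * (c.th j * x) = 0 := theta_mul_theta_mul _ _
  have z4 (x : Forms n) : (c.th j : Forms n) * (ι ℂ (c.e j) * x) = 0 := by
    rw [central_mul_left_comm, z1]
  have z5 (x : Forms n) : (c.th j : Forms n) * (ι ℂ (conjCotangent (c.e j)) * x) = 0 := by
    rw [central_mul_left_comm, z2]
  have z6 (x : Forms n) : ι ℂ (c.e j) * (ι ℂ (conjCotangent (c.e j)) * x) =
      -(Complex.I • (c.th j * x)) := by
    rw [th, coe_theta, smul_mul_assoc, smul_smul, mul_assoc]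
    simp
  have z7 (x : Forms n) : ι ℂ (conjCotangent (c.e j)) * (ι ℂ (c.e j) * x) =
      Complex.I • (c.th j * x) := by
    rw [ι_mul_ι_mul_comm, z6, neg_neg]
  simp only [add_mul, mul_add, mul_assoc, mv p, mv q, mv r, mv s, mc p, mc q, mc r, mc s, z1, z2,
    z3, z4, z5, z6, z7, ι_mul_ι_mul_self, mul_sub, mul_smul_comm, smul_sub]
  abel

end Coframe

end

end LinearHRR

/-! ### Positivity by induction on directions, and Poincaré duality -/

namespace LinearHRR

noncomputable section

open ExteriorAlgebra

variable {n : ℕ}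

namespace Coframe

variable (c : Coframe n)

/-- The exponential of `r` times the contraction with the Kähler form of the coframe. -/
def expD (r : ℂ) (l : List (Fin n)) : Module.End ℂ (Forms n) :=
  (l.map fun j => 1 + r • c.D j).prod

/-- The exponential of the Kähler form of the coframe. -/
def expTh (l : List (Fin n)) : CentralForms n := (l.map fun j => 1 + c.th j).prod

/-- The product of the volume forms of the complementary directions. -/
def complTh (l : List (Fin n)) : CentralForms n :=
  ∏ i ∈ Finset.univ.filter (· ∉ l), c.th i

variable {c}

theorem expD_nil (r : ℂ) (x : Forms n) : c.expD r [] x = x := by simp [expD]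

theorem expD_cons (r : ℂ) (j : Fin n) (l : List (Fin n)) (x : Forms n) :
    c.expD r (j :: l) x = c.expD r l x + r • c.D j (c.expD r l x) := by
  simp [expD]

theorem expD_mem_formsOn (r : ℂ) (l : List (Fin n)) {l' : List (Fin n)} {x : Forms n}
    (hx : x ∈ c.formsOn l') : c.expD r l x ∈ c.formsOn l' := by
  induction l with
  | nil => rwa [expD_nil]
  | cons j l ih =>
    rw [expD_cons]
    exact add_mem ih (Submodule.smul_mem _ _ (D_mem_formsOn j ih))

theorem expD_e_mul (r : ℂ) {j : Fin n} {l : List (Fin n)} (hj : j ∉ l) (x : Forms n) :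
    c.expD r l (ι ℂ (c.e j) * x) = ι ℂ (c.e j) * c.expD r l x := by
  induction l with
  | nil => rw [expD_nil, expD_nil]
  | cons a l ih =>
    rw [List.mem_cons, not_or] at hj
    rw [expD_cons, expD_cons, ih hj.2, D_e_mul _ (Ne.symm hj.1), mul_add, mul_smul_comm]

theorem expD_conj_mul (r : ℂ) {j : Fin n} {l : List (Fin n)} (hj : j ∉ l) (x : Forms n) :
    c.expD r l (ι ℂ (conjCotangent (c.e j)) * x) =
      ι ℂ (conjCotangent (c.e j)) * c.expD r l x := by
  induction l with
  | nil => rw [expD_nil, expD_nil]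
  | cons a l ih =>
    rw [List.mem_cons, not_or] at hj
    rw [expD_cons, expD_cons, ih hj.2, D_conj_mul _ (Ne.symm hj.1), mul_add, mul_smul_comm]

theorem expD_th_mul (r : ℂ) {j : Fin n} {l : List (Fin n)} (hj : j ∉ l) (x : Forms n) :
    c.expD r l (c.th j * x) = c.th j * c.expD r l x := by
  induction l with
  | nil => rw [expD_nil, expD_nil]
  | cons a l ih =>
    rw [List.mem_cons, not_or] at hj
    rw [expD_cons, expD_cons, ih hj.2, D_th_mul_of_ne _ (Ne.symm hj.1), mul_add, mul_smul_comm]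

theorem D_expD (r : ℂ) (j : Fin n) (l : List (Fin n)) (x : Forms n) :
    c.expD r l (c.D j x) = c.D j (c.expD r l x) := by
  induction l with
  | nil => rw [expD_nil, expD_nil]
  | cons a l ih => rw [expD_cons, expD_cons, ih, map_add, map_smul, D_comm]

theorem expD_neg_expD (r : ℂ) (l : List (Fin n)) (x : Forms n) :
    c.expD (-r) l (c.expD r l x) = x := by
  induction l generalizing x with
  | nil => rw [expD_nil, expD_nil]
  | cons a l ih =>
    rw [expD_cons, expD_cons, map_add, ih, map_smul, D_expD, ih, map_add, map_smul, D_D]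
    simp

theorem complTh_eq_mul {j : Fin n} {l : List (Fin n)} (hj : j ∉ l) :
    c.complTh l = c.th j * c.complTh (j :: l) := by
  have h : Finset.univ.filter (· ∉ j :: l) = (Finset.univ.filter (· ∉ l)).erase j := by
    ext i; simp [not_or]
  rw [complTh, complTh, h, Finset.mul_prod_erase]
  simpa using hj

theorem expTh_cons (j : Fin n) (l : List (Fin n)) :
    c.expTh (j :: l) = (1 + c.th j) * c.expTh l := by
  simp [expTh]

theorem complTh_mul_expTh_mem_contractInvariants {j : Fin n} {l : List (Fin n)} (hj : j ∉ l) :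
    c.complTh (j :: l) * c.expTh l ∈
      contractInvariants (c.d j) ⊓ contractInvariants (c.db j) := by
  refine mul_mem (prod_mem fun i hi => ?_) (list_prod_mem fun z hz => ?_)
  · refine c.th_mem_contractInvariants ?_
    rintro rfl
    simp at hi
  · obtain ⟨i, hi, rfl⟩ := List.mem_map.mp hz
    refine add_mem (one_mem _) (c.th_mem_contractInvariants ?_)
    rintro rfl
    exact hj hi

theorem complTh_mul_expTh_mem_weilInvariants (l l' : List (Fin n)) :
    c.complTh l * c.expTh l' ∈ weilInvariants n := by
  refine mul_mem (prod_mem fun i hi => c.th_mem_weilInvariants i) (list_prod_mem fun z hz => ?_)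
  obtain ⟨i, hi, rfl⟩ := List.mem_map.mp hz
  exact add_mem (one_mem _) (c.th_mem_weilInvariants i)

theorem D_cons_expand {j : Fin n} {l : List (Fin n)} (hj : j ∉ l) {a b b' d : Forms n}
    (ha : a ∈ c.formsOn l) (hb : b ∈ c.formsOn l) (hb' : b' ∈ c.formsOn l)
    (hd : d ∈ c.formsOn l) :
    c.D j (a + ι ℂ (c.e j) * b + ι ℂ (conjCotangent (c.e j)) * b' + c.th j * d) = d := by
  rw [mem_formsOn] at ha hb hb' hd
  have h1 : c.D j a = 0 := by rw [D_apply, (ha j hj).1, map_zero, smul_zero]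
  have h2 : c.D j (ι ℂ (c.e j) * b) = 0 := by
    rw [D_apply, contract_ι_mul, (hb j hj).1, mul_zero, sub_zero, map_smul, (hb j hj).2,
      smul_zero, smul_zero]
  have h3 : c.D j (ι ℂ (conjCotangent (c.e j)) * b') = 0 := by
    rw [D_apply, contract_ι_mul, (hb' j hj).1, mul_zero, sub_zero, map_smul, (hb' j hj).2,
      smul_zero, smul_zero]
  rw [map_add, map_add, map_add, h1, h2, h3, c.D_th_mul_of_eq_zero (hd j hj).1 (hd j hj).2]
  simp

theorem weil_expand (j : Fin n) (a b b' d : Forms n) :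
    weil (a + ι ℂ (c.e j) * b + ι ℂ (conjCotangent (c.e j)) * b' + (c.th j : Forms n) * d) =
      weil a + ι ℂ (c.e j) * (Complex.I • weil b)
        + ι ℂ (conjCotangent (c.e j)) * (-Complex.I • weil b') + (c.th j : Forms n) * weil d := by
  rw [map_add, map_add, map_add, map_mul, map_mul, map_mul, weil_ι, weil_ι, rotate_conjCotangent,
    c.rotate_e, conjCotangent_smul, mem_weilInvariants.mp (c.th_mem_weilInvariants j)]
  simp

theorem adj_expand (j : Fin n) (a b b' d : Forms n) :
    adj (a + ι ℂ (c.e j) * b + ι ℂ (conjCotangent (c.e j)) * b' + (c.th j : Forms n) * d) =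
      adj a + ι ℂ (c.e j) * parity (adj b')
        + ι ℂ (conjCotangent (c.e j)) * parity (adj b) + (c.th j : Forms n) * (-adj d) := by
  rw [adj_add, adj_add, adj_add, adj_mul, adj_mul, adj_mul, adj_ι, adj_ι,
    conjCotangent_conjCotangent, mul_ι, mul_ι]
  have : adj (c.th j : Forms n) = -c.th j := adj_theta _
  rw [this, mul_neg, ← central_comm, mul_neg]
  abel

variable {t : Forms n →ₗ[ℂ] ℂ}

theorem integral_eq_zero_of_contract_d (ht : IsIntegral t) {j : Fin n} {x : Forms n}
    (hx : contract (c.d j) x = 0) : t x = 0 := by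
  have h := ht (c.d j) (ι ℂ (c.e j) * x)
  rwa [contract_ι_mul, hx, d_e_self, one_smul, mul_zero, sub_zero] at h

theorem integral_eq_zero_of_contract_db (ht : IsIntegral t) {j : Fin n} {x : Forms n}
    (hx : contract (c.db j) x = 0) : t x = 0 := by
  have h := ht (c.db j) (ι ℂ (conjCotangent (c.e j)) * x)
  rwa [contract_ι_mul, hx, db_conj_self, one_smul, mul_zero, sub_zero] at h

/-- Only terms containing both e_j and ē_j have a nonzero integral. The summand 1 selects the
coefficient s of i e_j ∧ ē_j, and the summand `th j` supplies this factor to u. -/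
theorem integral_one_add_th_mul (ht : IsIntegral t) {j : Fin n} {l : List (Fin n)}
    (hj : j ∉ l) {z : CentralForms n}
    (hz : z ∈ contractInvariants (c.d j) ⊓ contractInvariants (c.db j)) {u v w s : Forms n}
    (hu : u ∈ c.formsOn l) (hv : v ∈ c.formsOn l) (hw : w ∈ c.formsOn l) :
    t ((z : Forms n) * ((1 + c.th j : CentralForms n) *
      (u + ι ℂ (c.e j) * v + ι ℂ (conjCotangent (c.e j)) * w + c.th j * s))) =
      t ((z : Forms n) * (c.th j * (u + s))) := by
  have e1 : t (z * u) = 0 := by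
    apply integral_eq_zero_of_contract_d (c := c) (j := j) ht
    rw [hz.1, ((mem_formsOn _).mp hu j hj).1, mul_zero]
  have e2 : t ((z : Forms n) * (ι ℂ (c.e j) * v)) = 0 := by
    apply integral_eq_zero_of_contract_db (c := c) (j := j) ht
    rw [hz.2, contract_ι_mul, ((mem_formsOn _).mp hv j hj).2, db_e]
    simp
  have e3 : t ((z : Forms n) * (ι ℂ (conjCotangent (c.e j)) * w)) = 0 := by
    apply integral_eq_zero_of_contract_d (c := c) (j := j) ht
    rw [hz.1, contract_ι_mul, ((mem_formsOn _).mp hw j hj).1, d_conj]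
    simp
  have z1 : (c.th j : Forms n) * (ι ℂ (c.e j) * v) = 0 := by
    rw [central_mul_left_comm]; exact ι_mul_theta_mul _ _
  have z2 : (c.th j : Forms n) * (ι ℂ (conjCotangent (c.e j)) * w) = 0 := by
    rw [central_mul_left_comm]; exact ι_conj_mul_theta_mul _ _
  have z3 : c.th j * (c.th j * s) = 0 := theta_mul_theta_mul _ _
  rw [Subalgebra.coe_add, Subalgebra.coe_one, add_mul, one_mul]
  simp only [mul_add, map_add, e1, e2, e3, z1, z2, z3, mul_zero, map_zero]
  ring

open scoped ComplexOrder

/-- Expanding along a direction j turns the form into the sum of four copies of the form on the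
remaining directions, one for each of a, b, b', d. In the empty list x is a constant r and the value
is |r|². -/
theorem exp_form_pos (ht : IsIntegral t) (hvol : t c.vol = 1) {l : List (Fin n)} (hl : l.Nodup)
    {x : Forms n} (hx : x ∈ c.formsOn l) :
    0 ≤ t ((c.complTh l * c.expTh l : CentralForms n) *
        (weil (c.expD (-1) l x) * adj (c.expD 1 l x))) ∧
      (t ((c.complTh l * c.expTh l : CentralForms n) *
        (weil (c.expD (-1) l x) * adj (c.expD 1 l x))) = 0 → x = 0) := by
  induction l generalizing x with
  | nil =>
    rw [mem_formsOn] at hx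
    obtain ⟨r, rfl⟩ := c.exists_algebraMap_of_contract_eq_zero (x := x)
      (fun j => (hx j (by simp)).1) (fun j => (hx j (by simp)).2)
    have hz : c.complTh [] * c.expTh [] = c.vol := by simp [complTh, expTh, vol]
    rw [hz, expD_nil, expD_nil, adj_algebraMap, AlgHom.commutes, ← map_mul, ← Algebra.commutes,
      ← Algebra.smul_def, map_smul, hvol, Complex.mul_conj, smul_eq_mul, mul_one]
    refine ⟨by exact_mod_cast Complex.normSq_nonneg r, fun h => ?_⟩
    rw [Complex.ofReal_eq_zero, Complex.normSq_eq_zero] at h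
    rw [h, map_zero]
  | cons j l ih =>
    rw [List.nodup_cons] at hl
    obtain ⟨hj, hl⟩ := hl
    obtain ⟨a, ha, b, hb, b', hb', d, hd, rfl⟩ := c.formsOn_cons hx
    -- The cross terms between a and d are where the opposite exponents matter. With A = weil a, E =
    -- weil d, the total is (A - E)(a* + d*) - (A - E)d* + E(a* + d*), which equals A a* + E d*.
    have key : t ((c.complTh (j :: l) * c.expTh (j :: l) : CentralForms n) *
        (weil (c.expD (-1) (j :: l) (a + ι ℂ (c.e j) * b + ι ℂ (conjCotangent (c.e j)) * b'
            + (c.th j : Forms n) * d)) *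
          adj (c.expD 1 (j :: l) (a + ι ℂ (c.e j) * b + ι ℂ (conjCotangent (c.e j)) * b'
            + (c.th j : Forms n) * d)))) =
        t ((c.complTh l * c.expTh l : CentralForms n) *
          (weil (c.expD (-1) l a) * adj (c.expD 1 l a))) +
        t ((c.complTh l * c.expTh l : CentralForms n) *
          (weil (c.expD (-1) l b) * adj (c.expD 1 l b))) +
        t ((c.complTh l * c.expTh l : CentralForms n) *
          (weil (c.expD (-1) l b') * adj (c.expD 1 l b'))) +
        t ((c.complTh l * c.expTh l : CentralForms n) *
          (weil (c.expD (-1) l d) * adj (c.expD 1 l d))) := by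
      have hexp (r : ℂ) : c.expD r (j :: l) (a + ι ℂ (c.e j) * b
          + ι ℂ (conjCotangent (c.e j)) * b' + (c.th j : Forms n) * d) =
          (c.expD r l a + r • c.expD r l d) + ι ℂ (c.e j) * c.expD r l b
            + ι ℂ (conjCotangent (c.e j)) * c.expD r l b' + (c.th j : Forms n) * c.expD r l d := by
        rw [expD_cons, map_add, map_add, map_add, expD_e_mul r hj, expD_conj_mul r hj,
          expD_th_mul r hj, D_cons_expand hj (expD_mem_formsOn r l ha) (expD_mem_formsOn r l hb)
          (expD_mem_formsOn r l hb') (expD_mem_formsOn r l hd)]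
        abel
      rw [hexp, hexp, weil_expand, adj_expand, mul_expand, expTh_cons]
      have hz := complTh_mul_expTh_mem_contractInvariants (c := c) hj
      have hpar := parity_of_mem_weilInvariants
        (mul_mem (complTh_mul_expTh_mem_weilInvariants (c := c) (j :: l) l)
          (c.th_mem_weilInvariants j))
      set z := c.complTh (j :: l) * c.expTh l with hz_def
      have e1 : c.complTh (j :: l) * ((1 + c.th j) * c.expTh l) = z * (1 + c.th j) := by
        rw [hz_def]; ring
      have e2 : c.complTh l * c.expTh l = z * c.th j := by
        rw [hz_def, complTh_eq_mul hj]; ring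
      have ma := fun r => expD_mem_formsOn (c := c) r l ha
      have mb := fun r => expD_mem_formsOn (c := c) r l hb
      have mb' := fun r => expD_mem_formsOn (c := c) r l hb'
      have md := fun r => expD_mem_formsOn (c := c) r l hd
      have mA (r : ℂ) := add_mem (ma r) (Submodule.smul_mem _ r (md r))
      have mp := weil_mem_formsOn (mA (-1))
      have mp' := adj_mem_formsOn (mA 1)
      have mI (r : ℂ) {y : Forms n} (hy : y ∈ c.formsOn l) :=
        Submodule.smul_mem _ r (weil_mem_formsOn hy)
      rw [e1, e2, Subalgebra.coe_mul, mul_assoc, integral_one_add_th_mul ht hj hz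
        (mul_mem_formsOn mp mp')
        (add_mem (mul_mem_formsOn (parity_mem_formsOn mp)
          (parity_mem_formsOn (adj_mem_formsOn (mb' 1))))
          (mul_mem_formsOn (mI Complex.I (mb (-1))) mp'))
        (add_mem (mul_mem_formsOn (parity_mem_formsOn mp)
          (parity_mem_formsOn (adj_mem_formsOn (mb 1))))
          (mul_mem_formsOn (mI (-Complex.I) (mb' (-1))) mp')), ← mul_assoc, ← Subalgebra.coe_mul]
      -- The signs left over in the b and b' terms are parities, which the integral ignores because
      -- the top degree 2n is even.
      have hp (y : Forms n) :
          t ((z * c.th j : CentralForms n) * parity y) = t ((z * c.th j : CentralForms n) * y) := by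
        rw [← c.integral_parity ht (_ * y), map_mul parity, hpar]
      rw [← hp (weil (c.expD (-1) l b) * _), ← hp (weil (c.expD (-1) l b') * _), ← map_add,
        ← map_add, ← map_add, ← mul_add, ← mul_add, ← mul_add]
      congr 2
      simp only [map_add, map_smul, adj_add, map_mul, smul_mul_assoc, mul_add, add_mul,
        one_smul, neg_smul, mul_neg, neg_mul, smul_sub, smul_smul, Complex.I_mul_I, map_neg]
      simp only [smul_neg, smul_smul, Complex.I_mul_I, neg_smul, one_smul]
      abel
    have ia := ih hl ha
    have ib := ih hl hb
    have ib' := ih hl hb'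
    have id := ih hl hd
    rw [key]
    refine ⟨add_nonneg (add_nonneg (add_nonneg ia.1 ib.1) ib'.1) id.1, fun h => ?_⟩
    rw [add_eq_zero_iff_of_nonneg (add_nonneg (add_nonneg ia.1 ib.1) ib'.1) id.1,
      add_eq_zero_iff_of_nonneg (add_nonneg ia.1 ib.1) ib'.1,
      add_eq_zero_iff_of_nonneg ia.1 ib.1] at h
    rw [ia.2 h.1.1.1, ib.2 h.1.1.2, ib'.2 h.1.2, id.2 h.2]
    simp

theorem mem_formsOn_finRange (x : Forms n) : x ∈ c.formsOn (List.finRange n) := by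
  rw [mem_formsOn]
  intro i hi
  exact absurd (List.mem_finRange i) hi

/-- The exponential is invertible: the inverse of 1 + θ is 1 - θ when θ² = 0. -/
theorem exists_expTh_mul_eq (l : List (Fin n)) (x : Forms n) : ∃ y, c.expTh l * y = x := by
  induction l generalizing x with
  | nil => exact ⟨x, by simp [expTh]⟩
  | cons j l ih =>
    obtain ⟨y, hy⟩ := ih (x - c.th j * x)
    refine ⟨y, ?_⟩
    have h : (c.th j : Forms n) * (c.th j * x) = 0 := theta_mul_theta_mul _ _
    rw [expTh_cons, Subalgebra.coe_mul, mul_assoc, hy, Subalgebra.coe_add, Subalgebra.coe_one,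
      add_mul, one_mul, mul_sub, h]
    abel

/-- Poincaré duality. -/
theorem eq_zero_of_integral_mul_eq_zero (c : Coframe n) (ht : IsIntegral t) (hvol : t c.vol = 1)
    {x : Forms n} (hx : ∀ y, t (x * y) = 0) : x = 0 := by
  obtain ⟨y, hy⟩ := exists_expTh_mul_eq (c := c) (List.finRange n) x
  -- Chosen so that the left factor of the positive form at w is y: `expD 1` inverts `expD (-1)`,
  -- and `weil` has fourth power 1. The form at w is then the integral of x against some form, hence
  -- zero.
  set w := c.expD 1 (List.finRange n) (weil (weil (weil y))) with hw
  have h1 : weil (c.expD (-1) (List.finRange n) w) = y := by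
    rw [hw, expD_neg_expD, weil_weil, weil_weil, parity_parity]
  have h2 : c.complTh (List.finRange n) = 1 := by simp [complTh]
  have h3 := (exp_form_pos (c := c) ht hvol (List.nodup_finRange n) (mem_formsOn_finRange w)).2
  rw [h1, h2, one_mul, ← mul_assoc, hy] at h3
  have h4 := h3 (hx _)
  rw [h4] at h1
  rw [← hy, ← h1]
  simp

end Coframe

end

end LinearHRR

namespace LinearHRR

noncomputable section

open ExteriorAlgebra

variable {n : ℕ}

/-! ### The classical hard Lefschetz theorem and Hodge–Riemann relations -/

/-- A graded space with a raising and a lowering operator as in a representation of `sl₂`. -/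
structure LefschetzTriple {V : Type*} [AddCommGroup V] [Module ℂ V] (N : ℕ)
    (L D : Module.End ℂ V) (W : ℕ → Submodule ℂ V) : Prop where
  raise : ∀ k, ∀ x ∈ W k, L x ∈ W (k + 2)
  lower : ∀ k, ∀ x ∈ W (k + 2), D x ∈ W k
  lower_zero : ∀ k < 2, ∀ x ∈ W k, D x = 0
  comm : ∀ k, ∀ x ∈ W k, D (L x) = L (D x) + ((N : ℂ) - k) • x

namespace LefschetzTriple

variable {V : Type*} [AddCommGroup V] [Module ℂ V] {N : ℕ} {L D : Module.End ℂ V}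
  {W : ℕ → Submodule ℂ V}

theorem pow_mem (h : LefschetzTriple N L D W) {k : ℕ} {x : V} (hx : x ∈ W k) (j : ℕ) :
    (L ^ j) x ∈ W (k + 2 * j) := by
  induction j with
  | zero => simpa using hx
  | succ j ih =>
    rw [pow_succ', Module.End.mul_apply, mul_add, ← add_assoc]
    exact h.raise _ _ ih

theorem lower_pow (h : LefschetzTriple N L D W) {k : ℕ} {x : V} (hx : x ∈ W k) (j : ℕ) :
    D ((L ^ (j + 1)) x) = (L ^ (j + 1)) (D x) + (((j : ℂ) + 1) * (N - k - j)) • (L ^ j) x := by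
  induction j with
  | zero => simpa using h.comm k x hx
  | succ j ih =>
    rw [pow_succ' L (j + 1), Module.End.mul_apply, h.comm _ _ (h.pow_mem hx (j + 1)), ih, map_add,
      map_smul, Module.End.mul_apply, pow_succ' L j]
    simp only [Module.End.mul_apply]
    push_cast
    module

/-- Below the middle degree the coefficient (j+1)(N-k-j) of `lower_pow` is nonzero. An inner
induction lowers j, once the outer induction on the degree k has shown D x = 0. -/
theorem eq_zero_of_pow (h : LefschetzTriple N L D W) {k : ℕ} {x : V} (hx : x ∈ W k) {j : ℕ}
    (hj : j + k ≤ N)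
    (h0 : (L ^ j) x = 0) : x = 0 := by
  induction k using Nat.strong_induction_on generalizing x j with
  | _ k ihk =>
    induction j with
    | zero => simpa using h0
    | succ j ihj =>
      have h1 := h.lower_pow hx j
      rw [h0, map_zero] at h1
      have hD : D x = 0 := by
        by_cases hk : k < 2
        · exact h.lower_zero k hk x hx
        · obtain ⟨m, rfl⟩ : ∃ m, k = m + 2 := ⟨k - 2, by omega⟩
          -- Applying L once more to `lower_pow` kills the term in L^j x and leaves L^{j+2}(D x) =
          -- 0. The sum of exponent and degree is unchanged, so the induction hypothesis applies to
          -- D x.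
          refine ihk m (by omega) (h.lower m x hx) (j := j + 2) (by omega) ?_
          have h2 := congrArg L h1
          rw [map_zero, map_add, map_smul, ← Module.End.mul_apply L, ← Module.End.mul_apply L,
            ← pow_succ', ← pow_succ', h0, smul_zero, add_zero] at h2
          exact h2.symm
      rw [hD, map_zero, zero_add] at h1
      refine ihj (by omega) ((smul_eq_zero.mp h1.symm).resolve_left ?_)
      refine mul_ne_zero (by exact_mod_cast Nat.succ_ne_zero j) ?_
      have : ((N - k - j : ℕ) : ℂ) ≠ 0 := by
        rw [Nat.cast_ne_zero]; omega
      rwa [Nat.cast_sub (by omega), Nat.cast_sub (by omega)] at this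

/-- For j = N - k the last coefficient of `lower_pow` vanishes, so L^{j+1} kills D x, on which it is
injective. -/
theorem lower_eq_zero_of_pow (h : LefschetzTriple N L D W) {k : ℕ} {x : V} (hx : x ∈ W k) {j : ℕ}
    (hj : j + k = N)
    (h0 : (L ^ (j + 1)) x = 0) : D x = 0 := by
  by_cases hk : k < 2
  · exact h.lower_zero k hk x hx
  · obtain ⟨m, rfl⟩ : ∃ m, k = m + 2 := ⟨k - 2, by omega⟩
    have h1 := h.lower_pow hx j
    have h2 : (N : ℂ) - (m + 2 : ℕ) - j = 0 := by
      rw [← hj]; push_cast; ring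
    rw [h0, map_zero, h2, mul_zero, zero_smul, add_zero] at h1
    exact h.eq_zero_of_pow (h.lower m x hx) (by omega) h1.symm

end LefschetzTriple

/-! ### The Lefschetz operators of a coframe and the classical relations -/

namespace Coframe

variable (c : Coframe n)

/-- The Kähler form of a coframe. -/
def omega : CentralForms n := ∑ j, c.th j

/-- The Kähler form of a list of coframe directions. -/
def omegaOn (l : List (Fin n)) : CentralForms n := (l.map c.th).sum

/-- The contraction adjoint to multiplication with `omegaOn`. -/
def DOn (l : List (Fin n)) : Module.End ℂ (Forms n) := (l.map c.D).sum

theorem DOn_cons (j : Fin n) (l : List (Fin n)) (x : Forms n) :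
    c.DOn (j :: l) x = c.D j x + c.DOn l x := by
  simp [DOn]

theorem omegaOn_cons_mul (j : Fin n) (l : List (Fin n)) (x : Forms n) :
    (c.omegaOn (j :: l) : Forms n) * x = c.th j * x + c.omegaOn l * x := by
  simp [omegaOn, add_mul]

theorem DOn_th_mul_of_notMem {j : Fin n} {l : List (Fin n)} (hj : j ∉ l) (x : Forms n) :
    c.DOn l (c.th j * x) = c.th j * c.DOn l x := by
  induction l with
  | nil => simp [DOn]
  | cons a l ih =>
    rw [List.mem_cons, not_or] at hj
    rw [DOn_cons, DOn_cons, ih hj.2, D_th_mul_of_ne _ (Ne.symm hj.1), mul_add]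

theorem D_omegaOn_mul {j : Fin n} {l : List (Fin n)} (hj : j ∉ l) (x : Forms n) :
    c.D j (c.omegaOn l * x) = c.omegaOn l * c.D j x := by
  induction l with
  | nil => simp [omegaOn]
  | cons a l ih =>
    rw [List.mem_cons, not_or] at hj
    rw [omegaOn_cons_mul, omegaOn_cons_mul, map_add, ih hj.2, D_th_mul_of_ne _ hj.1]

/-- Operators attached to different directions commute, so only the diagonal commutators `D_th_mul`
contribute. -/
theorem DOn_omegaOn_mul {l : List (Fin n)} (hl : l.Nodup) (x : Forms n) :
    c.DOn l (c.omegaOn l * x) = c.omegaOn l * c.DOn l x + ((l.length : ℂ) • x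
      - (l.map fun j => ι ℂ (c.e j) * contract (c.d j) x
        + ι ℂ (conjCotangent (c.e j)) * contract (c.db j) x).sum) := by
  induction l with
  | nil => simp [DOn, omegaOn]
  | cons j l ih =>
    rw [List.nodup_cons] at hl
    rw [omegaOn_cons_mul, omegaOn_cons_mul, map_add, DOn_cons, DOn_cons, D_th_mul,
      DOn_th_mul_of_notMem _ hl.1, D_omegaOn_mul _ hl.1, ih hl.2, DOn_cons, List.map_cons,
      List.sum_cons, List.length_cons, mul_add, mul_add]
    push_cast
    rw [add_smul, one_smul]
    abel

variable {c}

theorem euler_of_mem_formsOn {l : List (Fin n)} (hl : l.Nodup) {x : Forms n}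
    (hx : x ∈ c.formsOn l) :
    (l.map fun j => ι ℂ (c.e j) * contract (c.d j) x
        + ι ℂ (conjCotangent (c.e j)) * contract (c.db j) x).sum = c.euler x := by
  rw [euler_apply, ← List.sum_toFinset _ hl]
  refine Finset.sum_subset (Finset.subset_univ _) fun j _ hj => ?_
  have := (c.mem_formsOn).mp hx j (by simpa using hj)
  rw [this.1, this.2]
  simp

theorem th_mul_mem_formsOn {l : List (Fin n)} {j : Fin n} (hj : j ∈ l) {x : Forms n}
    (hx : x ∈ c.formsOn l) : c.th j * x ∈ c.formsOn l := by
  rw [mem_formsOn] at hx ⊢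
  intro i hi
  have hij : i ≠ j := by rintro rfl; exact hi hj
  rw [contract_d_th_mul_of_ne _ hij, contract_db_th_mul_of_ne _ hij, (hx i hi).1, (hx i hi).2]
  simp

theorem omegaOn_mul_mem_formsOn {l l' : List (Fin n)} (hl : ∀ j ∈ l, j ∈ l') {x : Forms n}
    (hx : x ∈ c.formsOn l') : c.omegaOn l * x ∈ c.formsOn l' := by
  induction l with
  | nil => simp [omegaOn]
  | cons j l ih =>
    rw [omegaOn_cons_mul]
    exact add_mem (th_mul_mem_formsOn (hl j List.mem_cons_self) hx)
      (ih fun i hi => hl i (List.mem_cons_of_mem _ hi))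

theorem omegaOn_mem_formsOfDegree (l : List (Fin n)) :
    (c.omegaOn l : Forms n) ∈ formsOfDegree n 2 := by
  induction l with
  | nil => simp [omegaOn]
  | cons j l ih =>
    have := c.omegaOn_cons_mul j l 1
    rw [mul_one, mul_one, mul_one] at this
    rw [this]
    exact add_mem (theta_mem_formsOfDegree _) ih

theorem D_mem_formsOfDegree (j : Fin n) {k : ℕ} {x : Forms n} (hx : x ∈ formsOfDegree n (k + 2)) :
    c.D j x ∈ formsOfDegree n k := by
  rw [D_apply]
  refine Submodule.smul_mem _ _ ?_
  exact (contract_mem_formsOfDegree _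
    ((contract_mem_formsOfDegree _ hx).2 (k + 1) rfl)).2 k rfl

theorem D_eq_zero_of_mem (j : Fin n) {k : ℕ} (hk : k < 2) {x : Forms n}
    (hx : x ∈ formsOfDegree n k) : c.D j x = 0 := by
  rw [D_apply]
  rcases k with _ | k
  · rw [(contract_mem_formsOfDegree _ hx).1 rfl, map_zero, smul_zero]
  · obtain rfl : k = 0 := by omega
    rw [(contract_mem_formsOfDegree _ ((contract_mem_formsOfDegree _ hx).2 0 rfl)).1 rfl, smul_zero]

theorem DOn_mem {V : Submodule ℂ (Forms n)} {x : Forms n} (h : ∀ j, c.D j x ∈ V)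
    (l : List (Fin n)) : c.DOn l x ∈ V := by
  induction l with
  | nil => simp [DOn]
  | cons j l ih =>
    rw [DOn_cons]
    exact add_mem (h j) ih

theorem lefschetzTriple {l : List (Fin n)} (hl : l.Nodup) :
    LefschetzTriple l.length (LinearMap.mulLeft ℂ (c.omegaOn l : Forms n)) (c.DOn l)
      (fun k => c.formsOn l ⊓ formsOfDegree n k) where
  raise k x hx := by
    refine ⟨omegaOn_mul_mem_formsOn (fun _ h => h) hx.1, ?_⟩
    rw [add_comm k 2]
    exact mul_mem_formsOfDegree (omegaOn_mem_formsOfDegree l) hx.2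
  lower k x hx := ⟨DOn_mem (fun j => D_mem_formsOn j hx.1) l,
    DOn_mem (fun j => D_mem_formsOfDegree j hx.2) l⟩
  lower_zero k hk x hx := by
    have := DOn_mem (c := c) (V := ⊥) (x := x) (fun j => D_eq_zero_of_mem j hk hx.2) l
    simpa using this
  comm k x hx := by
    rw [LinearMap.mulLeft_apply, LinearMap.mulLeft_apply, DOn_omegaOn_mul _ hl,
      euler_of_mem_formsOn hl hx.1, c.euler_of_mem hx.2, sub_smul]

theorem complTh_mul_th {l : List (Fin n)} {j : Fin n} (hj : j ∉ l) :
    c.complTh l * c.th j = 0 := by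
  rw [complTh_eq_mul hj, mul_right_comm]
  have h : c.th j * c.th j = 0 := theta_mul_self _
  rw [h, zero_mul]

theorem complTh_mul_omega {l : List (Fin n)} (hl : l.Nodup) :
    c.complTh l * c.omega = c.complTh l * c.omegaOn l := by
  rw [omega, omegaOn, ← List.sum_toFinset _ hl, Finset.mul_sum, Finset.mul_sum]
  refine (Finset.sum_subset (Finset.subset_univ _) fun j _ hj => ?_).symm
  exact complTh_mul_th (by simpa using hj)

theorem complTh_mul_omega_pow {l : List (Fin n)} (hl : l.Nodup) (r : ℕ) :
    c.complTh l * c.omega ^ r = c.complTh l * c.omegaOn l ^ r := by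
  induction r with
  | zero => simp
  | succ r ih =>
    rw [pow_succ, ← mul_assoc, ih, mul_right_comm, complTh_mul_omega hl, pow_succ]
    ring

/-- The list of directions complementary to `l`. -/
def complList (l : List (Fin n)) : List (Fin n) := (Finset.univ.filter (· ∉ l)).toList

theorem mem_complList {l : List (Fin n)} {j : Fin n} : j ∈ complList l ↔ j ∉ l := by
  simp [complList]

theorem complTh_eq_list (l : List (Fin n)) : c.complTh l = ((complList l).map c.th).prod := by
  rw [complTh, complList, Finset.prod_map_toList]

theorem DList_complTh_mul {l : List (Fin n)} {x : Forms n} (hx : x ∈ c.formsOn l) :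
    c.DList (complList l) (c.complTh l * x) = x := by
  rw [complTh_eq_list]
  exact c.DList_thList_mul (Finset.nodup_toList _)
    fun j hj => (c.mem_formsOn).mp hx j (mem_complList.mp hj)

theorem eq_zero_of_complTh_mul {l : List (Fin n)} {x : Forms n} (hx : x ∈ c.formsOn l)
    (h : (c.complTh l : Forms n) * x = 0) : x = 0 := by
  rw [← DList_complTh_mul hx, h, map_zero]

theorem th_mul_D_th_mul (j : Fin n) (x : Forms n) :
    c.th j * c.D j (c.th j * x) = c.th j * x := by
  have z1 (x : Forms n) : (c.th j : Forms n) * (ι ℂ (c.e j) * x) = 0 := by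
    rw [central_mul_left_comm]; exact ι_mul_theta_mul _ _
  have z2 (x : Forms n) : (c.th j : Forms n) * (ι ℂ (conjCotangent (c.e j)) * x) = 0 := by
    rw [central_mul_left_comm]; exact ι_conj_mul_theta_mul _ _
  have z3 (x : Forms n) : (c.th j : Forms n) * (c.th j * x) = 0 := theta_mul_theta_mul _ _
  rw [D_th_mul, mul_add, mul_sub, mul_sub, z1, z2, z3, sub_zero, sub_zero, add_zero]

theorem thList_mul_DList {l : List (Fin n)} (hl : l.Nodup) (x : Forms n) :
    (l.map c.th).prod * c.DList l ((l.map c.th).prod * x) = (l.map c.th).prod * x := by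
  induction l generalizing x with
  | nil => simp [DList_nil]
  | cons j l ih =>
    rw [List.nodup_cons] at hl
    rw [List.map_cons, List.prod_cons, Subalgebra.coe_mul, mul_assoc, mul_assoc, DList_cons,
      DList_th_mul_of_notMem _ hl.1, central_mul_left_comm, th_mul_D_th_mul,
      central_mul_left_comm, ih hl.2]

theorem complTh_mul_DList (l : List (Fin n)) (x : Forms n) :
    c.complTh l * c.DList (complList l) (c.complTh l * x) = c.complTh l * x := by
  rw [complTh_eq_list]
  exact thList_mul_DList (Finset.nodup_toList _) x

theorem DList_thList_mem_formsOfDegree {l : List (Fin n)} {k : ℕ} {x : Forms n}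
    (hl : l.Nodup) (hx : x ∈ formsOfDegree n k) :
    c.DList l ((l.map c.th).prod * x) ∈ formsOfDegree n k := by
  induction l generalizing x with
  | nil => simpa [DList_nil] using hx
  | cons j l ih =>
    rw [List.nodup_cons] at hl
    rw [List.map_cons, List.prod_cons, Subalgebra.coe_mul, mul_assoc, DList_cons,
      DList_th_mul_of_notMem _ hl.1]
    refine D_mem_formsOfDegree j ?_
    rw [add_comm]
    exact mul_mem_formsOfDegree (theta_mem_formsOfDegree _) (ih hl.2 hx)

/-- Modulo the forms killed by `complTh l`, every form is generated by the directions in `l`. -/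
theorem exists_formsOn (l : List (Fin n)) {k : ℕ} {x : Forms n} (hx : x ∈ formsOfDegree n k) :
    ∃ y ∈ c.formsOn l, y ∈ formsOfDegree n k ∧
      (c.complTh l : Forms n) * y = c.complTh l * x := by
  refine ⟨c.DList (complList l) (c.complTh l * x), ?_, ?_, complTh_mul_DList l x⟩
  · rw [mem_formsOn]
    exact fun i hi => c.contract_DList (mem_complList.mpr hi) _
  · rw [complTh_eq_list]
    exact DList_thList_mem_formsOfDegree (Finset.nodup_toList _) hx

theorem mulLeft_pow_apply (z : CentralForms n) (r : ℕ) (x : Forms n) :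
    ((LinearMap.mulLeft ℂ (z : Forms n)) ^ r) x = (z ^ r : CentralForms n) * x := by
  rw [LinearMap.pow_mulLeft, LinearMap.mulLeft_apply, Subalgebra.coe_pow]

theorem omegaOn_pow_mul_mem_formsOn {l : List (Fin n)} (r : ℕ) {x : Forms n}
    (hx : x ∈ c.formsOn l) : (c.omegaOn l ^ r : CentralForms n) * x ∈ c.formsOn l := by
  induction r with
  | zero => simpa using hx
  | succ r ih =>
    rw [pow_succ', Subalgebra.coe_mul, mul_assoc]
    exact omegaOn_mul_mem_formsOn (fun _ h => h) ih

/-- The hard Lefschetz theorem. -/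
theorem hard_lefschetz {l : List (Fin n)} (hl : l.Nodup) {k r : ℕ} (hr : r + k = l.length)
    {x : Forms n} (hx : x ∈ formsOfDegree n k)
    (h : (c.complTh l * c.omega ^ r : CentralForms n) * x = 0) :
    (c.complTh l : Forms n) * x = 0 := by
  obtain ⟨y, hy, hyk, hxy⟩ := exists_formsOn (c := c) l hx
  rw [complTh_mul_omega_pow hl, mul_comm, Subalgebra.coe_mul, mul_assoc, ← hxy,
    central_mul_left_comm, ← central_mul_left_comm] at h
  rw [central_mul_left_comm] at h
  have h1 := eq_zero_of_complTh_mul (omegaOn_pow_mul_mem_formsOn r hy) h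
  have h2 := (lefschetzTriple hl).eq_zero_of_pow ⟨hy, hyk⟩ hr.le (j := r)
    (by rw [mulLeft_pow_apply]; exact h1)
  rw [← hxy, h2, mul_zero]

/-- `expD r` is the exponential of r times `DOn`, since the D_j commute and square to zero; on the
kernel of `DOn` only its constant term acts. -/
theorem expD_eq_self (r : ℂ) {l : List (Fin n)} {x : Forms n} (h : c.DOn l x = 0) :
    c.expD r l x = x := by
  have h1 := (prod_one_add_eq_sum (l.map fun j => r • c.D j) (fun a ha b hb => by
    obtain ⟨i, _, rfl⟩ := List.mem_map.mp ha
    obtain ⟨j, _, rfl⟩ := List.mem_map.mp hb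
    refine ((Commute.smul_right ?_ r).smul_left r)
    exact LinearMap.ext fun x => c.D_comm i j x) fun a ha => by
    obtain ⟨i, _, rfl⟩ := List.mem_map.mp ha
    ext x
    simp [D_D]).2
  have h2 : (l.map fun j => r • c.D j).sum x = 0 := by
    have : (l.map fun j => r • c.D j).sum = r • c.DOn l := by
      rw [DOn, List.smul_sum, List.map_map]; rfl
    rw [this, LinearMap.smul_apply, h, smul_zero]
  rw [List.map_map] at h1
  have h3 : c.expD r l = _ := h1
  rw [h3, Finset.sum_range_succ', LinearMap.add_apply, LinearMap.sum_apply,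
    Finset.sum_eq_zero fun i _ => ?_]
  · simp
  · rw [pow_succ, LinearMap.smul_apply, Module.End.mul_apply, h2, map_zero, smul_zero]

theorem expTh_eq_sum (l : List (Fin n)) : (c.expTh l : Forms n) =
    ∑ i ∈ Finset.range (l.length + 1), ((i.factorial : ℂ)⁻¹) • (c.omegaOn l : Forms n) ^ i := by
  have h1 := (prod_one_add_eq_sum (l.map fun j => (c.th j : Forms n)) (fun a ha b hb => by
    obtain ⟨i, _, rfl⟩ := List.mem_map.mp ha
    exact central_comm _ _) fun a ha => by
    obtain ⟨i, _, rfl⟩ := List.mem_map.mp ha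
    rw [← Subalgebra.coe_mul]
    have h : c.th i * c.th i = 0 := theta_mul_self _
    rw [h, Subalgebra.coe_zero]).2
  rw [List.map_map, List.length_map] at h1
  have h2 : (c.expTh l : Forms n) =
      (l.map ((fun a : Forms n => 1 + a) ∘ fun j => (c.th j : Forms n))).prod := by
    rw [expTh]
    have := map_list_prod (CentralForms n).val (l.map fun j => 1 + c.th j)
    rw [List.map_map] at this
    exact this
  have h3 : (c.omegaOn l : Forms n) = (l.map fun j => (c.th j : Forms n)).sum := by
    rw [omegaOn]
    have := map_list_sum (CentralForms n).val (l.map c.th)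
    rw [List.map_map] at this
    exact this
  rw [h2, h1, h3]

theorem prod_th_mem_formsOfDegree (s : Finset (Fin n)) :
    ((∏ i ∈ s, c.th i : CentralForms n) : Forms n) ∈ formsOfDegree n (2 * s.card) := by
  induction s using Finset.cons_induction with
  | empty => simp
  | cons a s ha ih =>
    rw [Finset.prod_cons, Finset.card_cons, Subalgebra.coe_mul, mul_add, add_comm]
    exact mul_mem_formsOfDegree (theta_mem_formsOfDegree _) ih

theorem pow_mem_formsOfDegree {z : Forms n} {d : ℕ} (hz : z ∈ formsOfDegree n d) (r : ℕ) :
    z ^ r ∈ formsOfDegree n (d * r) := by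
  induction r with
  | zero => simp
  | succ r ih =>
    rw [pow_succ, mul_add, mul_one]
    exact mul_mem_formsOfDegree ih hz

theorem adj_prod_th (s : Finset (Fin n)) :
    adj ((∏ i ∈ s, c.th i : CentralForms n) : Forms n) =
      (-1 : ℂ) ^ s.card • ((∏ i ∈ s, c.th i : CentralForms n) : Forms n) := by
  induction s using Finset.cons_induction with
  | empty => simpa using adj_algebraMap (n := n) 1
  | cons a s ha ih =>
    have h : adj (c.th a : Forms n) = -c.th a := adj_theta _
    rw [Finset.prod_cons, Finset.card_cons, Subalgebra.coe_mul, adj_mul, ih, h, pow_succ,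
      central_comm, smul_mul_assoc]
    simp

open scoped ComplexOrder

variable {t : Forms n →ₗ[ℂ] ℂ}

/-- The classical Hodge–Riemann bilinear relations. -/
theorem hodge_riemann (ht : IsIntegral t) (hvol : t c.vol = 1) {l : List (Fin n)} (hl : l.Nodup)
    {k r : ℕ} (hr : r + k = l.length) {x : Forms n} (hx : x ∈ formsOfDegree n k)
    (h : (c.complTh l * c.omega ^ (r + 1) : CentralForms n) * x = 0) :
    0 ≤ t ((c.complTh l * c.omega ^ r : CentralForms n) * (weil x * adj x)) ∧
      (t ((c.complTh l * c.omega ^ r : CentralForms n) * (weil x * adj x)) = 0 →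
        (c.complTh l : Forms n) * x = 0) := by
  obtain ⟨y, hy, hyk, hxy⟩ := exists_formsOn (c := c) l hx
  -- In the directions of l the powers of `omega` and `omegaOn` agree after multiplication by
  -- `complTh l`, so the representative y is primitive there.
  have hD : c.DOn l y = 0 := by
    rw [complTh_mul_omega_pow hl, mul_comm, Subalgebra.coe_mul, mul_assoc, ← hxy,
      central_mul_left_comm] at h
    have h1 := eq_zero_of_complTh_mul (omegaOn_pow_mul_mem_formsOn (r + 1) hy) h
    exact (lefschetzTriple hl).lower_eq_zero_of_pow ⟨hy, hyk⟩ hr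
      (by rw [mulLeft_pow_apply]; exact h1)
  have hweil : (c.complTh l : Forms n) * weil x = c.complTh l * weil y := by
    have h1 : weil (c.complTh l : Forms n) = c.complTh l :=
      mem_weilInvariants.mp (prod_mem fun i _ => c.th_mem_weilInvariants i)
    rw [← h1, ← map_mul, ← map_mul, hxy]
  have hadj : (c.complTh l : Forms n) * adj x = c.complTh l * adj y := by
    have h1 := congrArg adj hxy
    rw [adj_mul, adj_mul, complTh, adj_prod_th, mul_smul_comm, mul_smul_comm, ← central_comm,
      ← central_comm] at h1
    exact (smul_right_injective _ (pow_ne_zero _ (neg_ne_zero.mpr one_ne_zero)) h1).symm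
  have hy2 : ∀ z : Forms n, z * (weil x * adj x) * (c.complTh l : Forms n) =
      z * (weil y * adj y) * (c.complTh l : Forms n) := by
    intro z
    have h1 : (c.complTh l : Forms n) * (weil x * adj x) = c.complTh l * (weil y * adj y) := by
      rw [← mul_assoc, hweil, mul_assoc, central_mul_left_comm, hadj, ← central_mul_left_comm]
    rw [mul_assoc, mul_assoc z (weil y * adj y), ← central_comm _ (weil x * adj x),
      ← central_comm _ (weil y * adj y), h1]
  -- As D y = 0, the exponentials of D act trivially. Of the exponential of ω only the term ω^r / r!
  -- reaches the top degree.
  have hform : (r.factorial : ℂ)⁻¹ *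
      t ((c.complTh l * c.omega ^ r : CentralForms n) * (weil x * adj x)) =
      t ((c.complTh l * c.expTh l : CentralForms n) *
        (weil (c.expD (-1) l y) * adj (c.expD 1 l y))) := by
    rw [expD_eq_self _ hD, expD_eq_self _ hD, complTh_mul_omega_pow hl, Subalgebra.coe_mul,
      mul_assoc, central_comm, hy2, ← central_comm, Subalgebra.coe_mul, mul_assoc, expTh_eq_sum,
      Finset.sum_mul, Finset.mul_sum, map_sum, Finset.sum_eq_single r]
    · rw [smul_mul_assoc, mul_smul_comm, map_smul, smul_eq_mul, Subalgebra.coe_pow]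
    · intro i _ hir
      have hcard : (Finset.univ.filter (· ∉ l)).card + l.length = n := by
        have h1 := Finset.card_filter_add_card_filter_not (s := (Finset.univ : Finset (Fin n)))
          (fun i => i ∈ l)
        have h2 : Finset.univ.filter (· ∈ l) = l.toFinset := by ext; simp
        rw [h2, List.toFinset_card_of_nodup hl, Finset.card_univ, Fintype.card_fin] at h1
        omega
      rw [smul_mul_assoc, mul_smul_comm, map_smul]
      have hmem := mul_mem_formsOfDegree
        (prod_th_mem_formsOfDegree (c := c) (Finset.univ.filter (· ∉ l)))
        (mul_mem_formsOfDegree (pow_mem_formsOfDegree (omegaOn_mem_formsOfDegree (c := c) l) i)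
          (mul_mem_formsOfDegree (weil_mem_formsOfDegree hyk) (adj_mem_formsOfDegree hyk)))
      rw [complTh, c.eq_zero_of_mem ht (by omega) hmem, smul_zero]
    · intro hr'
      exact absurd (Finset.mem_range.mpr (by omega)) hr'
  obtain ⟨h1, h2⟩ := exp_form_pos ht hvol hl hy
  rw [← hform] at h1 h2
  have hfac : (r.factorial : ℂ) ≠ 0 := by exact_mod_cast r.factorial_ne_zero
  have hfac' : (0 : ℂ) ≤ r.factorial := by exact_mod_cast r.factorial.zero_le
  refine ⟨?_, fun h0 => ?_⟩
  · have h3 := mul_nonneg hfac' h1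
    rwa [mul_inv_cancel_left₀ hfac] at h3
  · rw [← hxy, h2 (by rw [h0, mul_zero]), mul_zero]

end Coframe

end

end LinearHRR

namespace LinearHRR

noncomputable section

open ExteriorAlgebra

variable {n : ℕ}

/-! ### Unitary changes of coframe -/

theorem theta_smul (r : ℂ) (ξ : Cotangent n) :
    theta (r • ξ) = ((Complex.normSq r : ℝ) : ℂ) • theta ξ := by
  apply Subtype.ext
  rw [Subalgebra.coe_smul, coe_theta, coe_theta, conjCotangent_smul, map_smul, map_smul,
    smul_mul_smul_comm, Complex.mul_conj, smul_comm]

/-- Hermitian vectors, the coefficient space of a coframe. -/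
abbrev Coeffs (n : ℕ) : Type := EuclideanSpace ℂ (Fin n)

namespace Coframe

variable (c : Coframe n)

/-- The functional with given coefficients in a coframe. -/
def lin : Coeffs n →ₗ[ℂ] Cotangent n where
  toFun w := ∑ j, w j • c.e j
  map_add' w w' := by simp [add_smul, Finset.sum_add_distrib]
  map_smul' r w := by simp [Finset.smul_sum, smul_smul]

theorem lin_apply (w : Coeffs n) : c.lin w = ∑ j, w j • c.e j := rfl

theorem conjCotangent_sum {ι : Type*} (s : Finset ι) (g : ι → Cotangent n) :
    conjCotangent (∑ i ∈ s, g i) = ∑ i ∈ s, conjCotangent (g i) :=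
  map_sum (⟨⟨conjCotangent, conjCotangent_zero⟩, conjCotangent_add⟩ : Cotangent n →+ Cotangent n)
    g s

theorem conj_lin (w : Coeffs n) :
    conjCotangent (c.lin w) = ∑ j, starRingEnd ℂ (w j) • conjCotangent (c.e j) := by
  rw [lin_apply, conjCotangent_sum]
  simp_rw [conjCotangent_smul]

theorem rotate_lin (w : Coeffs n) : rotate n (c.lin w) = Complex.I • c.lin w := by
  rw [lin_apply, map_sum, Finset.smul_sum]
  simp_rw [map_smul, c.rotate_e, smul_comm Complex.I]

/-- The covector extending a functional on coefficients by zero on conjugate-linear functionals. -/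
def covector (g : Coeffs n →ₗ[ℂ] ℂ) : Covector n :=
  ∑ j, g (EuclideanSpace.single j 1) • c.d j

/-- The covector extending a conjugated functional on coefficients by zero on linear functionals. -/
def covectorBar (g : Coeffs n →ₗ[ℂ] ℂ) : Covector n :=
  ∑ j, starRingEnd ℂ (g (EuclideanSpace.single j 1)) • c.db j

theorem sum_smul_single (w : Coeffs n) : ∑ j, w j • EuclideanSpace.single j (1 : ℂ) = w := by
  ext i
  simp [Pi.single_apply]

theorem apply_eq_sum (g : Coeffs n →ₗ[ℂ] ℂ) (w : Coeffs n) :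
    g w = ∑ j, w j * g (EuclideanSpace.single j 1) := by
  conv_lhs => rw [← sum_smul_single w]
  simp

theorem covector_lin (g : Coeffs n →ₗ[ℂ] ℂ) (w : Coeffs n) : c.covector g (c.lin w) = g w := by
  rw [apply_eq_sum g w]
  simp [covector, lin_apply, d_e, mul_comm]

theorem covector_conj_lin (g : Coeffs n →ₗ[ℂ] ℂ) (w : Coeffs n) :
    c.covector g (conjCotangent (c.lin w)) = 0 := by
  simp [covector, conj_lin, d_conj]

theorem covectorBar_lin (g : Coeffs n →ₗ[ℂ] ℂ) (w : Coeffs n) :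
    c.covectorBar g (c.lin w) = 0 := by
  simp [covectorBar, lin_apply, db_e]

theorem covectorBar_conj_lin (g : Coeffs n →ₗ[ℂ] ℂ) (w : Coeffs n) :
    c.covectorBar g (conjCotangent (c.lin w)) = starRingEnd ℂ (g w) := by
  rw [apply_eq_sum g w]
  simp [covectorBar, conj_lin, db_conj, mul_comm]

/-- The coframe obtained by a linear change of basis. -/
def ofBasis (b : Module.Basis (Fin n) ℂ (Coeffs n)) : Coframe n where
  e i := c.lin (b i)
  d i := c.covector (b.coord i)
  db i := c.covectorBar (b.coord i)
  d_e i j := by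
    rw [covector_lin, b.coord_apply, b.repr_self, Finsupp.single_apply]
    simp only [eq_comm]
  d_conj i j := c.covector_conj_lin _ _
  db_e i j := c.covectorBar_lin _ _
  db_conj i j := by
    rw [covectorBar_conj_lin, b.coord_apply, b.repr_self, Finsupp.single_apply]
    simp only [eq_comm]
    split_ifs <;> simp
  complete ξ := by
    set v : Coeffs n := WithLp.toLp 2 fun j => c.d j ξ with hv
    set v' : Coeffs n := WithLp.toLp 2 fun j => starRingEnd ℂ (c.db j ξ) with hv'
    have h1 (g : Coeffs n →ₗ[ℂ] ℂ) : c.covector g ξ = g v := by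
      rw [apply_eq_sum g v]
      simp [covector, hv, mul_comm]
    have h2 (g : Coeffs n →ₗ[ℂ] ℂ) : c.covectorBar g ξ = starRingEnd ℂ (g v') := by
      rw [apply_eq_sum g v']
      simp [covectorBar, hv', mul_comm]
    simp_rw [h1, h2]
    rw [Finset.sum_add_distrib]
    have h3 : ∑ i, b.coord i v • c.lin (b i) = c.lin v := by
      conv_rhs => rw [← b.sum_repr v, map_sum]
      simp
    have h4 : ∑ i, starRingEnd ℂ (b.coord i v') • conjCotangent (c.lin (b i)) =
        conjCotangent (c.lin v') := by
      conv_rhs => rw [← b.sum_repr v', map_sum, conjCotangent_sum]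
      simp [conjCotangent_smul]
    rw [h3, h4, lin_apply, conj_lin, ← Finset.sum_add_distrib]
    conv_rhs => rw [← c.complete ξ]
    simp [hv, hv']
  rotate_e i := c.rotate_lin _

open scoped InnerProductSpace

/-- The coframe obtained by a unitary change of basis. -/
def change (b : OrthonormalBasis (Fin n) ℂ (Coeffs n)) : Coframe n := c.ofBasis b.toBasis

variable {c}

/-- On the span of the ē_j the rotation is multiplication by -i, so the ē_j components of an
eigenvector for i vanish. -/
theorem exists_lin_eq {ξ : Cotangent n} (h : rotate n ξ = Complex.I • ξ) : ∃ w, ξ = c.lin w := by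
  refine ⟨WithLp.toLp 2 fun j => c.d j ξ, ?_⟩
  have h1 (j : Fin n) : c.db j ξ = 0 := by
    have h2 := congrArg (c.db j) h
    have h3 : c.db j (rotate n ξ) = (c.db j ∘ₗ rotate n) ξ := rfl
    rw [h3, db_comp_rotate, LinearMap.smul_apply, map_smul, smul_eq_mul, smul_eq_mul] at h2
    have h4 : (2 * Complex.I) * c.db j ξ = 0 := by linear_combination -h2
    exact (mul_eq_zero.mp h4).resolve_left (by simp)
  conv_lhs => rw [← c.complete ξ]
  simp [h1, lin_apply]

variable (c)

/-- The semipositive form of a vector of coefficients. -/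
def sq (w : Coeffs n) : CentralForms n := theta (c.lin w)

theorem change_th (b : OrthonormalBasis (Fin n) ℂ (Coeffs n)) (i : Fin n) :
    (c.change b).th i = c.sq (b i) :=
  congrArg (fun v => theta (c.lin v)) (congrFun b.coe_toBasis i)

theorem sum_sq_eq (b b' : OrthonormalBasis (Fin n) ℂ (Coeffs n)) :
    ∑ i, c.sq (b i) = ∑ i, c.sq (b' i) := by
  have h1 (j : Fin n) : ι ℂ (c.lin (b' j)) = ∑ i, ⟪b i, b' j⟫_ℂ • ι ℂ (c.lin (b i)) := by
    conv_lhs => rw [← b.sum_repr' (b' j)]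
    simp
  have h2 (i : Fin n) : ι ℂ (conjCotangent (c.lin (b i))) =
      ∑ j, ⟪b i, b' j⟫_ℂ • ι ℂ (conjCotangent (c.lin (b' j))) := by
    conv_lhs => rw [← b'.sum_repr' (b i), map_sum, conjCotangent_sum, map_sum]
    simp [conjCotangent_smul]
  have h3 (b : OrthonormalBasis (Fin n) ℂ (Coeffs n)) :
      ((∑ i, c.sq (b i) : CentralForms n) : Forms n) =
      Complex.I • ∑ i, ι ℂ (c.lin (b i)) * ι ℂ (conjCotangent (c.lin (b i))) := by
    rw [Finset.smul_sum]
    exact map_sum (CentralForms n).val _ _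
  apply Subtype.ext
  rw [h3, h3]
  congr 1
  simp_rw [h1]
  conv_lhs => enter [2, i]; rw [h2]
  simp_rw [Finset.sum_mul, Finset.mul_sum, smul_mul_assoc, mul_smul_comm]
  exact Finset.sum_comm

theorem change_omega (b : OrthonormalBasis (Fin n) ℂ (Coeffs n)) :
    (c.change b).omega = c.omega := by
  have h (j : Fin n) : c.th j = c.sq (EuclideanSpace.basisFun (Fin n) ℂ j) := by
    rw [th, sq]
    congr 1
    simp [lin_apply]
  rw [omega, omega]
  simp_rw [change_th, h]
  exact c.sum_sq_eq _ _

/-- It transfers the invariance of ω under unitary changes of coframe to the volume form. -/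
theorem omega_pow : (c.omega : Forms n) ^ n = (n.factorial : ℂ) • (c.vol : Forms n) := by
  have h := sum_pow_length ((List.finRange n).map fun j => (c.th j : Forms n)) (fun a ha b hb => by
    obtain ⟨i, _, rfl⟩ := List.mem_map.mp ha
    exact central_comm _ _) fun a ha => by
    obtain ⟨i, _, rfl⟩ := List.mem_map.mp ha
    have h : c.th i * c.th i = 0 := theta_mul_self _
    rw [← Subalgebra.coe_mul, h, Subalgebra.coe_zero]
  rw [List.length_map, List.length_finRange] at h
  have h1 : (c.omega : Forms n) = ((List.finRange n).map fun j => (c.th j : Forms n)).sum := by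
    rw [← Fin.sum_univ_def, omega]
    exact map_sum (CentralForms n).val _ _
  have h2 : (c.vol : Forms n) = ((List.finRange n).map fun j => (c.th j : Forms n)).prod := by
    rw [vol_eq_list]
    have := map_list_prod (CentralForms n).val ((List.finRange n).map c.th)
    rw [List.map_map] at this
    exact this
  rw [h1, h2, h]

theorem change_vol (b : OrthonormalBasis (Fin n) ℂ (Coeffs n)) :
    ((c.change b).vol : Forms n) = c.vol := by
  have h := (c.change b).omega_pow
  rw [change_omega, omega_pow] at h
  exact (smul_right_injective _ (by exact_mod_cast n.factorial_ne_zero) h).symm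

/-- The product of the semipositive forms of some vectors of an orthonormal basis. -/
def flag (b : OrthonormalBasis (Fin n) ℂ (Coeffs n)) (I : Finset (Fin n)) : CentralForms n :=
  ∏ i ∈ I, c.sq (b i)

theorem sq_smul (r : ℂ) (w : Coeffs n) :
    c.sq (r • w) = ((Complex.normSq r : ℝ) : ℂ) • c.sq w := by
  rw [sq, map_smul, theta_smul, sq]

theorem sq_zero : c.sq 0 = 0 := by
  have := c.sq_smul 0 0
  simpa using this

theorem flag_mul_ι (b : OrthonormalBasis (Fin n) ℂ (Coeffs n)) {I : Finset (Fin n)} {w : Coeffs n}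
    (hw : w ∈ Submodule.span ℂ (b '' I)) : (c.flag b I : Forms n) * ι ℂ (c.lin w) = 0 ∧
      (c.flag b I : Forms n) * ι ℂ (conjCotangent (c.lin w)) = 0 := by
  induction hw using Submodule.span_induction with
  | mem w hw =>
    obtain ⟨i, hi, rfl⟩ := hw
    rw [flag, ← Finset.prod_erase_mul _ _ (Finset.mem_coe.mp hi), Subalgebra.coe_mul, mul_assoc,
      mul_assoc, central_comm (c.sq (b i)), central_comm (c.sq (b i))]
    have h1 := ι_mul_theta_mul (c.lin (b i)) 1
    have h2 := ι_conj_mul_theta_mul (c.lin (b i)) 1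
    rw [mul_one] at h1 h2
    rw [sq, h1, h2, mul_zero]
    exact ⟨rfl, rfl⟩
  | zero => simp [conjCotangent_zero]
  | add x y _ _ hx hy =>
    rw [map_add, conjCotangent_add, map_add, map_add, mul_add, mul_add, hx.1, hx.2, hy.1, hy.2]
    simp
  | smul r x _ hx =>
    rw [map_smul, conjCotangent_smul, map_smul, map_smul, mul_smul_comm, mul_smul_comm, hx.1, hx.2]
    simp

/-- On the subspace cut out by the flag, vectors of its span restrict to zero. This permits
Gram–Schmidt inside products of squares. -/
theorem flag_mul_sq_add (b : OrthonormalBasis (Fin n) ℂ (Coeffs n)) {I : Finset (Fin n)}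
    {v : Coeffs n} (hv : v ∈ Submodule.span ℂ (b '' I)) (w : Coeffs n) :
    c.flag b I * c.sq (w + v) = c.flag b I * c.sq w := by
  apply Subtype.ext
  obtain ⟨h1, h2⟩ := c.flag_mul_ι b hv
  rw [Subalgebra.coe_mul, Subalgebra.coe_mul, sq, sq, coe_theta, coe_theta, mul_smul_comm,
    mul_smul_comm, map_add, conjCotangent_add, map_add, map_add, ← mul_assoc,
    mul_add (c.flag b I : Forms n), h1, add_zero, mul_add,
    mul_assoc _ _ (ι ℂ (conjCotangent (c.lin v))),
    central_mul_left_comm, h2, mul_zero, add_zero, mul_assoc]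

theorem flag_mul_sq (b : OrthonormalBasis (Fin n) ℂ (Coeffs n)) (I : Finset (Fin n))
    {U : Submodule ℂ (Coeffs n)} (hU : ∀ i ∈ I, b i ∈ U) {w : Coeffs n} (hw : w ∈ U) :
    c.flag b I * c.sq w = 0 ∨ ∃ (r : ℝ) (b' : OrthonormalBasis (Fin n) ℂ (Coeffs n))
      (I' : Finset (Fin n)), 0 < r ∧ I'.card = I.card + 1 ∧ (∀ i ∈ I', b' i ∈ U) ∧
        c.flag b I * c.sq w = (r : ℂ) • c.flag b' I' := by
  -- Gram–Schmidt: v is the orthogonal projection of w to the span of the flag and can be dropped.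
  -- The remainder w' is zero or, once normalised, the next vector of the flag, with factor ‖w'‖².
  set v := ∑ i ∈ I, ⟪b i, w⟫_ℂ • b i with hv
  set w' := w - v with hw'
  have hvI : v ∈ Submodule.span ℂ (b '' I) :=
    sum_mem fun i hi => Submodule.smul_mem _ _ (Submodule.subset_span ⟨i, hi, rfl⟩)
  have hvU : v ∈ U := sum_mem fun i hi => Submodule.smul_mem _ _ (hU i hi)
  have hww : w = w' + v := by rw [hw']; abel
  have hw'U : w' ∈ U := sub_mem hw hvU
  rw [hww, flag_mul_sq_add c b hvI]
  by_cases h0 : w' = 0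
  · left
    rw [h0, sq_zero, mul_zero]
  right
  have horth (i : Fin n) (hi : i ∈ I) : ⟪b i, w'⟫_ℂ = 0 := by
    rw [hw', inner_sub_right, hv, inner_sum]
    simp [inner_smul_right, b.inner_eq_ite, hi]
  -- If I were everything, w' would be orthogonal to a basis. The free index j houses the new unit
  -- vector.
  obtain ⟨j, hj⟩ : ∃ j, j ∉ I := by
    by_contra! hI
    apply h0
    rw [← b.sum_repr' w']
    exact Finset.sum_eq_zero fun i _ => by rw [horth i (hI i), zero_smul]
  have hnorm : (‖w'‖ : ℂ) ≠ 0 := by simpa using h0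
  set u : Coeffs n := ((‖w'‖ : ℂ)⁻¹) • w' with hu
  have huw : w' = (‖w'‖ : ℂ) • u := by rw [hu, smul_smul, mul_inv_cancel₀ hnorm, one_smul]
  have hu1 : ‖u‖ = 1 := by
    rw [hu, norm_smul, norm_inv, Complex.norm_real, norm_norm, inv_mul_cancel₀]
    simpa using h0
  let g : Fin n → Coeffs n := Function.update b j u
  have hgi (i : Fin n) (hi : i ∈ I) : g i = b i :=
    Function.update_of_ne (by rintro rfl; exact hj hi) _ _
  have hgj : g j = u := Function.update_self _ _ _
  have hg : Orthonormal ℂ ((↑(insert j I) : Set (Fin n)).domRestrict g) := by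
    rw [orthonormal_iff_ite]
    rintro ⟨i, hi⟩ ⟨i', hi'⟩
    have huI (i : Fin n) (hi : i ∈ I) : ⟪b i, u⟫_ℂ = 0 := by
      rw [hu, inner_smul_right, horth i hi, mul_zero]
    have huI' (i : Fin n) (hi : i ∈ I) : ⟪u, b i⟫_ℂ = 0 := by
      rw [← inner_conj_symm, huI i hi, map_zero]
    have hne (i : Fin n) (hi : i ∈ I) : i ≠ j := fun h => hj (h ▸ hi)
    simp only [Set.domRestrict_apply, Subtype.mk.injEq]
    rcases Finset.mem_insert.mp (Finset.mem_coe.mp hi) with h | h <;>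
      rcases Finset.mem_insert.mp (Finset.mem_coe.mp hi') with h' | h'
    · rw [h, h', hgj, inner_self_eq_norm_sq_to_K, hu1]
      simp
    · rw [h, hgj, hgi i' h', huI' i' h', if_neg (hne i' h').symm]
    · rw [h', hgj, hgi i h, huI i h, if_neg (hne i h)]
    · rw [hgi i h, hgi i' h', b.inner_eq_ite]
  obtain ⟨b', hb'⟩ := Orthonormal.exists_orthonormalBasis_extension_of_card_eq
    (by simp) hg
  refine ⟨‖w'‖ ^ 2, b', insert j I, by positivity, Finset.card_insert_of_notMem hj, ?_, ?_⟩
  · intro i hi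
    rw [hb' i (Finset.mem_coe.mpr hi)]
    rcases Finset.mem_insert.mp hi with rfl | hi
    · rw [hgj]; exact Submodule.smul_mem _ _ hw'U
    · rw [hgi i hi]; exact hU i hi
  · have h1 : c.flag b' (insert j I) = c.flag b I * c.sq u := by
      rw [flag, Finset.prod_insert hj, mul_comm, flag, hb' j (by simp), hgj]
      congr 1
      refine Finset.prod_congr rfl fun i hi => ?_
      rw [hb' i (by simp [hi]), hgi i hi]
    rw [h1, huw, sq_smul, Complex.normSq_ofReal, mul_smul_comm, ← huw]
    simp [pow_two]

theorem prod_sq {U : Submodule ℂ (Coeffs n)} (l : List (Coeffs n)) (hl : ∀ w ∈ l, w ∈ U) :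
    (l.map c.sq).prod = 0 ∨ ∃ (r : ℝ) (b : OrthonormalBasis (Fin n) ℂ (Coeffs n))
      (I : Finset (Fin n)), 0 < r ∧ I.card = l.length ∧ (∀ i ∈ I, b i ∈ U) ∧
        (l.map c.sq).prod = (r : ℂ) • c.flag b I := by
  induction l with
  | nil =>
    right
    exact ⟨1, EuclideanSpace.basisFun (Fin n) ℂ, ∅, by simp [flag]⟩
  | cons w l ih =>
    rw [List.map_cons, List.prod_cons, mul_comm]
    rcases ih fun w hw => hl w (List.mem_cons_of_mem _ hw) with h | ⟨r, b, I, hr, hI, hU, h⟩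
    · left
      rw [h, zero_mul]
    · rw [h, smul_mul_assoc]
      rcases c.flag_mul_sq b I hU (hl w List.mem_cons_self) with
        h' | ⟨r', b', I', hr', hI', hU', h'⟩
      · left
        rw [h', smul_zero]
      · right
        refine ⟨r * r', b', I', mul_pos hr hr', by rw [hI', hI, List.length_cons], hU', ?_⟩
        rw [h', smul_smul]
        push_cast
        rfl

/-- Otherwise the product would be a multiple of a flag with more orthonormal vectors in U than U
has dimensions. -/
theorem prod_sq_eq_zero {U : Submodule ℂ (Coeffs n)} (l : List (Coeffs n)) (hl : ∀ w ∈ l, w ∈ U)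
    (h : Module.finrank ℂ U < l.length) : (l.map c.sq).prod = 0 := by
  rcases c.prod_sq l hl with h' | ⟨r, b, I, _, hI, hU, _⟩
  · exact h'
  · exfalso
    let g : I → U := fun i => ⟨b i, hU i i.2⟩
    have hg : LinearIndependent ℂ g := by
      apply LinearIndependent.of_comp U.subtype
      exact b.toBasis.linearIndependent.comp (fun i : I => (i : Fin n)) Subtype.val_injective
    have := hg.fintype_card_le_finrank
    rw [Fintype.card_coe] at this
    omega

end Coframe

end

end LinearHRR

namespace LinearHRR

noncomputable section

/-! ### Deformation of Hermitian forms -/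

section Deformation

open Matrix

variable {T ι κ : Type*} [TopologicalSpace T] [Fintype ι] [Fintype κ]

theorem eq_zero_of_forall_nonneg {r s : ℝ} (hs : 0 ≤ s) (h : ∀ u : ℝ, 0 ≤ 2 * u * r + u ^ 2 * s) :
    r = 0 := by
  by_contra hr
  -- Nearly the minimum -r/s of the quadratic; the summand 1 avoids division by zero for s = 0 and
  -- still gives a negative value.
  have h1 := h (-r / (s + 1))
  have h2 : 2 * (-r / (s + 1)) * r + (-r / (s + 1)) ^ 2 * s =
      -(r ^ 2 * (s + 2)) / (s + 1) ^ 2 := by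
    field_simp
    ring
  rw [h2] at h1
  have h3 : 0 < r ^ 2 * (s + 2) / (s + 1) ^ 2 := by positivity
  rw [neg_div] at h1
  linarith

theorem star_dotProduct_mulVec_comm {H : Matrix ι ι ℂ} (hH : H.IsHermitian) (x y : ι → ℂ) :
    star x ⬝ᵥ H *ᵥ y = starRingEnd ℂ (star y ⬝ᵥ H *ᵥ x) := by
  have h : star (star y ⬝ᵥ H *ᵥ x) = star x ⬝ᵥ H *ᵥ y := by
    rw [Matrix.star_dotProduct, star_star, Matrix.star_mulVec, hH.eq, ← Matrix.dotProduct_mulVec]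
  exact h.symm

open scoped ComplexOrder in
/-- A continuous family of nondegenerate Hermitian forms `H t` and subspaces `range (B t)` on
which the forms are nondegenerate: if `H t` is positive definite on the orthogonal complement
of `range (B t)` for one parameter `t`, then for all. -/
theorem pos_of_deformation [DecidableEq ι] [DecidableEq κ] [PreconnectedSpace T]
    {H : T → Matrix ι ι ℂ} {B : T → Matrix ι κ ℂ}
    (hH : Continuous H) (hB : Continuous B) (herm : ∀ t, (H t).IsHermitian)
    (hdet : ∀ t, (H t).det ≠ 0) (hdet' : ∀ t, ((B t)ᴴ * H t * B t).det ≠ 0) {t₁ : T}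
    (h₁ : ∀ x, x ≠ 0 → (B t₁)ᴴ *ᵥ (H t₁ *ᵥ x) = 0 → 0 < (star x ⬝ᵥ H t₁ *ᵥ x).re) (t : T)
    {x : ι → ℂ} (hx : x ≠ 0) (hxB : (B t)ᴴ *ᵥ (H t *ᵥ x) = 0) :
    0 < (star x ⬝ᵥ H t *ᵥ x).re := by
  set S : Set T := {t | ∀ x, x ≠ 0 → (B t)ᴴ *ᵥ (H t *ᵥ x) = 0 → 0 < (star x ⬝ᵥ H t *ᵥ x).re} with hS
  -- The complement is the projection of a closed set of pairs (t, unit vector) along the compact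
  -- unit sphere.
  have hopen : IsOpen S := by
    rw [← isClosed_compl_iff]
    let K := Metric.sphere (0 : ι → ℂ) 1
    have : CompactSpace K := isCompact_iff_compactSpace.mp (isCompact_sphere _ _)
    have hC : IsClosed {p : T × K | (B p.1)ᴴ *ᵥ (H p.1 *ᵥ (p.2 : ι → ℂ)) = 0 ∧
        (star (p.2 : ι → ℂ) ⬝ᵥ H p.1 *ᵥ (p.2 : ι → ℂ)).re ≤ 0} := by
      rw [Set.ofPred_and]
      refine (isClosed_eq ?_ continuous_const).inter (isClosed_le ?_ continuous_const)
      · fun_prop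
      · fun_prop
    have := isClosedMap_fst_of_compactSpace _ hC
    convert this using 1
    ext t
    simp only [hS, Set.mem_compl_iff, Set.mem_ofPred_eq, Set.mem_image, Prod.exists, not_forall,
      not_lt]
    constructor
    · rintro ⟨x, hx, hxB, hneg⟩
      have hn : ‖x‖ ≠ 0 := by simpa using hx
      refine ⟨t, ⟨((‖x‖⁻¹ : ℝ) : ℂ) • x, ?_⟩, ⟨?_, ?_⟩, rfl⟩
      · rw [mem_sphere_zero_iff_norm, norm_smul, Complex.norm_real, norm_inv, norm_norm,
          inv_mul_cancel₀ hn]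
      · rw [mulVec_smul, mulVec_smul, hxB, smul_zero]
      · rw [mulVec_smul, dotProduct_smul, star_smul, smul_dotProduct, Complex.star_def,
          Complex.conj_ofReal, smul_eq_mul, smul_eq_mul, Complex.re_ofReal_mul,
          Complex.re_ofReal_mul]
        have : 0 ≤ ‖x‖⁻¹ := by positivity
        nlinarith [mul_nonneg this this]
    · rintro ⟨t', x, ⟨hxB, hneg⟩, rfl⟩
      refine ⟨x, ?_, hxB, hneg⟩
      intro h0
      have := mem_sphere_zero_iff_norm.mp x.2
      rw [h0, norm_zero] at this
      exact zero_ne_one this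
  -- The projection along range (B t) to its H-orthogonal complement. It varies continuously with t
  -- because the Gram matrix of B is invertible, and so it extends a vector at one parameter to
  -- nearby ones.
  let P : T → (ι → ℂ) → (ι → ℂ) := fun t y =>
    y - B t *ᵥ (((B t)ᴴ * H t * B t)⁻¹ *ᵥ ((B t)ᴴ *ᵥ (H t *ᵥ y)))
  have hPmem (t : T) (y : ι → ℂ) : (B t)ᴴ *ᵥ (H t *ᵥ P t y) = 0 := by
    have : (B t)ᴴ *ᵥ (H t *ᵥ (B t *ᵥ (((B t)ᴴ * H t * B t)⁻¹ *ᵥ ((B t)ᴴ *ᵥ (H t *ᵥ y))))) =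
        (((B t)ᴴ * H t * B t) * ((B t)ᴴ * H t * B t)⁻¹) *ᵥ ((B t)ᴴ *ᵥ (H t *ᵥ y)) := by
      simp only [mulVec_mulVec, Matrix.mul_assoc]
    rw [mulVec_sub, mulVec_sub, this, Matrix.mul_nonsing_inv _ (isUnit_iff_ne_zero.mpr (hdet' t)),
      one_mulVec, sub_self]
  have hPcont (y : ι → ℂ) : Continuous fun t => P t y := by
    have hinv : Continuous fun t => ((B t)ᴴ * H t * B t)⁻¹ := by
      refine continuous_iff_continuousAt.mpr fun t => ?_
      have h1 : ContinuousAt (fun t => (B t)ᴴ * H t * B t) t := by fun_prop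
      refine ContinuousAt.comp (g := fun M : Matrix κ κ ℂ => M⁻¹) ?_ h1
      apply continuousAt_matrix_inv
      rw [Ring.inverse_eq_inv']
      exact continuousAt_inv₀ (hdet' t)
    fun_prop
  -- In the limit the form is semidefinite on the complement. A null vector x there is orthogonal to
  -- the whole complement (`hre`, `hzero`) and by `hxB` to range (B t), hence to everything
  -- (`hall`). Then H x = 0, which `hdet` excludes.
  have hclosed : IsClosed S := by
    rw [← closure_subset_iff_isClosed]
    intro t ht x hx hxB
    have hnonneg (y : ι → ℂ) (hy : (B t)ᴴ *ᵥ (H t *ᵥ y) = 0) : 0 ≤ (star y ⬝ᵥ H t *ᵥ y).re := by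
      have hC : IsClosed {t | 0 ≤ (star (P t y) ⬝ᵥ H t *ᵥ (P t y)).re} := by
        refine isClosed_le continuous_const ?_
        have := hPcont y
        fun_prop
      have hsub : S ⊆ {t | 0 ≤ (star (P t y) ⬝ᵥ H t *ᵥ (P t y)).re} := by
        intro t ht
        by_cases h0 : P t y = 0
        · simp [h0]
        · exact (ht _ h0 (hPmem t y)).le
      have hyP : P t y = y := by
        show y - _ = y
        rw [hy, mulVec_zero, mulVec_zero, sub_zero]
      have := closure_minimal hsub hC ht
      rwa [Set.mem_ofPred_eq, hyP] at this
    refine lt_of_le_of_ne (hnonneg x hxB) fun h0 => hx ?_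
    have hre (y : ι → ℂ) (hy : (B t)ᴴ *ᵥ (H t *ᵥ y) = 0) : (star y ⬝ᵥ H t *ᵥ x).re = 0 := by
      refine eq_zero_of_forall_nonneg (hnonneg y hy) fun u => ?_
      have h1 := hnonneg (x + (u : ℂ) • y) (by
        rw [mulVec_add, mulVec_smul, mulVec_add, mulVec_smul, hxB, hy, smul_zero, add_zero])
      have h2 : (star x ⬝ᵥ H t *ᵥ y).re = (star y ⬝ᵥ H t *ᵥ x).re := by
        rw [star_dotProduct_mulVec_comm (herm t), Complex.conj_re]
      rw [mulVec_add, mulVec_smul, star_add, star_smul, add_dotProduct, dotProduct_add,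
        dotProduct_add, smul_dotProduct, smul_dotProduct, dotProduct_smul, dotProduct_smul,
        Complex.star_def, Complex.conj_ofReal] at h1
      simp only [smul_eq_mul, Complex.add_re, Complex.re_ofReal_mul] at h1
      rw [← h0, h2] at h1
      linarith
    have hzero (y : ι → ℂ) (hy : (B t)ᴴ *ᵥ (H t *ᵥ y) = 0) : star y ⬝ᵥ H t *ᵥ x = 0 := by
      refine Complex.ext (hre y hy) ?_
      have h1 := hre (Complex.I • y) (by rw [mulVec_smul, mulVec_smul, hy, smul_zero])
      rw [star_smul, smul_dotProduct, Complex.star_def, Complex.conj_I, smul_eq_mul] at h1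
      simpa using h1
    have hall (y : ι → ℂ) : star y ⬝ᵥ H t *ᵥ x = 0 := by
      have h1 := hzero _ (hPmem t y)
      rw [star_sub, sub_dotProduct, Matrix.star_mulVec, ← Matrix.dotProduct_mulVec, hxB,
        dotProduct_zero, sub_zero] at h1
      exact h1
    have hHx : H t *ᵥ x = 0 := dotProduct_star_self_eq_zero.mp (hall (H t *ᵥ x))
    exact eq_zero_of_mulVec_eq_zero (hdet t) hHx
  have huniv : S = Set.univ := by
    rcases isClopen_iff.mp ⟨hclosed, hopen⟩ with h | h
    · exact absurd (show t₁ ∈ S from h₁) (by rw [h]; simp)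
    · exact h
  have : t ∈ S := by rw [huniv]; trivial
  exact this x hx hxB

end Deformation

end

end LinearHRR

namespace LinearHRR

noncomputable section

open ExteriorAlgebra

variable {n : ℕ}

namespace Coframe

variable (c : Coframe n)

/-! ### Independent directions -/

theorem contract_covector_sq_mul (g : Coeffs n →ₗ[ℂ] ℂ) (w : Coeffs n) (x : Forms n) :
    contract (c.covector g) (c.sq w * x) =
      Complex.I • (g w • (ι ℂ (conjCotangent (c.lin w)) * x)) +
        c.sq w * contract (c.covector g) x := by
  rw [sq, contract_theta_mul, covector_lin, covector_conj_lin, zero_smul, sub_zero]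

theorem contract_covectorBar_sq_mul (g : Coeffs n →ₗ[ℂ] ℂ) (w : Coeffs n) (x : Forms n) :
    contract (c.covectorBar g) (c.sq w * x) =
      -(Complex.I • (starRingEnd ℂ (g w) • (ι ℂ (c.lin w) * x))) +
        c.sq w * contract (c.covectorBar g) x := by
  rw [sq, contract_theta_mul, covectorBar_lin, covectorBar_conj_lin, zero_smul, zero_sub, smul_neg]

theorem sq_mem_contractInvariants {g : Coeffs n →ₗ[ℂ] ℂ} {w : Coeffs n} (h : g w = 0) :
    c.sq w ∈ contractInvariants (c.covector g) ⊓ contractInvariants (c.covectorBar g) := by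
  refine ⟨fun x => ?_, fun x => ?_⟩
  · rw [contract_covector_sq_mul, h, zero_smul, smul_zero, zero_add]
  · rw [contract_covectorBar_sq_mul, h, map_zero, zero_smul, smul_zero, neg_zero, zero_add]

theorem flag_mem_contractInvariants (b : OrthonormalBasis (Fin n) ℂ (Coeffs n))
    {I : Finset (Fin n)} {g : Coeffs n →ₗ[ℂ] ℂ} (h : ∀ i ∈ I, g (b i) = 0) :
    c.flag b I ∈ contractInvariants (c.covector g) ⊓ contractInvariants (c.covectorBar g) :=
  Subalgebra.prod_mem _ fun i hi => c.sq_mem_contractInvariants (h i hi)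

theorem eq_zero_of_sq_mul_eq_zero {g : Coeffs n →ₗ[ℂ] ℂ} {w : Coeffs n} (hg : g w = 1) {x : Forms n}
    (h : (c.sq w : Forms n) * x = 0) (h1 : contract (c.covector g) x = 0)
    (h2 : contract (c.covectorBar g) x = 0) : x = 0 := by
  have h3 := congrArg (contract (c.covector g)) h
  rw [contract_covector_sq_mul, h1, mul_zero, add_zero, hg, one_smul, map_zero,
    smul_eq_zero_iff_right Complex.I_ne_zero] at h3
  have h4 := congrArg (contract (c.covectorBar g)) h3
  rwa [contract_ι_mul, h2, mul_zero, sub_zero, covectorBar_conj_lin, hg, map_one, one_smul,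
    map_zero] at h4

theorem exists_dual_eq_one {S : Submodule ℂ (Coeffs n)} {k : ℕ} {v : Fin (k + 1) → Coeffs n}
    (hv : LinearIndependent ℂ (S.mkQ ∘ v)) : ∃ g : Coeffs n →ₗ[ℂ] ℂ, (∀ w ∈ S, g w = 0) ∧
      g (v 0) = 1 ∧ ∀ i : Fin k, g (v i.succ) = 0 := by
  obtain ⟨f, hf⟩ := LinearMap.exists_leftInverse_of_injective
    (Finsupp.linearCombination ℂ (S.mkQ ∘ v)) (LinearMap.ker_eq_bot.mpr hv)
  have hfv (i : Fin (k + 1)) : f (S.mkQ (v i)) = Finsupp.single i 1 := by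
    have := LinearMap.congr_fun hf (Finsupp.single i 1)
    simpa using this
  refine ⟨Finsupp.lapply 0 ∘ₗ f ∘ₗ S.mkQ, fun w hw => ?_, ?_, fun i => ?_⟩
  · have h0 : S.mkQ w = 0 := (Submodule.Quotient.mk_eq_zero S).mpr hw
    rw [LinearMap.comp_apply, LinearMap.comp_apply, h0, map_zero, map_zero]
  · rw [LinearMap.comp_apply, LinearMap.comp_apply, hfv]
    simp
  · rw [LinearMap.comp_apply, LinearMap.comp_apply, hfv]
    simp

/-- Induction on the degree. Contraction with a functional dual to v_0 commutes with z and with the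
squares of the other v_i, so the contractions of x satisfy the hypothesis with one degree and one
vector less. Once they vanish, v_0 does not occur in z x and multiplication by its square is
injective. -/
theorem mul_eq_zero_of_sq_mul_eq_zero {S : Submodule ℂ (Coeffs n)} {z : CentralForms n}
    (hz : ∀ g : Coeffs n →ₗ[ℂ] ℂ, (∀ v ∈ S, g v = 0) →
      z ∈ contractInvariants (c.covector g) ⊓ contractInvariants (c.covectorBar g))
    {k : ℕ} {v : Fin (k + 1) → Coeffs n} (hv : LinearIndependent ℂ (S.mkQ ∘ v)) {x : Forms n}
    (hx : x ∈ formsOfDegree n k) (h : ∀ i, (c.sq (v i) : Forms n) * (z * x) = 0) :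
    (z : Forms n) * x = 0 := by
  induction k generalizing x with
  | zero =>
    obtain ⟨g, hgS, hg, -⟩ := exists_dual_eq_one hv
    obtain ⟨hz1, hz2⟩ := hz g hgS
    refine c.eq_zero_of_sq_mul_eq_zero hg (h 0) ?_ ?_
    · rw [hz1, (contract_mem_formsOfDegree _ hx).1 rfl, mul_zero]
    · rw [hz2, (contract_mem_formsOfDegree _ hx).1 rfl, mul_zero]
  | succ k ih =>
    obtain ⟨g, hgS, hg, hg'⟩ := exists_dual_eq_one hv
    obtain ⟨hz1, hz2⟩ := hz g hgS
    have hv' : LinearIndependent ℂ (S.mkQ ∘ fun i : Fin (k + 1) => v i.succ) :=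
      hv.comp Fin.succ (Fin.succ_injective _)
    refine c.eq_zero_of_sq_mul_eq_zero hg (h 0) ?_ ?_
    · rw [hz1]
      refine ih hv' ((contract_mem_formsOfDegree _ hx).2 k rfl) fun i => ?_
      rw [← hz1, ← (c.sq_mem_contractInvariants (hg' i)).1, h, map_zero]
    · rw [hz2]
      refine ih hv' ((contract_mem_formsOfDegree _ hx).2 k rfl) fun i => ?_
      rw [← hz2, ← (c.sq_mem_contractInvariants (hg' i)).2, h, map_zero]

theorem exists_independent_mod {S : Submodule ℂ (Coeffs n)} {k : ℕ} {A : Set (Coeffs n)}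
    (h : Module.finrank ℂ S + (k + 1) ≤ Module.finrank ℂ (Submodule.span ℂ A)) :
    ∃ v : Fin (k + 1) → Coeffs n, (∀ i, v i ∈ A) ∧ LinearIndependent ℂ (S.mkQ ∘ v) := by
  obtain ⟨κ, a, ha, hspan, hli⟩ := exists_linearIndependent' ℂ (fun w : A => S.mkQ w)
  have hfin : Finite κ := hli.finite
  have := Fintype.ofFinite κ
  have h1 : Submodule.span ℂ (Set.range fun w : A => S.mkQ w) =
      (Submodule.span ℂ A).map S.mkQ := by
    rw [Submodule.map_span]
    congr 1
    ext y
    simp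
  have h2 := finrank_span_eq_card hli
  rw [hspan, h1] at h2
  set U := Submodule.span ℂ A
  have h3 := LinearMap.finrank_range_add_finrank_ker (S.mkQ.domRestrict U)
  rw [LinearMap.range_domRestrict] at h3
  -- The kernel of U → E/S is U ∩ S, so passing to the quotient costs at most dim S dimensions.
  have h4 : Module.finrank ℂ (LinearMap.ker (S.mkQ.domRestrict U)) ≤ Module.finrank ℂ S := by
    refine LinearMap.finrank_le_finrank_of_injective
      (f := ((U.subtype ∘ₗ (LinearMap.ker (S.mkQ.domRestrict U)).subtype).codRestrict S
        fun y => ?_)) ?_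
    · have := y.2
      rw [LinearMap.mem_ker, LinearMap.domRestrict_apply, Submodule.mkQ_apply,
        Submodule.Quotient.mk_eq_zero] at this
      exact this
    · intro y y' hy
      exact Subtype.ext (Subtype.ext (show ((y : U) : Coeffs n) = y' from
        congrArg (fun v : S => (v : Coeffs n)) hy))
  have h5 : k + 1 ≤ Fintype.card κ := by omega
  obtain ⟨f⟩ : Nonempty (Fin (k + 1) ↪ κ) := by
    rw [Function.Embedding.nonempty_iff_card_le]
    simpa using h5
  exact ⟨fun i => a (f i), fun i => (a (f i)).2, hli.comp f f.injective⟩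

/-- A k-form on the subspace cut out by the flag vanishes if it restricts to zero on k + 1
independent hyperplanes. The dimension bound on A provides these hyperplanes. -/
theorem flag_mul_eq_zero (b : OrthonormalBasis (Fin n) ℂ (Coeffs n)) (I : Finset (Fin n))
    {k : ℕ} {A : Set (Coeffs n)} (hA : I.card + (k + 1) ≤ Module.finrank ℂ (Submodule.span ℂ A))
    {x : Forms n} (hx : x ∈ formsOfDegree n k)
    (h : ∀ w ∈ A, ((c.flag b I * c.sq w : CentralForms n) : Forms n) * x = 0) :
    (c.flag b I : Forms n) * x = 0 := by
  have h1 : Module.finrank ℂ (Submodule.span ℂ (b '' I)) ≤ I.card := by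
    rw [← Finset.coe_image]
    exact (finrank_span_finset_le_card _).trans Finset.card_image_le
  obtain ⟨v, hvA, hv⟩ := exists_independent_mod (S := Submodule.span ℂ (b '' I)) (k := k)
    (A := A) (by omega)
  refine c.mul_eq_zero_of_sq_mul_eq_zero (fun g hg => c.flag_mem_contractInvariants b
    fun i hi => hg _ (Submodule.subset_span (Set.mem_image_of_mem _ hi))) hv hx fun i => ?_
  rw [← h (v i) (hvA i), mul_comm, Subalgebra.coe_mul, mul_assoc]

/-! ### Sums of squares -/

/-- Sums of squares of vectors that span a space of dimension at least `M`. -/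
def IsGood (M : ℕ) (α : CentralForms n) : Prop :=
  ∃ l : List (Coeffs n), α = (l.map c.sq).sum ∧
    M ≤ Module.finrank ℂ (Submodule.span ℂ {w | w ∈ l})

theorem th_eq_sq (j : Fin n) : c.th j = c.sq (EuclideanSpace.basisFun (Fin n) ℂ j) := by
  rw [th, sq]
  congr 1
  simp [lin_apply]

theorem isGood_omega {M : ℕ} (hM : M ≤ n) : c.IsGood M c.omega := by
  refine ⟨(List.finRange n).map (EuclideanSpace.basisFun (Fin n) ℂ), ?_, ?_⟩
  · rw [omega, List.map_map, ← Fin.sum_univ_def]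
    simp_rw [th_eq_sq]
    rfl
  · have h : {w | w ∈ (List.finRange n).map (EuclideanSpace.basisFun (Fin n) ℂ)} =
        Set.range (EuclideanSpace.basisFun (Fin n) ℂ).toBasis := by
      ext w
      simp
    rw [h, Module.Basis.span_eq, finrank_top]
    simpa using hM

theorem sum_map_sq_smul (r : ℂ) (l : List (Coeffs n)) :
    ((l.map fun w => r • w).map c.sq).sum = ((Complex.normSq r : ℝ) : ℂ) • (l.map c.sq).sum := by
  induction l with
  | nil => simp
  | cons w l ih =>
    rw [List.map_cons, List.map_cons, List.sum_cons, ih, List.map_cons, List.sum_cons, smul_add,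
      sq_smul]

theorem IsGood.segment {c : Coframe n} {M : ℕ} (hM : M ≤ n) {α : CentralForms n} (h : c.IsGood M α)
    {u : ℝ}
    (h0 : 0 ≤ u) (h1 : u ≤ 1) :
    c.IsGood M (((1 - u : ℝ) : ℂ) • α + (u : ℂ) • c.omega) := by
  rcases eq_or_lt_of_le h1 with rfl | hu
  -- At u = 1 the vectors of α are scaled to zero and no longer span, so here the rank comes from ω.
  · simpa using c.isGood_omega hM
  obtain ⟨l, rfl, hl⟩ := h
  obtain ⟨l', hl', -⟩ := c.isGood_omega hM
  refine ⟨(l.map fun w => ((√(1 - u) : ℝ) : ℂ) • w) ++ l'.map fun w => ((√u : ℝ) : ℂ) • w, ?_, ?_⟩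
  · rw [List.map_append, List.sum_append, sum_map_sq_smul, sum_map_sq_smul, hl',
      Complex.normSq_ofReal, Complex.normSq_ofReal, Real.mul_self_sqrt (by linarith),
      Real.mul_self_sqrt h0]
  · refine hl.trans (Submodule.finrank_mono (Submodule.span_le.mpr fun w hw => ?_))
    have hne : ((√(1 - u) : ℝ) : ℂ) ≠ 0 := by
      rw [Complex.ofReal_ne_zero]
      exact (Real.sqrt_pos.mpr (by linarith)).ne'
    have h2 : w = ((√(1 - u) : ℝ) : ℂ)⁻¹ • (((√(1 - u) : ℝ) : ℂ) • w) := by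
      rw [smul_smul, inv_mul_cancel₀ hne, one_smul]
    rw [h2]
    exact Submodule.smul_mem _ _ (Submodule.subset_span
      (List.mem_append_left _ (List.mem_map_of_mem (f := fun w => ((√(1 - u) : ℝ) : ℂ) • w) hw)))

end Coframe

end

end LinearHRR

namespace LinearHRR

noncomputable section

open ExteriorAlgebra

variable {n : ℕ}

/-! ### Real forms and their pairings -/

/-- Real forms of type `(d,d)`, characterized by their behaviour under the operators on forms. -/
structure IsRealForm (d : ℕ) (z : CentralForms n) : Prop where
  weil_eq : weil (z : Forms n) = z
  adj_eq : adj (z : Forms n) = (-1 : ℂ) ^ d • (z : Forms n)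
  mem : (z : Forms n) ∈ formsOfDegree n (2 * d)

namespace IsRealForm

variable {d d' : ℕ} {z z' : CentralForms n}

theorem one : IsRealForm 0 (1 : CentralForms n) where
  weil_eq := map_one weil
  adj_eq := by
    have := adj_algebraMap (n := n) 1
    simpa using this
  mem := by simp

theorem mul (h : IsRealForm d z) (h' : IsRealForm d' z') : IsRealForm (d + d') (z * z') where
  weil_eq := by rw [Subalgebra.coe_mul, map_mul, h.weil_eq, h'.weil_eq]
  adj_eq := by
    rw [Subalgebra.coe_mul, adj_mul, h.adj_eq, h'.adj_eq, smul_mul_smul_comm, central_comm z,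
      pow_add, mul_comm]
  mem := by
    rw [Subalgebra.coe_mul, mul_add]
    exact mul_mem_formsOfDegree h.mem h'.mem

theorem add (h : IsRealForm d z) (h' : IsRealForm d z') : IsRealForm d (z + z') where
  weil_eq := by rw [Subalgebra.coe_add, map_add, h.weil_eq, h'.weil_eq]
  adj_eq := by rw [Subalgebra.coe_add, adj_add, h.adj_eq, h'.adj_eq, smul_add]
  mem := add_mem h.mem h'.mem

theorem zero : IsRealForm d (0 : CentralForms n) where
  weil_eq := map_zero weil
  adj_eq := by rw [Subalgebra.coe_zero, adj_zero, smul_zero]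
  mem := zero_mem _

theorem pow (h : IsRealForm d z) (r : ℕ) : IsRealForm (r * d) (z ^ r) := by
  induction r with
  | zero => simpa using one
  | succ r ih =>
    rw [pow_succ, add_mul, one_mul]
    exact ih.mul h

theorem list_prod {l : List (CentralForms n)} (h : ∀ z ∈ l, IsRealForm d z) :
    IsRealForm (l.length * d) l.prod := by
  induction l with
  | nil => simpa using one
  | cons z l ih =>
    rw [List.prod_cons, List.length_cons, add_mul, one_mul, add_comm]
    exact (h z List.mem_cons_self).mul (ih fun z hz => h z (List.mem_cons_of_mem _ hz))

theorem list_sum {l : List (CentralForms n)} (h : ∀ z ∈ l, IsRealForm d z) :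
    IsRealForm d l.sum := by
  induction l with
  | nil => exact zero
  | cons z l ih =>
    rw [List.sum_cons]
    exact (h z List.mem_cons_self).add (ih fun z hz => h z (List.mem_cons_of_mem _ hz))

theorem finset_prod {ι : Type*} {s : Finset ι} {f : ι → CentralForms n}
    (h : ∀ i ∈ s, IsRealForm d (f i)) : IsRealForm (s.card * d) (∏ i ∈ s, f i) := by
  have := list_prod (l := s.toList.map f) (d := d) (by simpa using h)
  simpa using this

theorem theta {ξ : Cotangent n} (h : rotate n ξ = Complex.I • ξ) : IsRealForm 1 (theta ξ) where
  weil_eq := theta_mem_weilInvariants h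
  adj_eq := by rw [adj_theta, pow_one, neg_one_smul]
  mem := theta_mem_formsOfDegree ξ

end IsRealForm

/-- The Hermitian pairing of forms defined by a real form. -/
def pairing (t : Forms n →ₗ[ℂ] ℂ) (z : CentralForms n) (x y : Forms n) : ℂ :=
  t (z * (weil x * adj y))

namespace Coframe

variable (c : Coframe n) {t : Forms n →ₗ[ℂ] ℂ}

theorem isRealForm_sq (w : Coeffs n) : IsRealForm 1 (c.sq w) := IsRealForm.theta (c.rotate_lin w)

theorem IsGood.isRealForm {c : Coframe n} {M : ℕ} {α : CentralForms n} (h : c.IsGood M α) :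
    IsRealForm 1 α := by
  obtain ⟨l, rfl, -⟩ := h
  refine IsRealForm.list_sum fun z hz => ?_
  obtain ⟨w, -, rfl⟩ := List.mem_map.mp hz
  exact c.isRealForm_sq w

theorem isRealForm_flag (b : OrthonormalBasis (Fin n) ℂ (Coeffs n)) (I : Finset (Fin n)) :
    IsRealForm I.card (c.flag b I) := by
  have := IsRealForm.finset_prod (s := I) fun i _ => c.isRealForm_sq (b i)
  rwa [mul_one] at this

theorem isRealForm_vol : IsRealForm n c.vol := by
  have := IsRealForm.finset_prod (s := Finset.univ) fun i _ => IsRealForm.theta (c.rotate_e i)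
  rwa [mul_one, Finset.card_univ, Fintype.card_fin] at this

theorem conj_vol : conj (c.vol : Forms n) = c.vol := by
  have h (s : Finset (Fin n)) :
      conj ((∏ i ∈ s, c.th i : CentralForms n) : Forms n) = (∏ i ∈ s, c.th i : CentralForms n) := by
    induction s using Finset.induction_on with
    | empty => simp
    | insert i s hi ih =>
      rw [Finset.prod_insert hi, Subalgebra.coe_mul, map_mul, ih, th, conj_theta]
  exact h Finset.univ

/-- By uniqueness of integration it is enough that t ∘ `weil` is again an integral and that the
volume form is fixed by `weil`. The same idea gives `integral_conj`. -/
theorem integral_weil (c : Coframe n) (ht : IsIntegral t) (x : Forms n) : t (weil x) = t x := by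
  have h : IsIntegral (t ∘ₗ weil.toLinearMap) := by
    intro d x
    have h1 : weil (contract d x) = contract (-(d ∘ₗ rotate n)) (weil x) := by
      have h2 : (-(d ∘ₗ rotate n)) ∘ₗ rotate n = d := by
        refine LinearMap.ext fun ξ => ?_
        simp [rotate_rotate]
      rw [weil_contract, h2]
    simp only [LinearMap.comp_apply, AlgHom.toLinearMap_apply]
    rw [h1, ht]
  have h1 := c.eq_mul_integral h x
  rw [c.eq_mul_integral ht x]
  simp only [LinearMap.comp_apply, AlgHom.toLinearMap_apply] at h1
  rw [h1, c.isRealForm_vol.weil_eq]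

theorem integral_conj (ht : IsIntegral t) (hvol : t c.vol = 1) (x : Forms n) :
    t (conj x) = starRingEnd ℂ (t x) := by
  let t' : Forms n →ₗ[ℂ] ℂ :=
    { toFun := fun x => starRingEnd ℂ (t (conj x))
      map_add' := fun x y => by rw [map_add, map_add, map_add]
      map_smul' := fun r x => by rw [conj_smul, map_smul, smul_eq_mul, map_mul]; simp }
  have h : IsIntegral t' := by
    intro d x
    have h1 : conj (contract d x) = contract (conjCovector d) (conj x) := by
      rw [conj_contract]
      congr 3
      refine LinearMap.ext fun ξ => ?_
      simp [conjCovector, conjCotangent_conjCotangent]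
    change starRingEnd ℂ (t (conj (contract d x))) = 0
    rw [h1, ht, map_zero]
  have h1 : starRingEnd ℂ (t (conj x)) = c.integral x * starRingEnd ℂ (t (conj c.vol)) :=
    c.eq_mul_integral h x
  rw [conj_vol, hvol, map_one, mul_one] at h1
  have h2 := c.eq_mul_integral ht x
  rw [hvol, mul_one] at h2
  rw [h2, ← h1, Complex.conj_conj]

theorem integral_adj (ht : IsIntegral t) (hvol : t c.vol = 1) {x : Forms n}
    (hx : x ∈ formsOfDegree n (2 * n)) : t (adj x) = (-1) ^ n * starRingEnd ℂ (t x) := by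
  rw [adj, rev_of_mem (conj_mem_formsOfDegree hx), map_smul, c.integral_conj ht hvol, smul_eq_mul]
  congr 1
  rcases n with _ | n
  · simp
  · have h : 2 * (n + 1) * (2 * (n + 1) - 1) / 2 = (n + 1) + 2 * (n * (n + 1)) := by
      have : 2 * (n + 1) * (2 * (n + 1) - 1) = 2 * ((n + 1) + 2 * (n * (n + 1))) := by
        have : 2 * (n + 1) - 1 = 2 * n + 1 := by omega
        rw [this]
        ring
      rw [this, Nat.mul_div_cancel_left _ two_pos]
    rw [h, pow_add, pow_mul]
    simp

/-- Taking adjoints swaps the arguments. The signs from z, from `weil` applied twice, and from the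
integral are (-1)^d, (-1)^k and (-1)^n, which cancel because d + k = n. -/
theorem pairing_comm (ht : IsIntegral t) (hvol : t c.vol = 1) {d k : ℕ} {z : CentralForms n}
    (hz : IsRealForm d z) (hd : d + k = n) {x y : Forms n} (hx : x ∈ formsOfDegree n k)
    (hy : y ∈ formsOfDegree n k) : pairing t z y x = starRingEnd ℂ (pairing t z x y) := by
  have hdeg : (z : Forms n) * (weil x * adj y) ∈ formsOfDegree n (2 * n) := by
    have := mul_mem_formsOfDegree hz.mem (mul_mem_formsOfDegree (weil_mem_formsOfDegree hx)
      (adj_mem_formsOfDegree hy))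
    rwa [show 2 * d + (k + k) = 2 * n by omega] at this
  have h1 := c.integral_adj ht hvol hdeg
  rw [adj_mul, adj_mul, adj_adj, hz.adj_eq, mul_smul_comm, ← central_comm, map_smul,
    ← c.integral_weil ht, map_mul weil, map_mul weil, hz.weil_eq, ← weil_adj, weil_weil,
    parity_of_mem (adj_mem_formsOfDegree hx), mul_smul_comm, mul_smul_comm, map_smul, smul_eq_mul,
    smul_eq_mul, ← mul_assoc, ← pow_add, hd] at h1
  exact mul_left_cancel₀ (pow_ne_zero n (by norm_num)) h1

/-- Poincaré duality in complementary degrees. -/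
theorem eq_zero_of_integral_mul_eq_zero_of_mem (ht : IsIntegral t) (hvol : t c.vol = 1) {k l : ℕ}
    (hkl : k + l = 2 * n) {x : Forms n} (hx : x ∈ formsOfDegree n k)
    (h : ∀ y ∈ formsOfDegree n l, t (x * y) = 0) : x = 0 := by
  refine c.eq_zero_of_integral_mul_eq_zero ht hvol fun y => ?_
  induction y using forms_homogeneous_induction with
  | hom j y hy =>
    by_cases hj : j = l
    · exact h y (hj ▸ hy)
    · exact c.eq_zero_of_mem ht (k := k + j) (by omega) (mul_mem_formsOfDegree hx hy)
  | add y y' hy hy' => rw [mul_add, map_add, hy, hy', add_zero]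

theorem eq_zero_of_pairing_eq_zero (ht : IsIntegral t) (hvol : t c.vol = 1) {d k l : ℕ}
    {z : CentralForms n} (hz : IsRealForm d z) (hd : 2 * d + k + l = 2 * n) {x : Forms n}
    (hx : x ∈ formsOfDegree n k) (h : ∀ y ∈ formsOfDegree n l, pairing t z x y = 0) :
    (z : Forms n) * x = 0 := by
  have h1 : (z : Forms n) * weil x = 0 := by
    refine c.eq_zero_of_integral_mul_eq_zero_of_mem ht hvol hd
      (mul_mem_formsOfDegree hz.mem (weil_mem_formsOfDegree hx)) fun y hy => ?_
    have := h (adj y) (adj_mem_formsOfDegree hy)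
    rwa [pairing, adj_adj, ← mul_assoc] at this
  have h2 := congrArg weil h1
  rw [map_mul, hz.weil_eq, weil_weil, parity_of_mem hx, mul_smul_comm, map_zero] at h2
  exact (smul_eq_zero.mp h2).resolve_left (pow_ne_zero k (by norm_num))

theorem eq_zero_of_degree_gt (ht : IsIntegral t) (hvol : t c.vol = 1) {k : ℕ} (hk : 2 * n < k)
    {x : Forms n} (hx : x ∈ formsOfDegree n k) : x = 0 := by
  refine c.eq_zero_of_integral_mul_eq_zero ht hvol fun y => ?_
  induction y using forms_homogeneous_induction with
  | hom j y hy => exact c.eq_zero_of_mem ht (k := k + j) (by omega) (mul_mem_formsOfDegree hx hy)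
  | add y y' hy hy' => rw [mul_add, map_add, hy, hy', add_zero]

end Coframe

end

end LinearHRR

namespace LinearHRR

noncomputable section

open ExteriorAlgebra

variable {n : ℕ}

/-! ### Pairings modulo a central factor -/

section Pairing

variable {t : Forms n →ₗ[ℂ] ℂ} {z : CentralForms n} {d : ℕ}

theorem pairing_add_left (x x' y : Forms n) :
    pairing t z (x + x') y = pairing t z x y + pairing t z x' y := by
  rw [pairing, map_add, add_mul, mul_add, map_add, pairing, pairing]

theorem pairing_add_right (x y y' : Forms n) :
    pairing t z x (y + y') = pairing t z x y + pairing t z x y' := by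
  rw [pairing, adj_add, mul_add, mul_add, map_add, pairing, pairing]

theorem pairing_smul_left (r : ℂ) (x y : Forms n) :
    pairing t z (r • x) y = r * pairing t z x y := by
  rw [pairing, map_smul, smul_mul_assoc, mul_smul_comm, map_smul, smul_eq_mul, pairing]

theorem pairing_smul_right (r : ℂ) (x y : Forms n) :
    pairing t z x (r • y) = starRingEnd ℂ r * pairing t z x y := by
  rw [pairing, adj_smul, mul_smul_comm, mul_smul_comm, map_smul, smul_eq_mul, pairing]

theorem pairing_zero_left (y : Forms n) : pairing t z 0 y = 0 := by
  simpa using pairing_smul_left (t := t) (z := z) 0 0 y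

theorem pairing_zero_right (x : Forms n) : pairing t z x 0 = 0 := by
  simpa using pairing_smul_right (t := t) (z := z) 0 x 0

theorem pairing_sum_left {ι : Type*} (s : Finset ι) (a : ι → ℂ) (v : ι → Forms n) (y : Forms n) :
    pairing t z (∑ i ∈ s, a i • v i) y = ∑ i ∈ s, a i * pairing t z (v i) y := by
  classical
  induction s using Finset.induction_on with
  | empty => exact pairing_zero_left _
  | insert i s hi ih =>
    rw [Finset.sum_insert hi, Finset.sum_insert hi, pairing_add_left, ih, pairing_smul_left]

theorem pairing_sum_right {ι : Type*} (s : Finset ι) (a : ι → ℂ) (v : ι → Forms n) (x : Forms n) :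
    pairing t z x (∑ i ∈ s, a i • v i) = ∑ i ∈ s, starRingEnd ℂ (a i) * pairing t z x (v i) := by
  classical
  induction s using Finset.induction_on with
  | empty => exact pairing_zero_right _
  | insert i s hi ih =>
    rw [Finset.sum_insert hi, Finset.sum_insert hi, pairing_add_right, ih, pairing_smul_right]

/-- The pairing descends to forms modulo the kernel of F. With `pairing_congr_right` it allows
passage to representatives modulo a flag. -/
theorem pairing_congr_left {F : CentralForms n} (hF : weil (F : Forms n) = F) {x x' : Forms n}
    (h : (F : Forms n) * x = F * x') (y : Forms n) :
    pairing t (F * z) x y = pairing t (F * z) x' y := by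
  have h1 := congrArg weil h
  rw [map_mul, map_mul, hF] at h1
  rw [pairing, pairing, mul_comm F, Subalgebra.coe_mul, mul_assoc, mul_assoc,
    ← mul_assoc (F : Forms n),
    h1, mul_assoc]

theorem pairing_congr_right {F : CentralForms n} (hF : IsRealForm d F) {y y' : Forms n}
    (h : (F : Forms n) * y = F * y') (x : Forms n) :
    pairing t (F * z) x y = pairing t (F * z) x y' := by
  have h1 := congrArg adj h
  rw [adj_mul, adj_mul, hF.adj_eq, mul_smul_comm, mul_smul_comm, ← central_comm,
    ← central_comm] at h1
  have h2 := smul_right_injective _ (pow_ne_zero d (by norm_num : (-1 : ℂ) ≠ 0)) h1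
  rw [pairing, pairing, mul_comm F, Subalgebra.coe_mul, mul_assoc, mul_assoc,
    central_mul_left_comm F,
    h2, central_mul_left_comm F]

theorem pairing_mul_right {α : CentralForms n} (hα : IsRealForm d α) (x y : Forms n) :
    pairing t z x (α * y) = (-1) ^ d * pairing t (z * α) x y := by
  rw [pairing, adj_mul, hα.adj_eq, mul_smul_comm, ← central_comm, mul_smul_comm, mul_smul_comm,
    map_smul, smul_eq_mul, ← central_mul_left_comm α, pairing, Subalgebra.coe_mul, mul_assoc]

theorem pairing_mul_left {α : CentralForms n} (hα : IsRealForm d α) (x y : Forms n) :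
    pairing t z (α * x) y = pairing t (z * α) x y := by
  rw [pairing, map_mul weil, hα.weil_eq, pairing, Subalgebra.coe_mul, mul_assoc, mul_assoc]

end Pairing

/-! ### Bases modulo a kernel -/

/-- The v_i lift a basis of L(V), and φ composes L with an extension of the coordinates on L(V) to
all of F. This turns statements modulo a flag into statements about matrices. -/
theorem exists_basis_mod_ker {E F : Type*} [AddCommGroup E] [Module ℂ E] [AddCommGroup F]
    [Module ℂ F] (V : Submodule ℂ E) [Module.Finite ℂ V] (L : E →ₗ[ℂ] F) :
    ∃ (m : ℕ) (v : Fin m → E) (φ : E →ₗ[ℂ] (Fin m → ℂ)), (∀ i, v i ∈ V) ∧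
      (∀ x ∈ V, L (∑ i, φ x i • v i) = L x) ∧
      ∀ y : Fin m → ℂ, L (∑ i, y i • v i) = 0 → y = 0 := by
  have : Module.Finite ℂ (V.map L) := inferInstance
  let b := Module.finBasis ℂ (V.map L)
  have h (i) : ∃ v ∈ V, L v = b i := (b i).2
  choose v hv hLv using h
  obtain ⟨ψ, hψ⟩ := LinearMap.exists_extend b.equivFun.toLinearMap
  have hL (y : Fin _ → ℂ) : L (∑ i, y i • v i) = ((∑ i, y i • b i : V.map L) : F) := by
    simp [hLv]
  refine ⟨_, v, ψ ∘ₗ L, hv, fun x hx => ?_, fun y hy => ?_⟩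
  · have h1 : ψ (L x) = b.equivFun ⟨L x, Submodule.mem_map_of_mem hx⟩ :=
      LinearMap.congr_fun hψ ⟨L x, Submodule.mem_map_of_mem hx⟩
    rw [hL, LinearMap.comp_apply, h1, b.sum_equivFun]
  · rw [hL, ZeroMemClass.coe_eq_zero] at hy
    funext i
    exact Fintype.linearIndependent_iff.mp b.linearIndependent y hy i

theorem Coframe.finite_cotangent (c : Coframe n) : Module.Finite ℂ (Cotangent n) := by
  refine Module.Finite.of_surjective (LinearMap.coprod (Fintype.linearCombination ℂ c.e)
    (Fintype.linearCombination ℂ fun j => conjCotangent (c.e j))) fun ξ =>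
      ⟨(fun j => c.d j ξ, fun j => c.db j ξ), ?_⟩
  conv_rhs => rw [← c.complete ξ, Finset.sum_add_distrib]
  simp [Fintype.linearCombination_apply]

theorem Coframe.finite_formsOfDegree (c : Coframe n) (k : ℕ) :
    Module.Finite ℂ (formsOfDegree n k) :=
  have := c.finite_cotangent
  inferInstance

/-! ### Weakly continuous families -/

/-- Families of vectors whose coordinates are continuous. -/
def WeaklyContinuous {T E : Type*} [TopologicalSpace T] [AddCommMonoid E] [Module ℂ E]
    (X : T → E) : Prop :=
  ∀ φ : E →ₗ[ℂ] ℂ, Continuous fun u => φ (X u)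

theorem WeaklyContinuous.segment_mul {T : Type*} [TopologicalSpace T] {A : Type*} [Semiring A]
    [Algebra ℂ A] {f g : T → ℂ} (hf : Continuous f) (hg : Continuous g) (a b : A) {X : T → A}
    (hX : WeaklyContinuous X) : WeaklyContinuous fun u => (f u • a + g u • b) * X u := by
  intro φ
  have h1 := hX (φ ∘ₗ LinearMap.mulLeft ℂ a)
  have h2 := hX (φ ∘ₗ LinearMap.mulLeft ℂ b)
  have h3 : (fun u => φ ((f u • a + g u • b) * X u)) =
      fun u => f u * (φ ∘ₗ LinearMap.mulLeft ℂ a) (X u) +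
        g u * (φ ∘ₗ LinearMap.mulLeft ℂ b) (X u) := by
    funext u
    simp [add_mul]
  rw [h3]
  exact (hf.mul h1).add (hg.mul h2)

end

end LinearHRR

/-! ### The mixed properties, and Lefschetz from Hodge–Riemann one codimension higher -/

namespace LinearHRR

noncomputable section

open ExteriorAlgebra

variable {n : ℕ}

namespace Coframe

variable (c : Coframe n) (t : Forms n →ₗ[ℂ] ℂ)

/-- The mixed hard Lefschetz property on quotients of codimension `s`. -/
def Lefschetz (M s : ℕ) : Prop :=
  ∀ (b : OrthonormalBasis (Fin n) ℂ (Coeffs n)) (I : Finset (Fin n)), I.card = s →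
    ∀ l : List (CentralForms n), (∀ α ∈ l, c.IsGood M α) → ∀ k, s + l.length + k = M →
      ∀ x ∈ formsOfDegree n k,
        ((c.flag b I * (c.omega ^ (n - M) * l.prod) : CentralForms n) : Forms n) * x = 0 →
          (c.flag b I : Forms n) * x = 0

open scoped ComplexOrder in
/-- The mixed Hodge-Riemann property on quotients of codimension `s`. -/
def HodgeRiemann (M s : ℕ) : Prop :=
  ∀ (b : OrthonormalBasis (Fin n) ℂ (Coeffs n)) (I : Finset (Fin n)), I.card = s →
    ∀ l : List (CentralForms n), (∀ α ∈ l, c.IsGood M α) → ∀ α, c.IsGood M α →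
      ∀ k, s + l.length + k = M → ∀ x ∈ formsOfDegree n k,
        ((c.flag b I * (c.omega ^ (n - M) * l.prod) * α : CentralForms n) : Forms n) * x = 0 →
          0 ≤ pairing t (c.flag b I * (c.omega ^ (n - M) * l.prod)) x x ∧
            (pairing t (c.flag b I * (c.omega ^ (n - M) * l.prod)) x x = 0 →
              (c.flag b I : Forms n) * x = 0)

variable {c t}

theorem complTh_change (b : OrthonormalBasis (Fin n) ℂ (Coeffs n)) (I : Finset (Fin n)) :
    (c.change b).complTh (Finset.univ \ I).toList = c.flag b I := by
  rw [complTh, flag]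
  refine Finset.prod_congr ?_ fun _ _ => c.change_th b _
  ext i
  simp

theorem isRealForm_mixed {M : ℕ} (hM : M ≤ n) (b : OrthonormalBasis (Fin n) ℂ (Coeffs n))
    (I : Finset (Fin n)) {l : List (CentralForms n)} (hl : ∀ α ∈ l, c.IsGood M α) :
    IsRealForm (I.card + (n - M + l.length))
      (c.flag b I * (c.omega ^ (n - M) * l.prod)) := by
  have h1 := (c.isGood_omega hM).isRealForm.pow (n - M)
  have h2 := IsRealForm.list_prod fun z hz => (hl z hz).isRealForm
  rw [mul_one] at h1 h2
  exact (c.isRealForm_flag b I).mul (h1.mul h2)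

theorem mixed_mul {F ω z α : CentralForms n} : F * (ω * z) * α = F * (ω * (α * z)) := by ring

open scoped ComplexOrder in
-- One factor α is written as a sum of squares; each square cuts out a hyperplane on which x is
-- primitive, and the Hodge–Riemann values on these hyperplanes are nonnegative with sum zero.
theorem lefschetz_of_hodgeRiemann {M s : ℕ} (hM : M ≤ n) (h : c.HodgeRiemann t M (s + 1)) :
    c.Lefschetz M s := by
  intro b I hI l hl k hk x hx h0
  rcases l with _ | ⟨α, l⟩
  -- Only a power of ω is left, and this is the classical theorem on the directions outside I.
  · rw [List.prod_nil, mul_one] at h0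
    rw [← complTh_change] at h0 ⊢
    rw [← c.change_omega b] at h0
    refine (c.change b).hard_lefschetz (Finset.nodup_toList _) (k := k) (r := n - M) ?_ hx h0
    rw [Finset.length_toList, Finset.card_sdiff_of_subset (Finset.subset_univ _), Finset.card_univ,
      Fintype.card_fin, hI]
    simp only [List.length_nil] at hk
    omega
  · rw [List.length_cons] at hk
    have hα := hl α List.mem_cons_self
    have hl' : ∀ β ∈ l, c.IsGood M β := fun β hβ => hl β (List.mem_cons_of_mem _ hβ)
    obtain ⟨ws, hws, hrank⟩ := hα
    -- The list is nonempty, so s + k + 1 ≤ M, and the rank of α is large enough for the vanishing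
    -- lemma.
    refine c.flag_mul_eq_zero b I (A := {w | w ∈ ws}) (by omega) hx ?_
    set z := c.omega ^ (n - M) * l.prod with hz
    have hzα : c.flag b I * (c.omega ^ (n - M) * (α :: l).prod) = c.flag b I * z * α := by
      rw [List.prod_cons, hz, mixed_mul]
    rw [hzα] at h0
    -- The flag times the square of w is zero or a positive multiple of a flag of length s + 1, and
    -- multiplying `h0` by the square of w makes x primitive for it.
    have key (w : Coeffs n) : 0 ≤ pairing t (c.flag b I * z * c.sq w) x x ∧
        (pairing t (c.flag b I * z * c.sq w) x x = 0 →
          ((c.flag b I * c.sq w : CentralForms n) : Forms n) * x = 0) := by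
      have h1 : c.flag b I * z * c.sq w = c.flag b I * c.sq w * z := by ring
      rw [h1]
      rcases c.flag_mul_sq b I (U := ⊤) (by simp) (w := w) (by trivial) with
        h2 | ⟨r, b', I', hr, hI', -, h2⟩
      · rw [h2]
        simp [pairing]
      · have h3 : ((c.flag b' I' * z * α : CentralForms n) : Forms n) * x = 0 := by
          have h4 : (r : ℂ) • (c.flag b' I' * z * α) = c.sq w * (c.flag b I * z * α) := by
            rw [← smul_mul_assoc, ← smul_mul_assoc, ← h2]
            ring
          have h5 : ((r : ℂ) • (c.flag b' I' * z * α : CentralForms n) : Forms n) * x = 0 := by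
            rw [← Subalgebra.coe_smul, h4, Subalgebra.coe_mul, mul_assoc, h0, mul_zero]
          rw [smul_mul_assoc] at h5
          exact (smul_eq_zero.mp h5).resolve_left (by exact_mod_cast hr.ne')
        obtain ⟨h4, h5⟩ := h b' I' (by omega) l hl' α (hl α List.mem_cons_self) k (by omega) x hx h3
        have h6 : pairing t (c.flag b I * c.sq w * z) x x =
            r * pairing t (c.flag b' I' * z) x x := by
          rw [h2, pairing, pairing, smul_mul_assoc, Subalgebra.coe_smul, smul_mul_assoc, map_smul,
            smul_eq_mul]
        rw [h6, h2]
        refine ⟨mul_nonneg (by exact_mod_cast hr.le) h4, fun h7 => ?_⟩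
        have h8 := h5 ((mul_eq_zero.mp h7).resolve_left (by exact_mod_cast hr.ne'))
        rw [Subalgebra.coe_smul, smul_mul_assoc, h8, smul_zero]
    have hsum : ∀ ws : List (Coeffs n),
        pairing t (c.flag b I * z * (ws.map c.sq).sum) x x =
          (ws.map fun w => pairing t (c.flag b I * z * c.sq w) x x).sum := by
      intro ws
      induction ws with
      | nil => simp [pairing]
      | cons w ws ih =>
        rw [List.map_cons, List.sum_cons, List.map_cons, List.sum_cons, ← ih, mul_add, pairing,
          Subalgebra.coe_add, add_mul, map_add]
        rfl
    have htotal : pairing t (c.flag b I * z * α) x x = 0 := by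
      have h1 := (isRealForm_mixed hM b I hl).weil_eq
      rw [hzα] at h1
      rw [pairing, ← mul_assoc]
      have h2 := congrArg weil h0
      rw [map_mul, h1, map_zero] at h2
      rw [h2, zero_mul, map_zero]
    rw [hws, hsum] at htotal
    intro w hw
    have hnn : ∀ a ∈ ws.map fun w => pairing t (c.flag b I * z * c.sq w) x x, 0 ≤ a := by
      intro a ha
      obtain ⟨w', -, rfl⟩ := List.mem_map.mp ha
      exact (key w').1
    exact (key w).2 (List.all_zero_of_le_zero_le_of_sum_eq_zero hnn htotal (List.mem_map_of_mem hw))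

end Coframe

end

end LinearHRR

/-! ### Hodge–Riemann from Lefschetz by deformation -/

namespace LinearHRR

noncomputable section

open ExteriorAlgebra

variable {n : ℕ}

namespace Coframe

variable {c : Coframe n} {t : Forms n →ₗ[ℂ] ℂ}

/-- A basis of forms of degree `k` modulo forms killed by a flag, on which all mixed pairings are
nondegenerate. -/
theorem exists_upper_basis (ht : IsIntegral t) (hvol : t c.vol = 1) {M s r k : ℕ} (hM : M ≤ n)
    (h : c.Lefschetz M s) (hk : s + r + k = M) (b : OrthonormalBasis (Fin n) ℂ (Coeffs n))
    {I : Finset (Fin n)} (hI : I.card = s) :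
    ∃ (m : ℕ) (v : Fin m → Forms n) (φ : Forms n →ₗ[ℂ] (Fin m → ℂ)),
      (∀ i, v i ∈ formsOfDegree n k) ∧
      (∀ x ∈ formsOfDegree n k, (c.flag b I : Forms n) * (∑ i, φ x i • v i) = c.flag b I * x) ∧
      (∀ y : Fin m → ℂ, (c.flag b I : Forms n) * (∑ i, y i • v i) = 0 → y = 0) ∧
      ∀ l : List (CentralForms n), (∀ α ∈ l, c.IsGood M α) → l.length = r → ∀ y : Fin m → ℂ,
        (∀ i, pairing t (c.flag b I * (c.omega ^ (n - M) * l.prod)) (∑ i, y i • v i) (v i) = 0) →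
          y = 0 := by
  have := c.finite_formsOfDegree k
  obtain ⟨m, v, φ, hv, hφ, hinj⟩ := exists_basis_mod_ker (formsOfDegree n k)
    (LinearMap.mulLeft ℂ (c.flag b I : Forms n))
  refine ⟨m, v, φ, hv, hφ, hinj, fun l hl hr y hy => hinj y ?_⟩
  have hmem : ∑ i, y i • v i ∈ formsOfDegree n k :=
    sum_mem fun i _ => Submodule.smul_mem _ _ (hv i)
  refine h b I hI l hl k (by omega) _ hmem ?_
  refine c.eq_zero_of_pairing_eq_zero ht hvol (isRealForm_mixed hM b I hl) (k := k) (l := k)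
    (by omega) hmem fun x hx => ?_
  rw [← pairing_congr_right (c.isRealForm_flag b I) (hφ x hx), pairing_sum_right]
  exact Finset.sum_eq_zero fun i _ => by rw [hy, mul_zero]

/-- The vectors w_j span the (k-2)-forms modulo the flag. Through them primitivity of a k-form
becomes orthogonality to the α w_j, and the pairing is nondegenerate on the span of these. -/
theorem exists_lower_basis (ht : IsIntegral t) (hvol : t c.vol = 1) {M s r k : ℕ} (hM : M ≤ n)
    (h : c.Lefschetz M s) (hk : s + r + k = M) (b : OrthonormalBasis (Fin n) ℂ (Coeffs n))
    {I : Finset (Fin n)} (hI : I.card = s) :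
    ∃ (m : ℕ) (w : Fin m → Forms n),
      (∀ α, c.IsGood M α → ∀ j, (α : Forms n) * w j ∈ formsOfDegree n k) ∧
      (∀ l : List (CentralForms n), (∀ α ∈ l, c.IsGood M α) → l.length = r →
        ∀ α, c.IsGood M α → ∀ y : Fin m → ℂ,
          (∀ j, pairing t (c.flag b I * (c.omega ^ (n - M) * l.prod) * α * α)
            (∑ i, y i • w i) (w j) = 0) → y = 0) ∧
      ∀ l : List (CentralForms n), (∀ α ∈ l, c.IsGood M α) → l.length = r →
        ∀ α, c.IsGood M α → ∀ x ∈ formsOfDegree n k,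
          (∀ j, pairing t (c.flag b I * (c.omega ^ (n - M) * l.prod) * α) x (w j) = 0) →
            ((c.flag b I * (c.omega ^ (n - M) * l.prod) * α : CentralForms n) : Forms n) *
              x = 0 := by
  rcases lt_or_ge k 2 with hk2 | hk2
  -- For k < 2 there are no (k-2)-forms. Every k-form is then primitive, because the product has
  -- degree 2n + 2 - k > 2n.
  · refine ⟨0, Fin.elim0, fun _ _ j => j.elim0, fun _ _ _ _ _ _ _ => Subsingleton.elim _ _,
      fun l hl hr α hα x hx _ => ?_⟩
    refine c.eq_zero_of_degree_gt ht hvol ?_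
      (mul_mem_formsOfDegree ((isRealForm_mixed hM b I hl).mul hα.isRealForm).mem hx)
    omega
  obtain ⟨k', rfl⟩ := Nat.exists_eq_add_of_le' hk2
  have := c.finite_formsOfDegree k'
  obtain ⟨m, w, φ, hw, hφ, hinj⟩ := exists_basis_mod_ker (formsOfDegree n k')
    (LinearMap.mulLeft ℂ (c.flag b I : Forms n))
  have hext (z : CentralForms n) (x : Forms n)
      (hx : ∀ j, pairing t (c.flag b I * z) x (w j) = 0) (y : Forms n)
      (hy : y ∈ formsOfDegree n k') : pairing t (c.flag b I * z) x y = 0 := by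
    rw [← pairing_congr_right (c.isRealForm_flag b I) (hφ y hy), pairing_sum_right]
    exact Finset.sum_eq_zero fun i _ => by rw [hx, mul_zero]
  refine ⟨m, w, fun α hα j => ?_, fun l hl hr α hα y hy => hinj y ?_,
    fun l hl hr α hα x hx hpair => ?_⟩
  · rw [add_comm]
    exact mul_mem_formsOfDegree hα.isRealForm.mem (hw j)
  · have hmem : ∑ i, y i • w i ∈ formsOfDegree n k' :=
      sum_mem fun i _ => Submodule.smul_mem _ _ (hw i)
    -- Two extra factors α and two degrees less: the Lefschetz property applies again, as (r + 2) +
    -- (k - 2) = r + k.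
    have hl' : ∀ β ∈ α :: α :: l, c.IsGood M β := by
      intro β hβ
      rcases List.mem_cons.mp hβ with rfl | hβ
      · exact hα
      rcases List.mem_cons.mp hβ with rfl | hβ
      · exact hα
      · exact hl β hβ
    have hprod : c.flag b I * (c.omega ^ (n - M) * (α :: α :: l).prod) =
        c.flag b I * (c.omega ^ (n - M) * l.prod) * α * α := by
      rw [List.prod_cons, List.prod_cons]
      ring
    have hreal := isRealForm_mixed hM b I hl'
    refine h b I hI (α :: α :: l) hl' k' ?_ _ hmem ?_
    · simp only [List.length_cons]
      omega
    · rw [← hprod] at hy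
      refine c.eq_zero_of_pairing_eq_zero ht hvol hreal (k := k') (l := k') ?_ hmem (hext _ _ hy)
      simp only [List.length_cons]
      omega
  · refine c.eq_zero_of_pairing_eq_zero ht hvol ((isRealForm_mixed hM b I hl).mul hα.isRealForm)
      (k := k' + 2) (l := k') (by omega) hx fun y hy => ?_
    rw [mul_assoc] at hpair ⊢
    exact hext _ _ hpair y hy

open scoped ComplexOrder in
theorem hodge_riemann_omega (ht : IsIntegral t) (hvol : t c.vol = 1) {M s r k : ℕ} (hM : M ≤ n)
    (hk : s + r + k = M) (b : OrthonormalBasis (Fin n) ℂ (Coeffs n)) {I : Finset (Fin n)}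
    (hI : I.card = s) {x : Forms n} (hx : x ∈ formsOfDegree n k)
    (h : ((c.flag b I * (c.omega ^ (n - M) * c.omega ^ r) * c.omega : CentralForms n) : Forms n) *
      x = 0) :
    0 ≤ pairing t (c.flag b I * (c.omega ^ (n - M) * c.omega ^ r)) x x ∧
      (pairing t (c.flag b I * (c.omega ^ (n - M) * c.omega ^ r)) x x = 0 →
        (c.flag b I : Forms n) * x = 0) := by
  rw [mul_assoc, ← pow_add, ← pow_succ] at h
  rw [← pow_add, pairing]
  rw [← complTh_change, ← c.change_omega b] at h ⊢
  refine (c.change b).hodge_riemann ht (by rw [change_vol, hvol]) (Finset.nodup_toList _) (k := k)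
    ?_ hx h
  rw [Finset.length_toList, Finset.card_sdiff_of_subset (Finset.subset_univ _), Finset.card_univ,
    Fintype.card_fin, hI]
  omega

/-- The segment from a form to the Kähler form of the coframe. -/
def segment (c : Coframe n) (u : unitInterval) (α : CentralForms n) : CentralForms n :=
  ((1 - u : ℝ) : ℂ) • α + ((u : ℝ) : ℂ) • c.omega

theorem segment_one (α : CentralForms n) : c.segment 1 α = c.omega := by simp [segment]

theorem segment_zero (α : CentralForms n) : c.segment 0 α = α := by simp [segment]

theorem isGood_segment {M : ℕ} (hM : M ≤ n) {α : CentralForms n} (h : c.IsGood M α)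
    (u : unitInterval) : c.IsGood M (c.segment u α) := h.segment hM u.2.1 u.2.2

theorem weaklyContinuous_segment_mul (α : CentralForms n) {X : unitInterval → CentralForms n}
    (hX : WeaklyContinuous X) : WeaklyContinuous fun u => c.segment u α * X u :=
  hX.segment_mul (by fun_prop) (by fun_prop) _ _

theorem weaklyContinuous_prod_segment (l : List (CentralForms n)) :
    WeaklyContinuous fun u => (l.map (c.segment u)).prod := by
  induction l with
  | nil => exact fun φ => (continuous_const : Continuous fun _ : unitInterval => φ 1)
  | cons α l ih =>
    simp_rw [List.map_cons, List.prod_cons]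
    exact weaklyContinuous_segment_mul α ih

open scoped Matrix in
theorem mulVec_apply {ι κ : Type*} [Fintype κ] (A : Matrix ι κ ℂ) (y : κ → ℂ) (i : ι) :
    (A *ᵥ y) i = ∑ j, A i j * y j := rfl

open scoped ComplexOrder Matrix in
-- All factors, including the α defining primitivity, move simultaneously to ω. The Lefschetz
-- property holds at each parameter because `IsGood` is preserved along segments.
theorem hodgeRiemann_of_lefschetz (ht : IsIntegral t) (hvol : t c.vol = 1) {M s : ℕ} (hM : M ≤ n)
    (h : c.Lefschetz M s) : c.HodgeRiemann t M s := by
  intro b I hI l hl α hα k hk x hx h0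
  obtain ⟨m, v, φ, hv, hφ, hinj, hnd⟩ := exists_upper_basis ht hvol hM h hk b hI
  obtain ⟨m', w, hw, hnd', hprim⟩ := exists_lower_basis ht hvol hM h hk b hI
  set z : unitInterval → CentralForms n := fun u =>
    c.flag b I * (c.omega ^ (n - M) * (l.map (c.segment u)).prod) with hz
  have hlu (u : unitInterval) : ∀ β ∈ l.map (c.segment u), c.IsGood M β := by
    intro β hβ
    obtain ⟨β', hβ', rfl⟩ := List.mem_map.mp hβ
    exact isGood_segment hM (hl β' hβ') u
  have hαu (u : unitInterval) : c.IsGood M (c.segment u α) := isGood_segment hM hα u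
  have hlen (u : unitInterval) : (l.map (c.segment u)).length = l.length := List.length_map _
  have hzreal (u : unitInterval) := isRealForm_mixed hM b I (hlu u)
  -- The indices are swapped since the pairing is linear in its first argument. `B u` is
  -- multiplication by the deformed α from (k-2)-forms to k-forms, so the H-orthogonal complement of
  -- its range is the primitive space.
  let H : unitInterval → Matrix (Fin m) (Fin m) ℂ := fun u =>
    Matrix.of fun i j => pairing t (z u) (v j) (v i)
  let B : unitInterval → Matrix (Fin m) (Fin m') ℂ := fun u =>
    Matrix.of fun i j => φ (c.segment u α * w j) i
  have hHy (u : unitInterval) (y : Fin m → ℂ) (i : Fin m) :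
      (H u *ᵥ y) i = pairing t (z u) (∑ i, y i • v i) (v i) := by
    rw [pairing_sum_left, mulVec_apply]
    exact Finset.sum_congr rfl fun j _ => mul_comm _ _
  -- The minus sign comes from the adjoint of a real (1,1)-form being its negative.
  have hBH (u : unitInterval) (y : Fin m → ℂ) (j : Fin m') :
      ((B u)ᴴ *ᵥ (H u *ᵥ y)) j =
        -pairing t (z u * c.segment u α) (∑ i, y i • v i) (w j) := by
    have h1 := pairing_mul_right (t := t) (z := z u) (hαu u).isRealForm (∑ i, y i • v i) (w j)
    rw [pow_one, neg_one_mul] at h1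
    rw [← h1, hz, ← pairing_congr_right (c.isRealForm_flag b I) (hφ _ (hw _ (hαu u) j)),
      pairing_sum_right, mulVec_apply]
    exact Finset.sum_congr rfl fun i _ => by rw [hHy]; rfl
  have hBy (u : unitInterval) (y : Fin m' → ℂ) :
      B u *ᵥ y = φ (c.segment u α * ∑ j, y j • w j) := by
    rw [Finset.mul_sum, map_sum]
    funext i
    rw [Finset.sum_apply, mulVec_apply]
    refine Finset.sum_congr rfl fun j _ => ?_
    rw [mul_smul_comm, map_smul, Pi.smul_apply, smul_eq_mul, mul_comm]
    rfl
  have hyHy (u : unitInterval) (y : Fin m → ℂ) : star y ⬝ᵥ H u *ᵥ y =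
      pairing t (z u) (∑ i, y i • v i) (∑ i, y i • v i) := by
    rw [pairing_sum_right]
    exact Finset.sum_congr rfl fun i _ => by rw [hHy]; rfl
  have hcontz (x y : Forms n) : Continuous fun u => t (z u * (x * y)) := by
    have h1 := weaklyContinuous_prod_segment (c := c) l (t ∘ₗ LinearMap.mulRight ℂ (x * y) ∘ₗ
      (CentralForms n).val.toLinearMap ∘ₗ
        LinearMap.mulLeft ℂ (c.flag b I * c.omega ^ (n - M)))
    refine h1.congr fun u => ?_
    simp [hz, mul_assoc]
  have hH : Continuous H := continuous_matrix fun i j => hcontz _ _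
  have hB : Continuous B := by
    refine continuous_matrix fun i j => ?_
    have h1 := weaklyContinuous_segment_mul (c := c) α (X := fun _ => 1) (fun φ => continuous_const)
      (LinearMap.proj i ∘ₗ φ ∘ₗ LinearMap.mulRight ℂ (w j) ∘ₗ (CentralForms n).val.toLinearMap)
    refine h1.congr fun u => ?_
    simp [B]
  have herm (u : unitInterval) : (H u).IsHermitian := by
    refine Matrix.IsHermitian.ext fun i j => ?_
    exact (c.pairing_comm ht hvol (hzreal u) (by rw [hlen]; omega) (hv i) (hv j)).symm
  have hdet (u : unitInterval) : (H u).det ≠ 0 := by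
    rw [Ne, ← Matrix.exists_mulVec_eq_zero_iff]
    rintro ⟨y, hy, hHy0⟩
    refine hy (hnd _ (hlu u) (hlen u) y fun i => ?_)
    rw [← hHy, hHy0]
    rfl
  -- Up to sign this is the Gram matrix of the pairing with z ∧ α ∧ α on (k-2)-forms.
  have hdet' (u : unitInterval) : ((B u)ᴴ * H u * B u).det ≠ 0 := by
    rw [Ne, ← Matrix.exists_mulVec_eq_zero_iff]
    rintro ⟨y, hy, hy0⟩
    refine hy (hnd' _ (hlu u) (hlen u) _ (hαu u) y fun j => ?_)
    rw [← Matrix.mulVec_mulVec, ← Matrix.mulVec_mulVec] at hy0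
    have h1 := congrFun hy0 j
    have hmem : (c.segment u α : Forms n) * ∑ j, y j • w j ∈ formsOfDegree n k := by
      rw [Finset.mul_sum]
      exact sum_mem fun j _ => by
        rw [mul_smul_comm]
        exact Submodule.smul_mem _ _ (hw _ (hαu u) j)
    rw [hBH, hBy, hz, mul_assoc, pairing_congr_left (c.isRealForm_flag b I).weil_eq (hφ _ hmem),
      ← mul_assoc, pairing_mul_left (hαu u).isRealForm] at h1
    simpa using h1
  have hprimu (u : unitInterval) (y : Fin m → ℂ) (hy : (B u)ᴴ *ᵥ (H u *ᵥ y) = 0) :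
      ((z u * c.segment u α : CentralForms n) : Forms n) * (∑ i, y i • v i) = 0 := by
    refine hprim _ (hlu u) (hlen u) _ (hαu u) _
      (sum_mem fun i _ => Submodule.smul_mem _ _ (hv i)) fun j => ?_
    have := congrFun hy j
    rw [hBH] at this
    simpa using this
  have h₁ : ∀ y ≠ 0, (B 1)ᴴ *ᵥ (H 1 *ᵥ y) = 0 → 0 < (star y ⬝ᵥ H 1 *ᵥ y).re := by
    intro y hy hB0
    have hz1 : z 1 = c.flag b I * (c.omega ^ (n - M) * c.omega ^ l.length) := by
      simp only [hz]
      congr 2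
      rw [List.prod_eq_pow_card _ c.omega, List.length_map]
      intro β hβ
      obtain ⟨β', -, rfl⟩ := List.mem_map.mp hβ
      exact segment_one β'
    have h1 := hprimu 1 y hB0
    rw [hz1, segment_one] at h1
    obtain ⟨h2, h3⟩ := hodge_riemann_omega ht hvol hM hk b hI
      (sum_mem fun i _ => Submodule.smul_mem _ _ (hv i)) h1
    rw [hyHy, hz1]
    have h4 : pairing t (c.flag b I * (c.omega ^ (n - M) * c.omega ^ l.length))
        (∑ i, y i • v i) (∑ i, y i • v i) ≠ 0 := fun h5 => hy (hinj y (h3 h5))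
    exact (Complex.pos_iff.mp (lt_of_le_of_ne h2 h4.symm)).1
  have hz0 : z 0 = c.flag b I * (c.omega ^ (n - M) * l.prod) := by
    simp only [hz]
    congr 3
    conv_rhs => rw [← List.map_id l]
    exact List.map_congr_left fun β _ => segment_zero β
  have hreal0 := hzreal 0
  have hself : pairing t (z 0) (∑ i, φ x i • v i) (∑ i, φ x i • v i) = pairing t (z 0) x x := by
    rw [hz, pairing_congr_left (c.isRealForm_flag b I).weil_eq (hφ x hx),
      pairing_congr_right (c.isRealForm_flag b I) (hφ x hx)]
  have him : (pairing t (z 0) x x).im = 0 := by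
    rw [← Complex.conj_eq_iff_im]
    exact (c.pairing_comm ht hvol hreal0 (by rw [hlen]; omega) hx hx).symm
  rw [← hz0] at h0 ⊢
  -- Then x is zero modulo the flag; otherwise its coordinate vector is nonzero and primitive, and
  -- the deformation lemma applies at u = 0.
  by_cases hy : φ x = 0
  · have h1 : (c.flag b I : Forms n) * x = 0 := by
      rw [← hφ x hx, hy]
      simp
    have h2 : pairing t (z 0) x x = 0 := by
      rw [← hself, hy]
      simp [pairing]
    exact ⟨h2.ge, fun _ => h1⟩
  have hB0 : (B 0)ᴴ *ᵥ (H 0 *ᵥ φ x) = 0 := by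
    funext j
    have h1 := congrArg weil h0
    rw [← segment_zero α] at h1
    rw [hBH, hz, mul_assoc, pairing_congr_left (c.isRealForm_flag b I).weil_eq (hφ x hx),
      ← mul_assoc,
      pairing, ← mul_assoc]
    rw [map_mul, (hreal0.mul (hαu 0).isRealForm).weil_eq, map_zero] at h1
    rw [h1, zero_mul, map_zero, neg_zero]
    rfl
  have hpos := pos_of_deformation hH hB herm hdet hdet' h₁ 0 hy hB0
  rw [hyHy, hself] at hpos
  refine ⟨Complex.nonneg_iff.mpr ⟨hpos.le, him.symm⟩, fun h1 => ?_⟩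
  rw [h1] at hpos
  exact absurd hpos (lt_irrefl _)

theorem lefschetz_and_hodgeRiemann (ht : IsIntegral t) (hvol : t c.vol = 1) {M : ℕ} (hM : M ≤ n)
    (s : ℕ) : c.Lefschetz M s ∧ c.HodgeRiemann t M s := by
  by_cases hs : M < s
  -- For s > M no list and degree satisfy s + length + k = M, so the descending induction starts
  -- vacuously.
  · exact ⟨fun _ _ _ _ _ _ _ => by omega, fun _ _ _ _ _ _ _ _ _ => by omega⟩
  · have h := lefschetz_of_hodgeRiemann hM (lefschetz_and_hodgeRiemann ht hvol hM (s + 1)).2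
    exact ⟨h, hodgeRiemann_of_lefschetz ht hvol hM h⟩
termination_by M + 1 - s

end Coframe

end

end LinearHRR

namespace LinearHRR

noncomputable section

open ExteriorAlgebra

variable {n : ℕ}

/-! ### The standard coframe -/

/-- The covector `∂/∂z_j` or `∂/∂z̄_j`, depending on the sign `r = ∓ i`. -/
def wirtinger (r : ℂ) (j : Fin n) : Covector n where
  toFun ξ := (ξ (Pi.single j 1) + r * ξ (Pi.single j Complex.I)) / 2
  map_add' ξ η := by
    simp only [LinearMap.add_apply]
    ring
  map_smul' a ξ := by
    simp only [LinearMap.smul_apply, smul_eq_mul, RingHom.id_apply]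
    ring

theorem wirtinger_apply (r : ℂ) (j : Fin n) (ξ : Cotangent n) :
    wirtinger r j ξ = (ξ (Pi.single j 1) + r * ξ (Pi.single j Complex.I)) / 2 := rfl

/-- The coordinate functionals. -/
def coordinate (j : Fin n) : Cotangent n :=
  (LinearMap.proj j : (Fin n → ℂ) →ₗ[ℂ] ℂ).restrictScalars ℝ

theorem coordinate_apply (j : Fin n) (v : Fin n → ℂ) : coordinate j v = v j := rfl

theorem conj_coordinate_apply (j : Fin n) (v : Fin n → ℂ) :
    conjCotangent (coordinate j) v = starRingEnd ℂ (v j) := rfl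

theorem apply_eq_sum_re_im (ξ : Cotangent n) (v : Fin n → ℂ) :
    ξ v = ∑ j, (((v j).re : ℂ) * ξ (Pi.single j 1) +
      ((v j).im : ℂ) * ξ (Pi.single j Complex.I)) := by
  have h : v = ∑ j, ((v j).re • (Pi.single j 1 : Fin n → ℂ) +
      (v j).im • (Pi.single j Complex.I : Fin n → ℂ)) := by
    funext i
    rw [Finset.sum_apply]
    simp only [Pi.add_apply, Pi.smul_apply, Pi.single_apply, Complex.real_smul]
    rw [Finset.sum_eq_single i]
    · simp
    · intro j _ hj
      simp [hj.symm]
    · simp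
  conv_lhs => rw [h, map_sum]
  refine Finset.sum_congr rfl fun j _ => ?_
  rw [map_add, map_smul, map_smul, Complex.real_smul, Complex.real_smul]

/-- The coframe of the coordinate forms. -/
def stdCoframe (n : ℕ) : Coframe n where
  e := coordinate
  d := wirtinger (-Complex.I)
  db := wirtinger Complex.I
  d_e i j := by
    rw [wirtinger_apply, coordinate_apply, coordinate_apply]
    rcases eq_or_ne i j with rfl | h
    · simp
    · simp [h, h.symm]
  d_conj i j := by
    rw [wirtinger_apply, conj_coordinate_apply, conj_coordinate_apply]
    rcases eq_or_ne i j with rfl | h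
    · simp
    · simp [h.symm]
  db_e i j := by
    rw [wirtinger_apply, coordinate_apply, coordinate_apply]
    rcases eq_or_ne i j with rfl | h
    · simp
    · simp [h.symm]
  db_conj i j := by
    rw [wirtinger_apply, conj_coordinate_apply, conj_coordinate_apply]
    rcases eq_or_ne i j with rfl | h
    · simp
    · simp [h, h.symm]
  complete ξ := by
    refine LinearMap.ext fun v => ?_
    rw [apply_eq_sum_re_im ξ v, LinearMap.sum_apply]
    refine Finset.sum_congr rfl fun j _ => ?_
    rw [LinearMap.add_apply, LinearMap.smul_apply, LinearMap.smul_apply, wirtinger_apply,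
      wirtinger_apply, conj_coordinate_apply, coordinate_apply, smul_eq_mul, smul_eq_mul,
      Complex.re_eq_add_conj, Complex.im_eq_sub_conj]
    field_simp
    linear_combination (ξ (Pi.single j Complex.I) * (starRingEnd ℂ (v j) - v j)) * Complex.I_sq
  rotate_e j := by
    refine LinearMap.ext fun v => ?_
    rw [rotate_apply, LinearMap.smul_apply, coordinate_apply, coordinate_apply]
    rfl

theorem stdVolume_eq : stdVolume n = ((stdCoframe n).vol : Forms n) := by
  rw [stdVolume, Coframe.vol_eq_list, List.ofFn_eq_map]
  have := map_list_prod (CentralForms n).val ((List.finRange n).map (stdCoframe n).th)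
  rw [List.map_map] at this
  exact this.symm

open scoped Matrix in
-- The coefficients are conjugated because (yᴴ y)_{jk} = ∑ conj(y_{lj}) y_{lk}, where the conjugated
-- factor belongs to dz_j.
theorem formOfMatrix_eq_sum (y : Matrix (Fin n) (Fin n) ℂ) : formOfMatrix (yᴴ * y) =
    ((∑ l, (stdCoframe n).sq (WithLp.toLp 2 fun j => starRingEnd ℂ (y l j)) : CentralForms n) :
      Forms n) := by
  have h : ((∑ l, (stdCoframe n).sq (WithLp.toLp 2 fun j => starRingEnd ℂ (y l j)) :
      CentralForms n) : Forms n) = ∑ l, Complex.I •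
        ((∑ j, starRingEnd ℂ (y l j) • dz j) * (∑ k, y l k • dzbar k)) := by
    rw [AddSubmonoidClass.coe_finsetSum]
    refine Finset.sum_congr rfl fun l _ => ?_
    rw [Coframe.sq, coe_theta, Coframe.conj_lin, Coframe.lin_apply, map_sum, map_sum]
    simp only [map_smul, Complex.conj_conj]
    rfl
  rw [h, formOfMatrix, ← Finset.smul_sum]
  congr 1
  simp_rw [Finset.sum_mul_sum, smul_mul_smul_comm, Matrix.mul_apply, Finset.sum_smul,
    Matrix.conjTranspose_apply]
  conv_rhs => rw [Finset.sum_comm]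
  refine Finset.sum_congr rfl fun j _ => ?_
  rw [Finset.sum_comm]
  rfl

open scoped MatrixOrder ComplexOrder Matrix in
theorem exists_conjTranspose_mul_self {A : Matrix (Fin n) (Fin n) ℂ} (hA : A.PosSemidef) :
    ∃ y : Matrix (Fin n) (Fin n) ℂ, A = yᴴ * y :=
  CStarAlgebra.nonneg_iff_eq_star_mul_self.mp hA.nonneg

open scoped ComplexOrder in
-- In a factorisation A = yᴴ y of a positive definite matrix y is invertible, so its conjugated rows
-- form a basis, and this basis diagonalises ω.
theorem IsKahler.exists_coframe {ω : Forms n} (h : IsKahler ω) :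
    ∃ f : Coframe n, ω = (f.omega : Forms n) := by
  obtain ⟨A, hA, rfl⟩ := h
  obtain ⟨y, rfl⟩ := exists_conjTranspose_mul_self hA.posSemidef
  have hy : IsUnit (y.map (starRingEnd ℂ)) := by
    have h1 := (Matrix.isUnit_iff_isUnit_det _).mp hA.isUnit
    rw [Matrix.det_mul, IsUnit.mul_iff] at h1
    have h2 : y.map (starRingEnd ℂ) = (y.conjTranspose).transpose := rfl
    rw [Matrix.isUnit_iff_isUnit_det, h2, Matrix.det_transpose]
    exact h1.1
  have hli : LinearIndependent ℂ fun l : Fin n =>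
      (WithLp.toLp 2 fun j => starRingEnd ℂ (y l j) : Coeffs n) :=
    (Matrix.linearIndependent_rows_iff_isUnit.mpr hy).map'
      (WithLp.linearEquiv 2 ℂ _).symm.toLinearMap
      (LinearEquiv.ker _)
  let b : Module.Basis (Fin n) ℂ (Coeffs n) :=
    Module.Basis.mk hli (hli.span_eq_top_of_card_eq_finrank' (by simp)).ge
  refine ⟨(stdCoframe n).ofBasis b, ?_⟩
  rw [formOfMatrix_eq_sum, Coframe.omega]
  congr 1
  refine Finset.sum_congr rfl fun l _ => ?_
  have h3 : b l = WithLp.toLp 2 fun j => starRingEnd ℂ (y l j) := by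
    simp [b]
  rw [← h3]
  rfl

/-! ### Translation of positivity into a coframe adapted to the metric -/

namespace Coframe

variable (f : Coframe n)

theorem exists_sq_eq (w : Coeffs n) (c : Coframe n) : ∃ w', c.sq w = f.sq w' := by
  obtain ⟨w', hw'⟩ := exists_lin_eq (c := f) (c.rotate_lin w)
  exact ⟨w', by rw [sq, hw', sq]⟩

open scoped ComplexOrder in
theorem exists_sum_sq_of_isSemipositive {α : Forms n} (h : IsSemipositive α) :
    ∃ w : Fin n → Coeffs n, α = ((∑ l, f.sq (w l) : CentralForms n) : Forms n) := by
  obtain ⟨A, hA, rfl⟩ := h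
  obtain ⟨y, rfl⟩ := exists_conjTranspose_mul_self hA
  choose w hw using fun l : Fin n => f.exists_sq_eq
    (WithLp.toLp 2 fun j => starRingEnd ℂ (y l j)) (stdCoframe n)
  refine ⟨w, ?_⟩
  rw [formOfMatrix_eq_sum]
  simp_rw [hw]

/-- Expanding the power gives products of m squares of vectors in a space of dimension less than m.
-/
theorem sum_sq_pow_eq_zero {N m : ℕ} (w : Fin N → Coeffs n)
    (h : Module.finrank ℂ (Submodule.span ℂ (Set.range w)) < m) :
    (∑ l, f.sq (w l)) ^ m = 0 := by
  rw [Fintype.sum_pow]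
  refine Finset.sum_eq_zero fun p _ => ?_
  have h1 := f.prod_sq_eq_zero (U := Submodule.span ℂ (Set.range w)) (List.ofFn fun i => w (p i))
    (fun v hv => by
      obtain ⟨i, rfl⟩ := List.mem_ofFn.mp hv
      exact Submodule.subset_span (Set.mem_range_self _)) (by simpa using h)
  rwa [List.map_ofFn, List.prod_ofFn] at h1

theorem stdVolume_ne_zero : stdVolume n ≠ 0 := by
  rw [stdVolume_eq]
  exact fun h => (stdCoframe n).vol_ne_zero (Subtype.ext h)

theorem exists_isGood {m : ℕ} {ω α : Forms n} (h : IsMPositive m ω α) (hs : IsSemipositive α) :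
    ∃ β : CentralForms n, α = (β : Forms n) ∧ f.IsGood m β := by
  obtain ⟨w, hw⟩ := f.exists_sum_sq_of_isSemipositive hs
  refine ⟨_, hw, List.ofFn w, ?_, ?_⟩
  · rw [List.map_ofFn, List.sum_ofFn]
    rfl
  · have hset : {v | v ∈ List.ofFn w} = Set.range w := by
      ext v
      simp [List.mem_ofFn]
    rw [hset]
    by_contra! hlt
    -- Only the case k = m of m-positivity enters, through α^m ≠ 0; a smaller span would make α^m
    -- vanish.
    obtain ⟨r, hr, h0⟩ := h.2 m (by omega) le_rfl
    have h1 : α ^ m = 0 := by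
      rw [hw, ← Subalgebra.coe_pow, f.sum_sq_pow_eq_zero w hlt, Subalgebra.coe_zero]
    rw [h1, zero_mul, eq_comm, smul_eq_zero] at h0
    exact h0.elim (by exact_mod_cast hr.ne') stdVolume_ne_zero

/-- Up to sign conventions nothing is computed: the standard volume is a nonzero product of n
squares, hence a positive multiple of a full flag, whose product is the volume form of the coframe.
-/
theorem exists_isPositiveTop {Γ : Forms n} (h : IsPositiveTop Γ) :
    ∃ r : ℝ, 0 < r ∧ Γ = (r : ℂ) • (f.vol : Forms n) := by
  obtain ⟨a, ha, rfl⟩ := h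
  choose w hw using fun j : Fin n => f.exists_sq_eq
    (EuclideanSpace.basisFun (Fin n) ℂ j) (stdCoframe n)
  have h1 : (stdCoframe n).vol = ((List.ofFn w).map f.sq).prod := by
    rw [List.map_ofFn, List.prod_ofFn, vol]
    exact Finset.prod_congr rfl fun j _ => by rw [th_eq_sq, hw]; rfl
  rw [stdVolume_eq, h1]
  rcases f.prod_sq (U := ⊤) (List.ofFn w) (fun _ _ => trivial) with h2 | ⟨r, b, I, hr, hI, -, h2⟩
  · exact absurd (h1.trans h2) (stdCoframe n).vol_ne_zero
  · refine ⟨a * r, mul_pos ha hr, ?_⟩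
    have h3 : I = Finset.univ := by
      rw [← Finset.card_eq_iff_eq_univ, hI, List.length_ofFn, Fintype.card_fin]
    have h4 : f.flag b I = (f.change b).vol := by
      rw [h3, flag, vol]
      exact Finset.prod_congr rfl fun j _ => (f.change_th b j).symm
    rw [h2, h4, Subalgebra.coe_smul, change_vol, smul_smul]
    push_cast
    rfl

/-- By Poincaré duality against constants, a form of top degree is its integral times the volume
form, so the quotient exists and is unique. -/
theorem divTop_eq {t : Forms n →ₗ[ℂ] ℂ} (ht : IsIntegral t) (hvol : t f.vol = 1) {η : Forms n}
    (hη : η ∈ formsOfDegree n (2 * n)) {r : ℝ} (hr : 0 < r) :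
    divTop η ((r : ℂ) • (f.vol : Forms n)) = t η / r := by
  have hr' : (r : ℂ) ≠ 0 := by exact_mod_cast hr.ne'
  have h1 : η = t η • (f.vol : Forms n) := by
    rw [← sub_eq_zero]
    refine f.eq_zero_of_integral_mul_eq_zero_of_mem ht hvol (l := 0) (add_zero _)
      (sub_mem hη (Submodule.smul_mem _ _ f.isRealForm_vol.mem)) fun y hy => ?_
    obtain ⟨a, rfl⟩ := mem_formsOfDegree_zero hy
    rw [← Algebra.commutes, ← Algebra.smul_def, map_smul, map_sub, map_smul, hvol]
    simp
  have h2 : ∃ a : ℂ, η = a • ((r : ℂ) • (f.vol : Forms n)) :=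
    ⟨t η / r, by rw [smul_smul, div_mul_cancel₀ _ hr', ← h1]⟩
  rw [divTop, dif_pos h2, eq_div_iff hr']
  conv_rhs => rw [h2.choose_spec]
  rw [smul_smul, map_smul, hvol, smul_eq_mul, mul_one]

end Coframe

/-! ### Forms of type `(p,q)` -/

/-- Forms of degree `k` that are eigenvectors of the Weil operator. -/
def weilEigenforms (n k : ℕ) (μ : ℂ) : Submodule ℂ (Forms n) :=
  formsOfDegree n k ⊓ LinearMap.ker ((weil : Forms n →ₐ[ℂ] Forms n).toLinearMap - μ • LinearMap.id)

theorem mem_weilEigenforms {k : ℕ} {μ : ℂ} {x : Forms n} :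
    x ∈ weilEigenforms n k μ ↔ x ∈ formsOfDegree n k ∧ weil x = μ • x := by
  rw [weilEigenforms, Submodule.mem_inf, LinearMap.mem_ker, LinearMap.sub_apply, sub_eq_zero]
  rfl

theorem weilEigenforms_mul_le (k l : ℕ) (μ ν : ℂ) :
    weilEigenforms n k μ * weilEigenforms n l ν ≤ weilEigenforms n (k + l) (μ * ν) := by
  refine Submodule.mul_le.mpr fun x hx y hy => ?_
  rw [mem_weilEigenforms] at hx hy ⊢
  exact ⟨mul_mem_formsOfDegree hx.1 hy.1, by rw [map_mul, hx.2, hy.2, smul_mul_smul_comm]⟩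

theorem pow_le_weilEigenforms {S : Submodule ℂ (Forms n)} {μ : ℂ} (h : S ≤ weilEigenforms n 1 μ)
    (p : ℕ) : S ^ p ≤ weilEigenforms n p (μ ^ p) := by
  induction p with
  | zero =>
    rw [pow_zero]
    intro x hx
    obtain ⟨a, rfl⟩ := Submodule.mem_one.mp hx
    rw [mem_weilEigenforms]
    exact ⟨algebraMap_mem_formsOfDegree a, by simp⟩
  | succ p ih =>
    rw [pow_succ, pow_succ]
    exact (mul_le_mul' ih h).trans (weilEigenforms_mul_le _ _ _ _)

theorem formsOfType_le (p q : ℕ) :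
    formsOfType n p q ≤ weilEigenforms n (p + q) (Complex.I ^ p * (-Complex.I) ^ q) := by
  refine (mul_le_mul' (pow_le_weilEigenforms (Submodule.span_le.mpr ?_) p)
    (pow_le_weilEigenforms (Submodule.span_le.mpr ?_) q)).trans (weilEigenforms_mul_le _ _ _ _)
  · rintro _ ⟨j, rfl⟩
    refine mem_weilEigenforms.mpr ⟨ι_mem_formsOfDegree _, ?_⟩
    rw [dz, weil_ι, ← map_smul]
    exact congrArg _ ((stdCoframe n).rotate_e j)
  · rintro _ ⟨j, rfl⟩
    refine mem_weilEigenforms.mpr ⟨ι_mem_formsOfDegree _, ?_⟩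
    rw [dzbar, weil_ι, ← map_smul, rotate_conjCotangent]
    have h := congrArg conjCotangent ((stdCoframe n).rotate_e j)
    rw [conjCotangent_smul, Complex.conj_I] at h
    exact congrArg _ h

theorem Q_eq_pairing {f : Coframe n} {t : Forms n →ₗ[ℂ] ℂ} (ht : IsIntegral t)
    (hvol : t f.vol = 1) {d p q : ℕ} (hd : d + (p + q) = n) {z : CentralForms n}
    (hz : IsRealForm d z) {r : ℝ} (hr : 0 < r) {Φ Ψ : Forms n} (hΦ : Φ ∈ formsOfType n p q)
    (hΨ : Ψ ∈ formsOfType n p q) :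
    Q p q (z : Forms n) ((r : ℂ) • (f.vol : Forms n)) Φ Ψ = pairing t z Φ Ψ / r := by
  obtain ⟨hΦd, hΦw⟩ := mem_weilEigenforms.mp (formsOfType_le p q hΦ)
  obtain ⟨hΨd, -⟩ := mem_weilEigenforms.mp (formsOfType_le p q hΨ)
  have hdeg : (z : Forms n) * Φ * conj Ψ ∈ formsOfDegree n (2 * n) := by
    have := mul_mem_formsOfDegree (mul_mem_formsOfDegree hz.mem hΦd) (conj_mem_formsOfDegree hΨd)
    rwa [show 2 * d + (p + q) + (p + q) = 2 * n by omega] at this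
  rw [Q, f.divTop_eq ht hvol hdeg hr, pairing, hΦw, adj, rev_of_mem (conj_mem_formsOfDegree hΨd),
    smul_mul_smul_comm, mul_smul_comm, map_smul, smul_eq_mul, ← mul_assoc (z : Forms n),
    ← mul_div_assoc]
  congr 2
  -- With k = p + q, the two sign exponents differ by k, and i^{q-p} (-1)^{p+q} = i^{p-q} is the
  -- eigenvalue of the Weil operator.
  have h1 : (p + q) * (p + q + 1) / 2 = (p + q) * (p + q - 1) / 2 + (p + q) := by
    rcases Nat.eq_zero_or_pos (p + q) with h | h
    · rw [h]
    · rw [← Nat.add_mul_div_right _ _ two_pos]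
      congr 1
      obtain ⟨k, hk⟩ := Nat.exists_eq_add_of_lt h
      rw [hk]
      simp only [zero_add, Nat.add_sub_cancel]
      ring
  have h2 : Complex.I ^ ((q : ℤ) - (p : ℤ)) = Complex.I ^ q * (-Complex.I) ^ p := by
    rw [zpow_sub₀ Complex.I_ne_zero, zpow_natCast, zpow_natCast, div_eq_mul_inv, ← inv_pow,
      Complex.inv_I]
  rw [h1, h2, pow_add, pow_add, neg_pow Complex.I p, neg_pow Complex.I q]
  have h3 : ((-1 : ℂ) ^ p) * (-1) ^ p = 1 := by rw [← mul_pow]; simp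
  linear_combination (Complex.I ^ q * Complex.I ^ p * (-1) ^ ((p + q) * (p + q - 1) / 2) *
    (-1) ^ q) * h3

end

end LinearHRR

/-! ### The mixed Hodge–Riemann relations -/

theorem mainTheorem2 (n m p q : ℕ) (hpq : p + q ≤ m) (hmn : m ≤ n)
    (ω Γ : LinearHRR.Forms n) (hω : LinearHRR.IsKahler ω) (hΓ : LinearHRR.IsPositiveTop Γ)
    (α : Fin (m - p - q + 1) → LinearHRR.Forms n)
    (hα_pos : ∀ j, LinearHRR.IsMPositive m ω (α j))
    (hα_semi : ∀ j, LinearHRR.IsSemipositive (α j))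
    (Ω : LinearHRR.Forms n)
    (hΩ : Ω = LinearHRR.mixedForm m ω (fun j : Fin (m - p - q) => α j.castSucc)) :
    LinearHRR.IsPositiveDefiniteOn (LinearHRR.Q p q Ω Γ)
      (LinearHRR.primitiveForms p q (Ω * α (Fin.last (m - p - q)))) := by
  open LinearHRR in
  obtain ⟨f, rfl⟩ := hω.exists_coframe
  obtain ⟨r, hr, rfl⟩ := f.exists_isPositiveTop hΓ
  choose β hβα hβ using fun j => f.exists_isGood (hα_pos j) (hα_semi j)
  have ht := f.isIntegral_integral
  have hvol := f.integral_vol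
  set l : List (CentralForms n) := List.ofFn fun j : Fin (m - p - q) => β j.castSucc with hl
  have hlgood : ∀ z ∈ l, f.IsGood m z := by
    intro z hz
    obtain ⟨j, rfl⟩ := List.mem_ofFn.mp hz
    exact hβ _
  have hlen : l.length = m - p - q := List.length_ofFn
  let b := EuclideanSpace.basisFun (Fin n) ℂ
  -- The case s = 0: with the empty flag nothing is divided out, so vanishing modulo the flag is
  -- vanishing.
  have hflag : f.flag b ∅ = 1 := Finset.prod_empty
  have hreal := Coframe.isRealForm_mixed hmn b ∅ hlgood
  set z : CentralForms n := f.flag b ∅ * (f.omega ^ (n - m) * l.prod) with hz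
  have hΩz : Ω = (z : Forms n) := by
    have h1 := map_list_prod (CentralForms n).val l
    rw [hl, List.map_ofFn] at h1
    rw [hΩ, mixedForm, hz, hflag, one_mul, Subalgebra.coe_mul, Subalgebra.coe_pow]
    congr 1
    rw [funext fun j : Fin (m - p - q) => hβα j.castSucc]
    exact h1.symm
  rw [hΩz, hβα]
  have hd : (∅ : Finset (Fin n)).card + (n - m + l.length) + (p + q) = n := by
    rw [hlen, Finset.card_empty]
    omega
  refine ⟨fun Φ hΦ Ψ hΨ => ?_, fun Φ hΦ hΦ0 => ?_⟩
  · obtain ⟨hΦd, -⟩ := mem_weilEigenforms.mp (formsOfType_le p q hΦ.1)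
    obtain ⟨hΨd, -⟩ := mem_weilEigenforms.mp (formsOfType_le p q hΨ.1)
    rw [Q_eq_pairing ht hvol hd hreal hr hΨ.1 hΦ.1, Q_eq_pairing ht hvol hd hreal hr hΦ.1 hΨ.1,
      map_div₀, Complex.conj_ofReal, f.pairing_comm ht hvol hreal hd hΦd hΨd]
  · obtain ⟨hΦd, -⟩ := mem_weilEigenforms.mp (formsOfType_le p q hΦ.1)
    rw [Q_eq_pairing ht hvol hd hreal hr hΦ.1 hΦ.1]
    obtain ⟨h1, h2⟩ := (Coframe.lefschetz_and_hodgeRiemann ht hvol hmn 0).2 b ∅ Finset.card_empty l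
      hlgood _ (hβ _) (p + q) (by rw [hlen]; omega) Φ hΦd
      (by rw [Subalgebra.coe_mul]; exact hΦ.2)
    rw [← hz] at h1 h2
    have h3 : pairing f.integral z Φ Φ ≠ 0 := fun h => hΦ0 (by
      have := h2 h
      rwa [hflag, Subalgebra.coe_one, one_mul] at this)
    rw [Complex.div_ofReal_im, Complex.div_ofReal_re]
    obtain ⟨h4, h5⟩ := Complex.nonneg_iff.mp h1
    refine ⟨by rw [← h5, zero_div], div_pos (lt_of_le_of_ne h4 fun h => h3 ?_) hr⟩
    exact Complex.ext h.symm h5.symm
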